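/- Let $k$ be a field of characteristic $0$, $\bar k$ an algebraic closure of $k$, and $d\ge 1$ an integer. Let ${\mathcal M}$ be the Grothendieck ring of algebraic varieties over $k$ (reduced separated schemes of finite type): it is generated by symbols $[S]$ with the relations $[S]=[S']$ if $S\simeq S'$, $[S]=[S\setminus Z]+[Z]$ for $Z$ closed in $S$, $[S\times S']=[S][S']$, with unit $[{\rm Spec}\,k]$. Put ${\bf L}=[{\mathbb A}^1_k]$ and ${\mathcal M}_{\rm loc}={\mathcal M}[{\bf L}^{-1}]$. A constructible subset $C$ of a variety (a set of closed points, or equivalently a set of $\bar k$-points that is constructible over $k$) has a class $[C]\in{\mathcal M}$, the sum of the classes of the pieces of a finite partition of $C$ into locally closed subvarieties. Infinite Grassmannian. Let ${\mathcal Gr}_{(n)}$ be the projective variety of $k[[t]]$-submodules $H$ with $t^nk[[t]]^d\subset H\subset t^{-n}k[[t]]^d$ (a closed subvariety of the Grassmannian of $t^{-n}k[[t]]^d/t^nk[[t]]^d$), and ${\mathcal Gr}=\bigcup_n{\mathcal Gr}_{(n)}$. For $H$ in ${\mathcal Gr}_{(n)}$ put ${\rm index}(H)=\dim (t^{-n}k[[t]]^d/H)-nd$,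 which does not depend on $n$, and let ${\mathcal Gr}[m]$ be the set of $H$ of index $m$ (for points over an extension $K$ of $k$, replace $k$ by $K$). A subset $A$ of ${\mathcal Gr}$ is gr-stable at level $n$ if it is a constructible subset of ${\mathcal Gr}_{(n)}$, and gr-stable if it is so at some level; then $$\tilde\mu_{\mathcal Gr}(A):=\sum_{m\in{\mathbb Z}}[A\cap{\mathcal Gr}[m]]\,{\bf L}^{-md}\in{\mathcal M}_{\rm loc},$$ a finite sum. Arcs. Let ${\rm M}_d$ be the affine space of $d\times d$ matrices, ${\mathcal L}({\rm M}_d)$ its arc space, with points the matrices over $\bar k[[t]]$, and $\pi_l$ the truncation modulo $t^{l+1}$, with values in ${\mathcal L}_l({\rm M}_d)\simeq{\mathbb A}_k^{(l+1)d^2}$. A subset of ${\mathcal L}({\rm M}_d)$ is cylindrical at level $l$ if it is $\pi_l^{-1}(C)$ with $C$ constructible. If $B\subset{\bf GL}_d(k((t)))$ and $t^NB$ consists of matrices over $\bar k[[t]]$ and is cylindrical at level $l$ in ${\mathcal L}({\rm M}_d)$, put $\tilde\mu(B):={\bf L}^{d^2N}\,[\pi_l(t^NB)]\,{\bf L}^{-(l+1)d^2}\in{\mathcal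 M}_{\rm loc}$, which does not depend on $N,l$. Let $\Theta:{\bf GL}_d(k((t)))\to{\mathcal Gr}$ send $M$ to the lattice $M\,k[[t]]^d$ spanned by its columns. (1) If $A\subset{\mathcal Gr}$ is gr-stable at level $n$, then $t^n\Theta^{-1}(A)=\Theta^{-1}(t^nA)$ is cylindrical at level $2n$, and $$\tilde\mu_{\mathcal Gr}(A)=(1-{\bf L}^{-1})^{-1}\cdots(1-{\bf L}^{-d})^{-1}\,\tilde\mu(\Theta^{-1}(A)).$$ Precisely, $\tilde\mu(\Theta^{-1}(A))=\prod_{i=1}^d(1-{\bf L}^{-i})\;\tilde\mu_{\mathcal Gr}(A)$ in ${\mathcal M}_{\rm loc}$, and hence the displayed formula holds after applying any homomorphism from ${\mathcal M}_{\rm loc}$ to a commutative ring in which the images of $1-{\bf L}^{-1},\dots,1-{\bf L}^{-d}$ are invertible. (2) Let ${\mathfrak L}$ be a Lie algebra over $k[[t]]$ with an injective $k[[t]]$-linear map ${\mathfrak L}\to k((t))^d$ whose image contains $k[[t]]^d$, and let $L_0\subset{\mathfrak L}$ be the inverse image of $k[[t]]^d$. (Examples: ${\mathfrak L}=L_0$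 a $k[[t]]$-Lie algebra, free of rank $d$ as a module, with a basis; or ${\mathfrak L}$ a $d$-dimensional $k((t))$-Lie algebra with a $k[[t]]$-submodule $L_0$ spanned by a basis.) A class ${\mathcal X}$ of $k[[t]]$-subalgebras is the datum, for every finite extension $K$ of $k$, of a family ${\mathcal X}(K)$ of Lie subalgebras $H$ of ${\mathfrak L}\otimes_kK$ that are $K[[t]]$-submodules and commensurable with $L_0\otimes K$, that is, $H\cap(L_0\otimes K)$ has finite codimension in both; ${\rm codim}\,H$ is the sum of these two codimensions (the usual codimension if ${\mathfrak L}=L_0$). Each $H\in{\mathcal X}(K)$ defines a point of ${\mathcal Gr}$ over $K$; thus ${\mathcal X}$ is viewed as a subset of ${\mathcal Gr}$. Let $A_{l,n}({\mathcal X})$ be the set of points of ${\mathcal Gr}_{(l)}$ defined by the $H$ in ${\mathcal X}$ with ${\rm codim}\,H=n$, and suppose that ${\mathcal X}$ is constructible, i.e. all $A_{l,n}({\mathcal X})$ are constructible in ${\mathcal Gr}_{(l)}$. Then ${\mathcal X}$ is stable: for every $n$, the set $A_{l,n}({\mathcal X})$ does not depend on $l$ for $l$ large. The subsets of ${\mathcal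 X}$ on which ${\rm index}(H)\,d$ and ${\rm codim}\,H$ take fixed values $j$ and $n$ are gr-stable, and for fixed $n$ only finitely many of them are non-empty. The motivic zeta function $P_{{\mathfrak L},{\mathcal X}}(T):=\sum_{n\ge0}[A_n({\mathcal X})]T^n$, where $[A_n({\mathcal X})]=[A_{l,n}({\mathcal X})]$ for large $l$, satisfies, with $T={\bf L}^{-s}$ a formal variable, the following identity in ${\mathcal M}_{\rm loc}[[T]]$: $$P_{{\mathfrak L},{\mathcal X}}({\bf L}^{-s})=\int_{{\mathcal X}\subset{\mathcal Gr}}{\bf L}^{{\rm index}(H)\,d-({\rm codim}\,H)\,s}\,d\tilde\mu_{\mathcal Gr}(H),$$ where the right-hand side is by definition $$\sum_{n\ge0}\Bigl(\sum_{j\in{\mathbb Z}}{\bf L}^{j}\,\tilde\mu_{\mathcal Gr}\bigl(\{H\in{\mathcal X}:{\rm index}(H)\,d=j,\ {\rm codim}\,H=n\}\bigr)\Bigr)T^n.$$ -/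

import Mathlib

open AlgebraicGeometry CategoryTheory
open scoped PowerSeries LaurentSeries TensorProduct

universe u v w

noncomputable section

namespace MotivicGr

/-! ### Varieties over a field and their Grothendieck ring -/

section Varieties

variable (k : Type u) [Field k]

/-- An algebraic variety over `k`: a reduced separated scheme of finite type over `k`. -/
structure Variety where
  X : Over (Spec (CommRingCat.of k))
  reduced : IsReduced X.left
  separated : IsSeparated X.hom
  locallyOfFiniteType : LocallyOfFiniteType X.hom
  quasiCompact : QuasiCompact X.hom

/-- The affine variety `Spec R` of a reduced `k`-algebra `R` of finite type. -/
def affineVariety (R : Type u) [CommRing R] [Algebra k R] [_root_.IsReduced R]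
    [Algebra.FiniteType k R] : Variety k where
  X := Over.mk (Spec.map (CommRingCat.ofHom (algebraMap k R)))
  reduced := by
    dsimp
    infer_instance
  separated := by
    dsimp
    infer_instance
  locallyOfFiniteType := by
    dsimp
    rw [HasRingHomProperty.Spec_iff (P := @LocallyOfFiniteType)]
    exact (RingHom.finiteType_algebraMap).2 inferInstance
  quasiCompact := by
    dsimp
    infer_instance

/-- The affine space over `k` with coordinates indexed by the finite type `σ`. -/
def affineSpace (σ : Type) [Finite σ] : Variety k :=
  affineVariety k (MvPolynomial σ k)

/-- The defining relations of the Grothendieck ring: `[S] = [S']` for isomorphic varieties,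
`[S] = [S \ Z] + [Z]` for `Z` closed in `S`, `[S × S'] = [S] [S']`, and `[Spec k] = 1`. -/
def grothendieckRelations : Set (MvPolynomial (Variety k) ℤ) :=
  {p | ∃ S S' : Variety k, Nonempty (S.X ≅ S'.X) ∧
      p = MvPolynomial.X S - MvPolynomial.X S'} ∪
  {p | ∃ (S U Z : Variety k) (j : U.X ⟶ S.X) (i : Z.X ⟶ S.X),
      IsOpenImmersion j.left ∧ IsClosedImmersion i.left ∧
      Set.range j.left = (Set.range i.left)ᶜ ∧
      p = MvPolynomial.X S - (MvPolynomial.X U + MvPolynomial.X Z)} ∪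
  {p | ∃ (S S' P : Variety k) (a : P.X ⟶ S.X) (b : P.X ⟶ S'.X),
      IsPullback a.left b.left S.X.hom S'.X.hom ∧
      p = MvPolynomial.X P - MvPolynomial.X S * MvPolynomial.X S'} ∪
  {p | ∃ S : Variety k, IsIso S.X.hom ∧ p = MvPolynomial.X S - 1}

/-- The Grothendieck ring `ℳ` of algebraic varieties over `k`. -/
abbrev GrothendieckRing : Type (u + 1) :=
  MvPolynomial (Variety k) ℤ ⧸ Ideal.span (grothendieckRelations k)

variable {k} in
/-- The class `[S]` of a variety. -/
def Variety.cls (S : Variety k) : GrothendieckRing k :=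
  Ideal.Quotient.mk _ (MvPolynomial.X S)

/-- `𝐋 = [𝔸¹]`. -/
def lefschetz : GrothendieckRing k := (affineSpace k (Fin 1)).cls

/-- `ℳ_loc = ℳ[𝐋⁻¹]`. -/
abbrev GrothendieckRingLoc : Type (u + 1) := Localization.Away (lefschetz k)

/-- `𝐋` as a unit of `ℳ_loc`. -/
def lefschetzUnit : (GrothendieckRingLoc k)ˣ :=
  (IsLocalization.Away.algebraMap_isUnit (S := GrothendieckRingLoc k) (lefschetz k)).unit

/-- The integral power `𝐋 ^ m` in `ℳ_loc`. -/
def lefPow (m : ℤ) : GrothendieckRingLoc k := ((lefschetzUnit k ^ m : (GrothendieckRingLoc k)ˣ) :)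

end Varieties

/-! ### Constructible sets of geometric points and their classes

The closed points of a variety over `k` are the Galois orbits of its `F`-points, `F` being an
algebraic closure of `k`. A set of closed points is represented by the set of all `F`-points that
lie over it (a set of `F`-points which is constructible over `k` is automatically Galois-stable). A variety is presented by its standard affine charts, that is by the
parametrisations `φ i : F ^ σ i → Y` of pieces of its set `Y` of `F`-points. -/

section Constructible

variable (k : Type u) {F : Type u} [Field k] [Field F] [Algebra k F]

/-- The point of the affine space over `k` which underlies an `F`-point. -/
def affinePoint {σ : Type} [Finite σ] (x : σ → F) : (affineSpace k σ).X.left :=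
  (⟨RingHom.ker (MvPolynomial.aeval (R := k) x), RingHom.ker_isPrime _⟩ :
    PrimeSpectrum (MvPolynomial σ k))

variable {ι : Type} {σ : ι → Type} [∀ i, Finite (σ i)] {Y : Type u}

/-- `A` is a constructible set (over `k`): it is covered by the charts, and in every chart it is
given by a constructible subset of the affine space over `k`. -/
def IsConstructibleSet (φ : ∀ i, (σ i → F) → Y) (A : Set Y) : Prop :=
  A ⊆ ⋃ i, Set.range (φ i) ∧
  ∀ i, ∃ C : Set (affineSpace k (σ i)).X.left,
    Topology.IsConstructible C ∧ φ i ⁻¹' A = affinePoint k ⁻¹' C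

/-- `c = [A]`: the set `A` is the disjoint union of finitely many locally closed subvarieties, each
contained in a chart, and `c` is the sum of their classes. -/
def HasClass (φ : ∀ i, (σ i → F) → Y) (A : Set Y) (c : GrothendieckRing k) : Prop :=
  ∃ (r : ℕ) (i : Fin r → ι) (V : Fin r → Variety k)
    (f : ∀ j, (V j).X ⟶ (affineSpace k (σ (i j))).X),
    (∀ j, IsImmersion (f j).left) ∧
    Pairwise (fun j j' => Disjoint
      (φ (i j) '' (affinePoint k ⁻¹' Set.range (f j).left))
      (φ (i j') '' (affinePoint k ⁻¹' Set.range (f j').left))) ∧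
    A = ⋃ j, φ (i j) '' (affinePoint k ⁻¹' Set.range (f j).left) ∧
    c = ∑ j, (V j).cls

open Classical in
/-- The class `[A]` in `ℳ` of a constructible set. -/
def setClass (φ : ∀ i, (σ i → F) → Y) (A : Set Y) : GrothendieckRing k :=
  if h : ∃ c, HasClass k φ A c then h.choose else 0

/-- The single chart of an affine space. -/
def affineChart (F : Type u) (τ : Type) : Unit → (τ → F) → (τ → F) := fun _ x => x

end Constructible

/-! ### Relative dimensions -/

section Commensurable

variable (K : Type*) {V : Type*} [Field K] [AddCommGroup V] [Module K V]

/-- `dim A / (A ∩ B)`. -/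
def relDim (A B : Submodule K V) : ℕ := Module.finrank K (A ⧸ B.submoduleOf A)

/-- `A ∩ B` has finite codimension in `A` and in `B`. -/
def Commensurable (A B : Submodule K V) : Prop :=
  Module.Finite K (A ⧸ B.submoduleOf A) ∧ Module.Finite K (B ⧸ A.submoduleOf B)

/-- The sum of the codimensions of `A ∩ B` in `A` and in `B`. -/
def commCodim (A B : Submodule K V) : ℕ := relDim K A B + relDim K B A

end Commensurable

/-! ### The infinite Grassmannian -/

section Grassmannian

/-- The space `F((t))ᵈ`. -/
abbrev LaurentSpace (F : Type u) [Field F] (d : ℕ) : Type u := Fin d → F⸨X⸩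

/-- `F[[t]]`-submodules of `F((t))ᵈ`. -/
abbrev TLattice (F : Type u) [Field F] (d : ℕ) : Type u := Submodule F⟦X⟧ (LaurentSpace F d)

/-- `tⁿ F[[t]]ᵈ`. -/
def stdLattice (F : Type u) [Field F] (d : ℕ) (n : ℤ) : TLattice F d :=
  Submodule.span F⟦X⟧ (Set.range fun i : Fin d => Pi.single i (HahnSeries.single n (1 : F)))

/-- The `F`-points of `Gr_(n) = Gr_t(t⁻ⁿ k[[t]]ᵈ / tⁿ k[[t]]ᵈ)`. -/
def Gr (F : Type u) [Field F] (d n : ℕ) : Set (TLattice F d) :=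
  {H | stdLattice F d n ≤ H ∧ H ≤ stdLattice F d (-n)}

instance (F : Type u) [Field F] : IsScalarTower F F⟦X⟧ F⸨X⸩ where
  smul_assoc a f x := by
    rw [Algebra.smul_def a f, mul_smul]
    ext n
    simp [Algebra.smul_def]

variable (k : Type u) {F : Type u} [Field k] [Field F] [Algebra k F] {d : ℕ}

/-- The dimension of `t⁻ⁿ F[[t]]ᵈ / H` for `H ⊆ t⁻ⁿ F[[t]]ᵈ`. -/
def coDim (n : ℕ) (H : TLattice F d) : ℕ :=
  relDim F ((stdLattice F d (-n)).restrictScalars F) (H.restrictScalars F)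

open Classical in
/-- `index(H) = dim (t⁻ⁿ F[[t]]ᵈ / H) - n d` for `H` in `Gr_(n)` (it does not depend on `n`; the
smallest possible `n` is used). -/
def index (H : TLattice F d) : ℤ :=
  if h : ∃ n, H ∈ Gr F d n then (coDim (Nat.find h) H : ℤ) - (Nat.find h : ℤ) * d else 0

/-- `Gr[m]`. -/
def GrIndex (F : Type u) [Field F] (d : ℕ) (m : ℤ) : Set (TLattice F d) :=
  {H | (∃ n, H ∈ Gr F d n) ∧ index H = m}

/-- The codimension of `H` relative to `F[[t]]ᵈ`. -/
def latticeCodim (H : TLattice F d) : ℕ :=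
  commCodim F ((stdLattice F d 0).restrictScalars F) (H.restrictScalars F)

/-- Coordinates on `t⁻ⁿ F[[t]]ᵈ / tⁿ F[[t]]ᵈ`: the coefficient of `t ^ (j - n) e_i`. -/
def coordAt (n : ℕ) (p : Fin d × Fin (2 * n)) (v : LaurentSpace F d) : F :=
  (v p.1).coeff ((p.2 : ℤ) - n)

/-- The standard charts of the Grassmannian of `t⁻ⁿ F[[t]]ᵈ / tⁿ F[[t]]ᵈ`: for a set `I` of
coordinates, the matrix `c` parametrises the subspace which is the graph of the linear map
`F ^ Iᶜ → F ^ I` with matrix `c`. -/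
def grChart (F : Type u) [Field F] (d n : ℕ) (I : Finset (Fin d × Fin (2 * n)))
    (c : I × (Iᶜ : Finset _) → F) : Set (LaurentSpace F d) :=
  {v | v ∈ stdLattice F d (-n) ∧
    ∀ p : I, coordAt n p v = ∑ q : (Iᶜ : Finset _), c (p, q) * coordAt n q v}

/-- A set of lattices, seen as a set of subsets of `F((t))ᵈ`. -/
def asSets (A : Set (TLattice F d)) : Set (Set (LaurentSpace F d)) :=
  (fun H : TLattice F d => (H : Set (LaurentSpace F d))) '' A

/-- `A` is gr-stable at level `n`: it is a constructible subset of `Gr_(n)`. -/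
def GrStable (n : ℕ) (A : Set (TLattice F d)) : Prop :=
  A ⊆ Gr F d n ∧ IsConstructibleSet k (grChart F d n) (asSets A)

/-- The class in `ℳ` of a constructible subset of `Gr_(n)`. -/
def grClass (n : ℕ) (A : Set (TLattice F d)) : GrothendieckRing k :=
  setClass k (grChart F d n) (asSets A)

open Classical in
/-- The motivic measure `∑ₘ [A ∩ Gr[m]] 𝐋^{-md}` of a gr-stable set. -/
def grMeasure (A : Set (TLattice F d)) : GrothendieckRingLoc k :=
  if h : ∃ n, GrStable k n A then
    ∑ᶠ m : ℤ, algebraMap (GrothendieckRing k) (GrothendieckRingLoc k)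
      (grClass k (Nat.find h) (A ∩ GrIndex F d m)) * lefPow k (-(m * d))
  else 0

/-- The integral `∫_A 𝐋^α T^β dμ_Gr`: the coefficient of `Tⁿ` is
`∑ⱼ 𝐋ʲ μ_Gr {H ∈ A | α H = j, β H = n}`. -/
def grIntegral (A : Set (TLattice F d)) (α : TLattice F d → ℤ) (β : TLattice F d → ℕ) :
    PowerSeries (GrothendieckRingLoc k) :=
  PowerSeries.mk fun n => ∑ᶠ j : ℤ, lefPow k j * grMeasure k {H ∈ A | α H = j ∧ β H = n}

end Grassmannian

/-! ### Arcs on the space of matrices, and the map `Θ` -/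

section Arcs

variable (k : Type u) {F : Type u} [Field k] [Field F] [Algebra k F] {d : ℕ}

/-- Truncation `π_l` of an arc on the space `M_d` of matrices modulo `t ^ (l + 1)`; the space
`ℒ_l(M_d)` is the affine space with coordinates the coefficients of the entries. -/
def truncate (l : ℕ) (M : Matrix (Fin d) (Fin d) F⟦X⟧) : Fin d × Fin d × Fin (l + 1) → F :=
  fun p => PowerSeries.coeff (p.2.2 : ℕ) (M p.1 p.2.1)

/-- The arcs in `t ^ N A`, for a subset `A` of `GL_d(F((t)))`. -/
def shiftedArcs (N : ℕ) (A : Set (GL (Fin d) F⸨X⸩)) : Set (Matrix (Fin d) (Fin d) F⟦X⟧) :=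
  {B | ∃ M ∈ A, B.map (algebraMap F⟦X⟧ F⸨X⸩) =
    (HahnSeries.single (N : ℤ) (1 : F) : F⸨X⸩) • (M : Matrix (Fin d) (Fin d) F⸨X⸩)}

/-- `t ^ N A` consists of arcs on `M_d`, and is cylindrical at level `l` as a subset of `ℒ(M_d)`. -/
def IsCylindrical (N l : ℕ) (A : Set (GL (Fin d) F⸨X⸩)) : Prop :=
  (∀ M ∈ A, ∃ B : Matrix (Fin d) (Fin d) F⟦X⟧, B.map (algebraMap F⟦X⟧ F⸨X⸩) =
    (HahnSeries.single (N : ℤ) (1 : F) : F⸨X⸩) • (M : Matrix (Fin d) (Fin d) F⸨X⸩)) ∧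
  ∃ C : Set (Fin d × Fin d × Fin (l + 1) → F),
    IsConstructibleSet k (affineChart F _) C ∧ shiftedArcs N A = truncate l ⁻¹' C

open Classical in
/-- The motivic measure of a subset `A` of `GL_d(F((t)))` such that `t ^ N A` is cylindrical at
level `l` for some `N` and `l`: it is `𝐋^{d²N} [π_l(t ^ N A)] 𝐋^{-(l+1)d²}`. -/
def arcMeasure (A : Set (GL (Fin d) F⸨X⸩)) : GrothendieckRingLoc k :=
  if h : ∃ p : ℕ × ℕ, IsCylindrical k p.1 p.2 A then
    lefPow k ((d : ℤ) ^ 2 * h.choose.1) *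
      algebraMap (GrothendieckRing k) (GrothendieckRingLoc k)
        (setClass k (affineChart F _) (truncate h.choose.2 '' shiftedArcs h.choose.1 A)) *
      lefPow k (-(((h.choose.2 : ℤ) + 1) * (d : ℤ) ^ 2))
  else 0

/-- The map `Θ`, sending `M` to the lattice `M F[[t]]ᵈ` spanned by its columns. -/
def Theta (M : GL (Fin d) F⸨X⸩) : TLattice F d :=
  Submodule.span F⟦X⟧ (Set.range fun (j : Fin d) (i : Fin d) =>
    (M : Matrix (Fin d) (Fin d) F⸨X⸩) i j)

end Arcs

/-! ### Classes of subalgebras and the motivic zeta function -/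

section Subalgebras

variable {k : Type u} [Field k] {d : ℕ}
variable {𝔏 : Type w} [LieRing 𝔏] [LieAlgebra k 𝔏] [LieAlgebra k⟦X⟧ 𝔏] [IsScalarTower k k⟦X⟧ 𝔏]

/-- The `k[[t]]`-submodule `L₀` of `𝔏` of elements with integral coordinates. -/
def integralPart (coords : 𝔏 →ₗ[k⟦X⟧] LaurentSpace k d) : Submodule k 𝔏 :=
  ((stdLattice k d 0).comap coords).restrictScalars k

/-- A class of `k[[t]]`-subalgebras of `𝔏` (commensurable with `L₀`): for every finite extension
`K` of `k`, a family of Lie subalgebras of `K ⊗ 𝔏` which are `K[[t]]`-submodules (here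
`K[[t]] = K ⊗ k[[t]]`) and commensurable with `K ⊗ L₀`. -/
structure SubalgebraClass (coords : 𝔏 →ₗ[k⟦X⟧] LaurentSpace k d) where
  carrier : ∀ (K : Type u) [Field K] [Algebra k K] [FiniteDimensional k K],
    Set (LieSubalgebra K (K ⊗[k] 𝔏))
  smul_mem : ∀ (K : Type u) [Field K] [Algebra k K] [FiniteDimensional k K],
    ∀ H ∈ carrier K, ∀ (a : k⟦X⟧), ∀ x ∈ H, (Algebra.lsmul k k 𝔏 a).lTensor K x ∈ H
  commensurable : ∀ (K : Type u) [Field K] [Algebra k K] [FiniteDimensional k K],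
    ∀ H ∈ carrier K,
      Commensurable K ((integralPart coords).baseChange K) H.toSubmodule

variable {F : Type u} [Field F] [Algebra k F]

/-- The map `K ⊗ 𝔏 → F((t))ᵈ`, `a ⊗ x ↦ a · coords x`, attached to an embedding of `K` in `F`. -/
def geomMap (coords : 𝔏 →ₗ[k⟦X⟧] LaurentSpace k d) {K : Type u} [Field K] [Algebra k K]
    (e : K →ₐ[k] F) : K ⊗[k] 𝔏 →ₗ[k] LaurentSpace F d :=
  TensorProduct.lift (LinearMap.mk₂ k
    (fun (a : K) (x : 𝔏) (i : Fin d) => e a • (coords x i).map (algebraMap k F))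
    (by intro a b x; funext i; ext n; simp [add_mul])
    (by intro c a x; funext i; ext n; simp [Algebra.smul_def, mul_assoc])
    (by intro a x y; funext i; ext n; simp [mul_add])
    (by
      intro c a x
      funext i; ext n
      have h : coords (c • x) = c • coords x := by
        rw [← algebraMap_smul k⟦X⟧ c x, map_smul, algebraMap_smul]
      simp [h, Algebra.smul_def, mul_left_comm]))

/-- The point of the infinite Grassmannian over `F` defined by a subspace `H` of `K ⊗ 𝔏`. -/
def geomLattice (coords : 𝔏 →ₗ[k⟦X⟧] LaurentSpace k d) {K : Type u} [Field K] [Algebra k K]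
    (e : K →ₐ[k] F) (H : Submodule K (K ⊗[k] 𝔏)) : TLattice F d :=
  Submodule.span F⟦X⟧ (geomMap coords e '' H)

variable {coords : 𝔏 →ₗ[k⟦X⟧] LaurentSpace k d}

namespace SubalgebraClass

variable (F) in
/-- The class `𝒳` as a subset of the infinite Grassmannian. -/
def points (𝒳 : SubalgebraClass coords) : Set (TLattice F d) :=
  {Λ | ∃ (K : Type u) (_ : Field K) (_ : Algebra k K) (_ : FiniteDimensional k K)
    (e : K →ₐ[k] F), ∃ H ∈ 𝒳.carrier K, Λ = geomLattice coords e H.toSubmodule}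

variable (F) in
/-- `A_{l,n}(𝒳)`: the set of points of `Gr_(l)` defined by the members of `𝒳` of codimension `n`. -/
def levelSet (𝒳 : SubalgebraClass coords) (l n : ℕ) : Set (TLattice F d) :=
  {Λ | Λ ∈ Gr F d l ∧
    ∃ (K : Type u) (_ : Field K) (_ : Algebra k K) (_ : FiniteDimensional k K)
    (e : K →ₐ[k] F), ∃ H ∈ 𝒳.carrier K,
      commCodim K ((integralPart coords).baseChange K) H.toSubmodule = n ∧
      Λ = geomLattice coords e H.toSubmodule}

variable (F) in
/-- `𝒳` is a constructible class of subalgebras. -/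
def IsConstructible (𝒳 : SubalgebraClass coords) : Prop :=
  ∀ l n, GrStable k l (levelSet F 𝒳 l n)

variable (F) in
/-- The sets `A_{l,n}(𝒳)`, `n` fixed, are all equal from the index `l` on. -/
def StableFrom (𝒳 : SubalgebraClass coords) (n l : ℕ) : Prop :=
  ∀ j ≥ l, levelSet F 𝒳 l n = levelSet F 𝒳 j n

variable (F) in
/-- `𝒳` is a stable class of subalgebras. -/
def IsStable (𝒳 : SubalgebraClass coords) : Prop :=
  ∀ n, ∃ l, StableFrom F 𝒳 n l

open Classical in
variable (F) in
/-- The motivic zeta function `P_{L,𝒳}(T) = ∑ₙ [Aₙ(𝒳)] Tⁿ`, where `[Aₙ] = [A_{l,n}]` for large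
`l`. -/
def zeta (𝒳 : SubalgebraClass coords) : PowerSeries (GrothendieckRing k) :=
  PowerSeries.mk fun n =>
    if h : ∃ l, StableFrom F 𝒳 n l then
      grClass k (Nat.find h) (levelSet F 𝒳 (Nat.find h) n)
    else 0

end SubalgebraClass

end Subalgebras

end MotivicGr

end

open MotivicGr

noncomputable section
namespace MotivicGr

/-! ### Classes of subvarieties of affine space, read off from their `F`-points -/

section SchemePart

variable {k : Type u} [Field k]

/-! Part (1). Fix a level `n` and use the standard charts of the Grassmannian of `t⁻ⁿF[[t]]ᵈ /
tⁿF[[t]]ᵈ`. The points of the chart attached to `I` are subspaces of dimension `r = |Iᶜ|`, so the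
index is constant there, equal to `nd - r` (`index_eq_of_grChart`). By Nakayama, `d` vectors
generate a lattice `H` of this chart iff their classes form a basis of `H/tH`. Since `tH` contains
`tⁿ⁺¹F[[t]]ᵈ`, this depends only on the vectors modulo `tⁿ⁺¹`, that is, on the arc `tⁿM` modulo
`t²ⁿ⁺¹` (`span_eq_iff_isFrame`), which explains the level `2n`. Modulo `tⁿ⁺¹`, the spaces `H` and
`tH` have dimensions `r + d` and `r`, and choosing the generators one after the other, each outside
the span of `tH` and the previous ones, shows that the generating systems over a constructible set
`X` of coordinates have class `[X] ∏_{j<d} (𝐋^(r+d) - 𝐋^(r+j)) = [X] 𝐋^((r+d)d) ∏_{i≤d} (1 - 𝐋⁻ⁱ)`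
(`affineClass_isFrame`, `algebraMap_prod_frames`). The normalisation `𝐋^(d²n - (2n+1)d²)` of the arc
measure turns the power of `𝐋` into `𝐋^(-(nd-r)d)`, the weight of that chart in the measure on the
Grassmannian.

These computations rest on a calculus of classes for sets of `F`-points. A set constructible over
`k` is a finite union of cells cut out by the vanishing and non-vanishing of finitely many
polynomials, and the sum of the classes of the cells does not depend on the polynomials, because a
reduced subvariety is determined by its `F`-points (`cls_eq_of_range_eq`,
`eq_of_preimage_affinePoint_eq`). This class is invariant under bijections that are piecewise
rational together with their inverses (`affineClass_eq_of_bijOn`). Gaussian elimination is piecewise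
rational in the coefficients (`Definable.exists_solution`), so a family of `r`-dimensional vector
spaces over `X` has class `[X] 𝐋^r` (`affineClass_span`), with no need of local triviality. The same
elimination shows that the changes of charts are piecewise rational, so that classes can be computed
from any presentation by charts (`IsPresentation.sum_eq`).

Part (2). By Nakayama again, `t` acts nilpotently on every finite-dimensional quotient, with
exponent at most the dimension (`map_X_pow_eq_zero`). Hence a subalgebra of codimension `n` gives a
point of `Gr_(n)`, and `A_{l,n}` is constant for `l ≥ n`. The codimension can be read on the lattice
over `F` (`latticeCodim_geomLattice`). In the coefficient of `Tⁿ` the factor `𝐋ʲ` with `j = md`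
cancels the weight `𝐋^(-md)` of the measure, and the pieces of fixed index add up to `[Aₙ]`. -/

theorem cls_eq_of_iso {S S' : Variety k} (e : S.X ≅ S'.X) : S.cls = S'.cls := by
  refine Ideal.Quotient.eq.2 (Ideal.subset_span ?_)
  exact Or.inl (Or.inl (Or.inl ⟨S, S', ⟨e⟩, rfl⟩))

theorem cls_eq_add {S U Z : Variety k} (j : U.X ⟶ S.X) (i : Z.X ⟶ S.X)
    (hj : IsOpenImmersion j.left) (hi : IsClosedImmersion i.left)
    (h : Set.range j.left = (Set.range i.left)ᶜ) : S.cls = U.cls + Z.cls := by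
  rw [Variety.cls, Variety.cls, Variety.cls, ← map_add]
  refine Ideal.Quotient.eq.2 (Ideal.subset_span ?_)
  exact Or.inl (Or.inl (Or.inr ⟨S, U, Z, j, i, hj, hi, h, rfl⟩))

theorem cls_eq_mul {S S' P : Variety k} (a : P.X ⟶ S.X) (b : P.X ⟶ S'.X)
    (h : IsPullback a.left b.left S.X.hom S'.X.hom) : P.cls = S.cls * S'.cls := by
  rw [Variety.cls, Variety.cls, Variety.cls, ← map_mul]
  refine Ideal.Quotient.eq.2 (Ideal.subset_span ?_)
  exact Or.inl (Or.inr ⟨S, S', P, a, b, h, rfl⟩)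

theorem cls_eq_one {S : Variety k} (h : IsIso S.X.hom) : S.cls = 1 := by
  rw [Variety.cls, ← map_one (Ideal.Quotient.mk _)]
  refine Ideal.Quotient.eq.2 (Ideal.subset_span ?_)
  exact Or.inr ⟨S, h, rfl⟩

attribute [instance] Variety.reduced Variety.separated Variety.locallyOfFiniteType
  Variety.quasiCompact

/-- The projection is a base change of an immersion and it is surjective, so its image is closed and
it is a closed immersion. A surjective closed immersion onto a reduced scheme is an isomorphism. -/
theorem isIso_fst_of_range_eq {X Y S : Scheme.{u}} (f : X ⟶ S) (g : Y ⟶ S) [IsImmersion g]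
    [IsReduced X] (h : Set.range f ⊆ Set.range g) : IsIso (Limits.pullback.fst f g) := by
  have hs : Function.Surjective (Limits.pullback.fst f g) := by
    intro x
    obtain ⟨y, hy⟩ := h ⟨x, rfl⟩
    obtain ⟨z, hz, -⟩ := Scheme.Pullback.exists_preimage_pullback x y hy.symm
    exact ⟨z, hz⟩
  have : IsClosedImmersion (Limits.pullback.fst f g) := by
    refine .of_isPreimmersion _ ?_
    rw [hs.range_eq]
    exact isClosed_univ
  have : Surjective (Limits.pullback.fst f g) := ⟨hs⟩
  exact isIso_of_isClosedImmersion_of_surjective _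

/-- Both projections of the fibre product over the ambient variety are isomorphisms, since the
sources are reduced. -/
theorem cls_eq_of_range_eq {S V W : Variety k} (f : V.X ⟶ S.X) (g : W.X ⟶ S.X)
    [IsImmersion f.left] [IsImmersion g.left] (h : Set.range f.left = Set.range g.left) :
    V.cls = W.cls := by
  have h1 := isIso_fst_of_range_eq f.left g.left h.subset
  have h2 : IsIso (Limits.pullback.snd f.left g.left) := by
    have := isIso_fst_of_range_eq g.left f.left h.symm.subset
    rw [← Limits.pullbackSymmetry_hom_comp_fst]
    infer_instance
  refine cls_eq_of_iso (Over.isoMk ((asIso (Limits.pullback.fst f.left g.left)).symm ≪≫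
    asIso (Limits.pullback.snd f.left g.left)) ?_)
  have := Limits.pullback.condition (f := f.left) (g := g.left)
  simp only [Iso.trans_hom, Iso.symm_hom, asIso_inv, asIso_hom, Category.assoc]
  rw [IsIso.inv_comp_eq, ← Over.w f, ← Over.w g, ← Category.assoc, ← Category.assoc, this]

instance (V : Variety k) : IsLocallyNoetherian V.X.left :=
  LocallyOfFiniteType.isLocallyNoetherian V.X.hom

instance (V : Variety k) : CompactSpace V.X.left :=
  QuasiCompact.compactSpace_of_compactSpace V.X.hom

/-- The reduced subscheme of a variety given by an immersion. -/
def Variety.sub (V : Variety k) {Y : Scheme.{u}} (j : Y ⟶ V.X.left) [IsImmersion j] [IsReduced Y]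
    [QuasiCompact j] : Variety k where
  X := Over.mk (j ≫ V.X.hom)
  reduced := by dsimp; infer_instance
  separated := by dsimp; infer_instance
  locallyOfFiniteType := by dsimp; infer_instance
  quasiCompact := by dsimp; infer_instance

/-- The inclusion of `V.sub j` in `V`. -/
def Variety.subHom (V : Variety k) {Y : Scheme.{u}} (j : Y ⟶ V.X.left) [IsImmersion j]
    [IsReduced Y] [QuasiCompact j] : (V.sub j).X ⟶ V.X := Over.homMk j rfl

theorem isReduced_subscheme_vanishingIdeal (X : Scheme.{u}) (Z : TopologicalSpace.Closeds X) :
    IsReduced (Scheme.IdealSheafData.vanishingIdeal Z).subscheme := by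
  have h : ∀ i, IsReduced
      ((Scheme.IdealSheafData.vanishingIdeal Z).subschemeCover.openCover.X i) := by
    intro (U : X.affineOpens)
    change IsReduced (Spec (.of (Γ(X, U) ⧸ (Scheme.IdealSheafData.vanishingIdeal Z).ideal U)))
    have : _root_.IsReduced (CommRingCat.of
        (Γ(X, U) ⧸ (Scheme.IdealSheafData.vanishingIdeal Z).ideal U)) := by
      change _root_.IsReduced (Γ(X, U) ⧸ (Scheme.IdealSheafData.vanishingIdeal Z).ideal U)
      rw [← Ideal.isRadical_iff_quotient_reduced, Scheme.IdealSheafData.vanishingIdeal_ideal]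
      exact PrimeSpectrum.isRadical_vanishingIdeal _
    infer_instance
  exact @IsReduced.of_openCover _ _ h

/-- The complement carries its reduced structure. The topological space is noetherian, which makes
the open piece quasi-compact. -/
theorem exists_open_closed (V : Variety k) (U : V.X.left.Opens) :
    ∃ (A B : Variety k) (j : A.X ⟶ V.X) (i : B.X ⟶ V.X), IsOpenImmersion j.left ∧
      IsClosedImmersion i.left ∧ Set.range j.left = U ∧ Set.range i.left = (U : Set V.X.left)ᶜ ∧
      V.cls = A.cls + B.cls := by
  have : IsNoetherian V.X.left := {}
  let I := Scheme.IdealSheafData.vanishingIdeal (X := V.X.left)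
    ⟨(U : Set V.X.left)ᶜ, U.2.isClosed_compl⟩
  have hI : IsReduced I.subscheme := isReduced_subscheme_vanishingIdeal _ _
  have hr : Set.range I.subschemeι = (U : Set V.X.left)ᶜ := by
    rw [Scheme.IdealSheafData.range_subschemeι]
    simp [I]
  have hU : Set.range U.ι = U := Scheme.Opens.range_ι U
  have h1 : IsOpenImmersion (V.subHom U.ι).left := inferInstanceAs (IsOpenImmersion U.ι)
  have h2 : IsClosedImmersion (V.subHom I.subschemeι).left :=
    inferInstanceAs (IsClosedImmersion I.subschemeι)
  exact ⟨V.sub U.ι, V.sub I.subschemeι, V.subHom _, V.subHom _, h1, h2, hU, hr,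
    cls_eq_add (V.subHom _) (V.subHom _) h1 h2 (hU.trans (by rw [← compl_compl (U : Set V.X.left), ← hr]; rfl))⟩


variable {F : Type u} [Field F] [Algebra k F]
variable {σ τ : Type} [Finite σ] [Finite τ]

theorem mem_affinePoint {x : σ → F} {p : MvPolynomial σ k} :
    p ∈ (affinePoint k x : PrimeSpectrum (MvPolynomial σ k)).asIdeal ↔
      MvPolynomial.aeval x p = 0 := Iff.rfl

theorem affinePoint_mem_zeroLocus {x : σ → F} {s : Set (MvPolynomial σ k)} :
    (affinePoint k x : PrimeSpectrum (MvPolynomial σ k)) ∈ PrimeSpectrum.zeroLocus s ↔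
      ∀ p ∈ s, MvPolynomial.aeval x p = 0 := Iff.rfl

/-- Nullstellensatz: the residue field of a maximal ideal is finite over `k`, hence embeds in `F`.
-/
theorem exists_affinePoint_eq [IsAlgClosed F] (m : PrimeSpectrum (MvPolynomial σ k))
    (hm : m.asIdeal.IsMaximal) : ∃ x : σ → F, (affinePoint k x : PrimeSpectrum _) = m := by
  let _ : Field (MvPolynomial σ k ⧸ m.asIdeal) := Ideal.Quotient.field _
  have : Module.Finite k (MvPolynomial σ k ⧸ m.asIdeal) :=
    finite_of_finite_type_of_isJacobsonRing _ _
  let φ : (MvPolynomial σ k ⧸ m.asIdeal) →ₐ[k] F := IsAlgClosed.lift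
  refine ⟨fun i => φ (Ideal.Quotient.mk _ (MvPolynomial.X i)), ?_⟩
  have h : MvPolynomial.aeval (R := k) (fun i => φ (Ideal.Quotient.mk _ (MvPolynomial.X i))) =
      φ.comp (Ideal.Quotient.mkₐ k m.asIdeal) := by
    ext i; simp
  refine PrimeSpectrum.ext (Ideal.ext fun p => ?_)
  rw [mem_affinePoint, h]
  simp [Ideal.Quotient.eq_zero_iff_mem]

/-- A polynomial ring over a field is Jacobson, so each nonempty locally closed piece contains a
closed point, and closed points lift to `F`. -/
theorem exists_affinePoint_mem [IsAlgClosed F] {C : Set (PrimeSpectrum (MvPolynomial σ k))}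
    (hC : Topology.IsConstructible C) (hne : C.Nonempty) :
    ∃ x : σ → F, (affinePoint k x : PrimeSpectrum _) ∈ C := by
  obtain ⟨S, rfl⟩ := PrimeSpectrum.exists_constructibleSetData_iff.2 hC
  obtain ⟨y, hy⟩ := hne
  simp only [PrimeSpectrum.ConstructibleSetData.toSet, Set.mem_iUnion] at hy
  obtain ⟨B, hB, hy⟩ := hy
  have hl : IsLocallyClosed B.toSet := by
    refine IsLocallyClosed.inter (PrimeSpectrum.isClosed_zeroLocus _).isLocallyClosed
      (IsOpen.isLocallyClosed ?_)
    exact (PrimeSpectrum.isClosed_zeroLocus _).isOpen_compl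
  obtain ⟨m, hm, hm'⟩ := nonempty_inter_closedPoints (Z := B.toSet) ⟨y, hy⟩ hl
  obtain ⟨x, hx⟩ := exists_affinePoint_eq (F := F) m
    ((PrimeSpectrum.isClosed_singleton_iff_isMaximal _).1 hm')
  exact ⟨x, Set.mem_iUnion₂.2 ⟨B, hB, hx ▸ hm⟩⟩

theorem eq_of_preimage_affinePoint_eq [IsAlgClosed F]
    {C C' : Set (PrimeSpectrum (MvPolynomial σ k))}
    (hC : Topology.IsConstructible C) (hC' : Topology.IsConstructible C')
    (h : ∀ x : σ → F, (affinePoint k x : PrimeSpectrum _) ∈ C ↔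
      (affinePoint k x : PrimeSpectrum _) ∈ C') : C = C' := by
  have key : ∀ {C C' : Set (PrimeSpectrum (MvPolynomial σ k))}, Topology.IsConstructible C →
      Topology.IsConstructible C' → (∀ x : σ → F, (affinePoint k x : PrimeSpectrum _) ∈ C →
      (affinePoint k x : PrimeSpectrum _) ∈ C') → C ⊆ C' := by
    intro C C' hC hC' h
    by_contra hn
    obtain ⟨x, hx⟩ := exists_affinePoint_mem (F := F) (hC.sdiff hC')
      (Set.sdiff_nonempty.2 hn)
    exact hx.2 (h x hx.1)
  exact (key hC hC' fun x => (h x).1).antisymm (key hC' hC fun x => (h x).2)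

theorem isConstructible_range_of_isImmersion (V : Variety k) {Y : Scheme.{u}} (f : Y ⟶ V.X.left)
    [IsImmersion f] : Topology.IsConstructible (Set.range f) := by
  have : IsNoetherian V.X.left := {}
  have h := f.isLocallyClosed_range
  obtain ⟨U, Z, hU, hZ, h⟩ := h
  rw [h]
  refine Topology.IsConstructible.inter ?_ ?_
  · exact IsCompact.isConstructible (TopologicalSpace.NoetherianSpace.isCompact _) hU
  · rw [← Topology.isConstructible_compl]
    exact IsCompact.isConstructible (TopologicalSpace.NoetherianSpace.isCompact _) hZ.isOpen_compl

variable (k) in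
/-- `T` is the set of `F`-points of a subvariety of an affine space, whose class is `c`. -/
def IsSubvariety (T : Set (σ → F)) (c : GrothendieckRing k) : Prop :=
  ∃ (V : Variety k) (f : V.X ⟶ (affineSpace k σ).X), IsImmersion f.left ∧
    T = affinePoint k ⁻¹' Set.range f.left ∧ V.cls = c

/-- The images of the two immersions are constructible with the same `F`-points, hence equal. -/
theorem IsSubvariety.unique [IsAlgClosed F] {T : Set (σ → F)} {c c' : GrothendieckRing k}
    (h : IsSubvariety k T c) (h' : IsSubvariety k T c') : c = c' := by
  obtain ⟨V, f, hf, hT, rfl⟩ := h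
  obtain ⟨V', f', hf', hT', rfl⟩ := h'
  refine cls_eq_of_range_eq f f' ?_
  refine eq_of_preimage_affinePoint_eq (F := F) (isConstructible_range_of_isImmersion _ _)
    (isConstructible_range_of_isImmersion _ _) fun x => ?_
  have : x ∈ affinePoint k ⁻¹' Set.range f.left ↔ x ∈ affinePoint k ⁻¹' Set.range f'.left := by
    rw [← hT, ← hT']
  exact this

theorem IsSubvariety.split {T : Set (σ → F)} {c : GrothendieckRing k}
    (h : IsSubvariety k T c) (p : MvPolynomial σ k) :
    ∃ c₁ c₂, IsSubvariety k (T ∩ {x | MvPolynomial.aeval x p ≠ 0}) c₁ ∧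
      IsSubvariety k (T ∩ {x | MvPolynomial.aeval x p = 0}) c₂ ∧ c = c₁ + c₂ := by
  obtain ⟨V, f, hf, hT, rfl⟩ := h
  let D : (affineSpace k σ).X.left.Opens := PrimeSpectrum.basicOpen p
  obtain ⟨A, B, j, i, hj, hi, hrj, hri, h⟩ := exists_open_closed V (f.left ⁻¹ᵁ D)
  have hD : ∀ x : σ → F, affinePoint k x ∈ D ↔ MvPolynomial.aeval x p ≠ 0 := fun x => Iff.rfl
  refine ⟨A.cls, B.cls, ⟨A, j ≫ f, ?_, ?_, rfl⟩, ⟨B, i ≫ f, ?_, ?_, rfl⟩, h⟩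
  · rw [Over.comp_left]; infer_instance
  · ext x
    have : Set.range (j ≫ f).left = f.left '' Set.range j.left := by
      rw [Over.comp_left, Scheme.Hom.comp_base, TopCat.coe_comp, Set.range_comp]
    rw [Set.mem_preimage, this, hrj, hT]
    constructor
    · rintro ⟨⟨v, hv⟩, hx⟩
      exact ⟨v, by
        change f.left v ∈ D
        rw [hv]; exact (hD x).2 hx, hv⟩
    · rintro ⟨v, hv, hvx⟩
      exact ⟨⟨v, hvx⟩, (hD x).1 (hvx ▸ hv)⟩
  · rw [Over.comp_left]; infer_instance
  · ext x
    have : Set.range (i ≫ f).left = f.left '' Set.range i.left := by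
      rw [Over.comp_left, Scheme.Hom.comp_base, TopCat.coe_comp, Set.range_comp]
    rw [Set.mem_preimage, this, hri, hT]
    constructor
    · rintro ⟨⟨v, hv⟩, hx⟩
      refine ⟨v, fun hvD => ?_, hv⟩
      exact (hD x).1 (hv ▸ (hvD : f.left v ∈ D)) hx
    · rintro ⟨v, hv, hvx⟩
      refine ⟨⟨v, hvx⟩, ?_⟩
      by_contra hx
      exact hv (show f.left v ∈ D from hvx ▸ (hD x).2 hx)

theorem isSubvariety_univ :
    IsSubvariety k (Set.univ : Set (σ → F)) (affineSpace k σ).cls := by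
  refine ⟨affineSpace k σ, 𝟙 _, ?_, ?_, rfl⟩
  · rw [Over.id_left]; infer_instance
  · ext x
    simp only [Set.mem_univ, Set.mem_preimage, true_iff]
    exact ⟨affinePoint k x, by simp⟩

/-- Cutting the empty set by the polynomial `0` gives the empty set twice, whence `c = c + c`. -/
theorem IsSubvariety.empty_eq [IsAlgClosed F] {c : GrothendieckRing k}
    (h : IsSubvariety k (∅ : Set (σ → F)) c) : c = 0 := by
  obtain ⟨c₁, c₂, h₁, h₂, h₃⟩ := h.split 0
  rw [Set.empty_inter] at h₁ h₂
  have e1 := h.unique h₁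
  have e2 := h.unique h₂
  rw [← e1, ← e2] at h₃
  simpa using h₃

theorem isSubvariety_empty [IsAlgClosed F] : IsSubvariety k (∅ : Set (σ → F)) 0 := by
  obtain ⟨c₁, c₂, h₁, h₂, h₃⟩ := (isSubvariety_univ (k := k) (F := F) (σ := σ)).split 0
  have h0 : (Set.univ : Set (σ → F)) ∩ {x | MvPolynomial.aeval x (0 : MvPolynomial σ k) ≠ 0} = ∅ := by
    ext; simp
  rw [h0] at h₁
  rwa [h₁.empty_eq] at h₁

end SchemePart

/-! ### Moving subvarieties between affine spaces: graphs and products -/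

section SchemeMaps

variable {k : Type u} [Field k] {F : Type u} [Field F] [Algebra k F]
variable {σ τ : Type} [Finite σ] [Finite τ]

/-- The morphism of spectra attached to a homomorphism of algebras. -/
def specMap {R S : Type u} [CommRing R] [CommRing S] [Algebra k R] [Algebra k S] (α : R →ₐ[k] S) :
    Spec (CommRingCat.of S) ⟶ Spec (CommRingCat.of R) :=
  Spec.map (CommRingCat.ofHom α.toRingHom)

theorem specMap_comp {R S S' : Type u} [CommRing R] [CommRing S] [CommRing S'] [Algebra k R]
    [Algebra k S] [Algebra k S'] (α : R →ₐ[k] S) (β : S →ₐ[k] S') :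
    specMap β ≫ specMap α = specMap (β.comp α) := by
  rw [specMap, specMap, specMap, ← Spec.map_comp]; rfl

theorem specMap_over {R S : Type u} [CommRing R] [CommRing S] [Algebra k R] [Algebra k S]
    (α : R →ₐ[k] S) : specMap α ≫ Spec.map (CommRingCat.ofHom (algebraMap k R)) =
      Spec.map (CommRingCat.ofHom (algebraMap k S)) := by
  rw [specMap, ← Spec.map_comp, ← CommRingCat.ofHom_comp]
  congr 2
  exact α.comp_algebraMap

/-- The kernel of a point of `Spec R` with values in a field. -/
def kerPoint {R : Type u} [CommRing R] [Algebra k R] (φ : R →ₐ[k] F) : PrimeSpectrum R :=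
  ⟨RingHom.ker φ, RingHom.ker_isPrime _⟩

theorem specMap_kerPoint {R S : Type u} [CommRing R] [CommRing S] [Algebra k R] [Algebra k S]
    (α : R →ₐ[k] S) (φ : S →ₐ[k] F) : specMap α (kerPoint φ : PrimeSpectrum S) =
      (kerPoint (φ.comp α) : PrimeSpectrum R) := rfl

/-- `Spec R` is an open subscheme of the first affine space (via `α`), mapped to the second one by
`β`, and `γ` projects the second space back to the first. The subvariety lifts to `Spec R`, and its
image in the second space is again an immersion because composing it with the projection gives back
the original immersion. -/
theorem IsSubvariety.transfer [IsAlgClosed F] {T : Set (σ → F)} {c : GrothendieckRing k}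
    (h : IsSubvariety k T c) {R : Type u} [CommRing R] [Algebra k R]
    (α : MvPolynomial σ k →ₐ[k] R) (β : MvPolynomial τ k →ₐ[k] R)
    (γ : MvPolynomial σ k →ₐ[k] MvPolynomial τ k) (hβ : β.comp γ = α)
    (hα : IsOpenImmersion (specMap α)) (U : Set (τ → F))
    (hT : ∀ x ∈ T, ∃ φ : R →ₐ[k] F, φ.comp α = MvPolynomial.aeval x)
    (hU : ∀ y : τ → F, y ∈ U ↔ (fun i => MvPolynomial.aeval y (γ (MvPolynomial.X i))) ∈ T ∧
      ∀ p, β p = 0 → MvPolynomial.aeval y p = 0)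
    (hφ : ∀ y ∈ U, ∃ φ : R →ₐ[k] F, φ.comp β = MvPolynomial.aeval y) :
    IsSubvariety k U c := by
  obtain ⟨V, f, hf, hTf, rfl⟩ := h
  let ia : Spec (CommRingCat.of R) ⟶ (affineSpace k σ).X.left := specMap α
  let ib : Spec (CommRingCat.of R) ⟶ (affineSpace k τ).X.left := specMap β
  let ig : (affineSpace k τ).X.left ⟶ (affineSpace k σ).X.left := specMap γ
  have hbg : ib ≫ ig = ia := (specMap_comp γ β).trans (congrArg specMap hβ)
  have hia : IsOpenImmersion ia := hα
  have hpt : ∀ (x : σ → F) (φ : R →ₐ[k] F), φ.comp α = MvPolynomial.aeval x →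
      ia (kerPoint φ : PrimeSpectrum R) = affinePoint k x := by
    intro x φ hx
    change specMap α (kerPoint φ : PrimeSpectrum R) = _
    rw [specMap_kerPoint, hx]; rfl
  have hptb : ∀ (x : τ → F) (φ : R →ₐ[k] F), φ.comp β = MvPolynomial.aeval x →
      ib (kerPoint φ : PrimeSpectrum R) = affinePoint k x := by
    intro x φ hx
    change specMap β (kerPoint φ : PrimeSpectrum R) = _
    rw [specMap_kerPoint, hx]; rfl
  have hptg : ∀ y : τ → F, ig (affinePoint k y) =
      affinePoint k (fun i => MvPolynomial.aeval y (γ (MvPolynomial.X i))) := by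
    intro y
    change specMap γ (kerPoint (MvPolynomial.aeval y) : PrimeSpectrum (MvPolynomial τ k)) = _
    rw [specMap_kerPoint]
    have : (MvPolynomial.aeval y).comp γ =
        MvPolynomial.aeval (fun i => MvPolynomial.aeval y (γ (MvPolynomial.X i))) := by
      ext i; simp
    rw [this]; rfl
  -- The inclusion of images is tested on `F`-points, where it is the hypothesis `hT`.
  have hrange : Set.range f.left ⊆ Set.range ia := by
    by_contra hn
    obtain ⟨x, hx⟩ := exists_affinePoint_mem (F := F) (k := k) (σ := σ)
      ((isConstructible_range_of_isImmersion (affineSpace k σ) f.left).sdiff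
        (isConstructible_range_of_isImmersion (affineSpace k σ) ia)) (Set.sdiff_nonempty.2 hn)
    obtain ⟨φ, h⟩ := hT x (hTf ▸ hx.1)
    exact hx.2 ⟨_, hpt x φ h⟩
  let g := IsOpenImmersion.lift ia f.left hrange
  have hg : g ≫ ia = f.left := IsOpenImmersion.lift_fac _ _ _
  have hfg : (g ≫ ib) ≫ ig = f.left := by rw [Category.assoc, hbg, hg]
  have hover : (g ≫ ib) ≫ (affineSpace k τ).X.hom = V.X.hom := by
    have h1 : ig ≫ (affineSpace k σ).X.hom = (affineSpace k τ).X.hom := specMap_over γ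
    rw [← h1, ← Category.assoc, hfg, Over.w]
  have himm : IsImmersion (g ≫ ib) := by
    have : IsImmersion ((g ≫ ib) ≫ ig) := by rw [hfg]; exact hf
    exact IsImmersion.of_comp _ ig
  refine ⟨V, Over.homMk (g ≫ ib) hover, himm, ?_, rfl⟩
  ext y
  constructor
  · intro hy
    obtain ⟨φ, h⟩ := hφ y hy
    have hyT := ((hU y).1 hy).1
    rw [hTf] at hyT
    obtain ⟨v, hv⟩ := hyT
    have e1 : ia (kerPoint φ : PrimeSpectrum R) = f.left v := by
      rw [hv, ← hptg, ← hptb y φ h, ← hbg]; rfl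
    have e2 : ia (g v) = f.left v := by rw [← hg]; rfl
    have e3 := hia.base_open.injective (e1.trans e2.symm)
    refine ⟨v, ?_⟩
    rw [← hptb y φ h, e3]; rfl
  · rintro ⟨v, hv⟩
    have hv' : ib (g v) = affinePoint k y := hv
    refine (hU y).2 ⟨?_, ?_⟩
    · rw [hTf]
      refine ⟨v, ?_⟩
      rw [← hptg, ← hv', ← hfg]; rfl
    · intro p hp
      rw [← mem_affinePoint]
      have : (affinePoint k y : PrimeSpectrum (MvPolynomial τ k)) =
        (PrimeSpectrum.comap β.toRingHom (g v : PrimeSpectrum R)) := hv'.symm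
      rw [this]
      change β p ∈ PrimeSpectrum.asIdeal (R := R) (g v)
      rw [hp]; exact Ideal.zero_mem _

theorem IsSubvariety.reindex [IsAlgClosed F] {T : Set (σ → F)} {c : GrothendieckRing k}
    (h : IsSubvariety k T c) (e : σ ≃ τ) : IsSubvariety k {y : τ → F | y ∘ e ∈ T} c := by
  have hco : ∀ y : τ → F, (fun i => MvPolynomial.aeval y
      (MvPolynomial.rename (R := k) e (MvPolynomial.X i))) = y ∘ e := by
    intro y; ext i; simp
  refine h.transfer (AlgHom.id k _) (MvPolynomial.rename e.symm) (MvPolynomial.rename e)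
    ?_ ?_ _ (fun x _ => ⟨MvPolynomial.aeval x, rfl⟩) ?_ ?_
  · ext i; simp
  · have : specMap (AlgHom.id k (MvPolynomial σ k)) = 𝟙 _ := Spec.map_id _
    rw [this]; infer_instance
  · intro y
    rw [hco]
    refine ⟨fun hy => ⟨hy, fun p hp => ?_⟩, fun hy => hy.1⟩
    have := MvPolynomial.rename_injective (R := k) _ e.symm.injective (hp.trans (map_zero _).symm)
    rw [this, map_zero]
  · intro y _
    refine ⟨MvPolynomial.aeval (y ∘ e), ?_⟩
    ext i; simp

/-- Graph of the rational map `p / q`: the transfer goes through the localization at `q`, with the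
new coordinates sent to `p j / q`. -/
theorem IsSubvariety.graph [IsAlgClosed F] {T : Set (σ → F)} {c : GrothendieckRing k}
    (h : IsSubvariety k T c) (p : τ → MvPolynomial σ k) (q : MvPolynomial σ k)
    (hq : ∀ x ∈ T, MvPolynomial.aeval x q ≠ 0) :
    IsSubvariety k {y : σ ⊕ τ → F | y ∘ Sum.inl ∈ T ∧ ∀ j, y (Sum.inr j) *
      MvPolynomial.aeval (y ∘ Sum.inl) q = MvPolynomial.aeval (y ∘ Sum.inl) (p j)} c := by
  let R := Localization.Away q
  let u : R := IsLocalization.Away.invSelf q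
  have hu : algebraMap (MvPolynomial σ k) R q * u = 1 := IsLocalization.Away.mul_invSelf q
  let α : MvPolynomial σ k →ₐ[k] R := IsScalarTower.toAlgHom k _ _
  let β : MvPolynomial (σ ⊕ τ) k →ₐ[k] R := MvPolynomial.aeval
    (Sum.elim (fun i => α (MvPolynomial.X i)) (fun j => α (p j) * u))
  have hβ : β.comp (MvPolynomial.rename Sum.inl) = α := by
    ext i; simp [β]
  have hφ : ∀ y : σ ⊕ τ → F, MvPolynomial.aeval (y ∘ Sum.inl) q ≠ 0 → (∀ j, y (Sum.inr j) *
      MvPolynomial.aeval (y ∘ Sum.inl) q = MvPolynomial.aeval (y ∘ Sum.inl) (p j)) →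
      ∃ φ : R →ₐ[k] F, φ.comp β = MvPolynomial.aeval y ∧
        φ.comp α = MvPolynomial.aeval (y ∘ Sum.inl) := by
    intro y hq0 hy
    let φ : R →ₐ[k] F := IsLocalization.liftAlgHom (M := Submonoid.powers q)
      (f := MvPolynomial.aeval (y ∘ Sum.inl)) (by
        rintro ⟨_, n, rfl⟩
        simpa using hq0.isUnit.pow n)
    have hα : ∀ r, φ (α r) = MvPolynomial.aeval (y ∘ Sum.inl) r := fun r => by
      simp [φ, α]
    have hu' : MvPolynomial.aeval (y ∘ Sum.inl) q * φ u = 1 := by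
      rw [← hα, ← map_mul]
      change φ (algebraMap _ _ q * u) = 1
      rw [hu, map_one]
    refine ⟨φ, ?_, ?_⟩
    · ext i
      rcases i with i | j
      · simp [β, hα]
      · simp only [β, AlgHom.comp_apply, MvPolynomial.aeval_X, Sum.elim_inr, map_mul, hα]
        rw [← hy j, mul_assoc, hu', mul_one]
    · ext i; simp [hα]
  have hco : ∀ y : σ ⊕ τ → F, (fun i => MvPolynomial.aeval y
      (MvPolynomial.rename (R := k) (Sum.inl : σ → σ ⊕ τ) (MvPolynomial.X i))) = y ∘ Sum.inl := by
    intro y; ext i; simp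
  refine h.transfer α β (MvPolynomial.rename Sum.inl) hβ ?_ _ ?_ ?_ ?_
  · exact inferInstanceAs (IsOpenImmersion (Spec.map (CommRingCat.ofHom
      (algebraMap (MvPolynomial σ k) (Localization.Away q)))))
  · intro x hx
    obtain ⟨φ, -, h⟩ := hφ (Sum.elim x fun j => MvPolynomial.aeval x (p j) / MvPolynomial.aeval x q)
      (by simpa using hq x hx) (fun j => by simp [hq x hx])
    exact ⟨φ, by simpa using h⟩
  · intro y
    rw [hco]
    constructor
    · rintro ⟨hyT, hy⟩
      refine ⟨hyT, fun r hr => ?_⟩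
      obtain ⟨φ, h, -⟩ := hφ y (hq _ hyT) hy
      rw [← h, AlgHom.comp_apply, hr, map_zero]
    · rintro ⟨hyT, hy⟩
      refine ⟨hyT, fun j => ?_⟩
      -- The polynomial `y_j q - p_j` is in the kernel of `β`, and its vanishing at `y` is the
      -- equation of the graph.
      have := hy (MvPolynomial.X (Sum.inr j) * MvPolynomial.rename Sum.inl q -
        MvPolynomial.rename Sum.inl (p j)) (by
          have h1 : ∀ r, β (MvPolynomial.rename Sum.inl r) = α r := fun r => by rw [← hβ]; rfl
          rw [map_sub, map_mul, h1, h1]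
          simp only [β, MvPolynomial.aeval_X, Sum.elim_inr]
          rw [mul_assoc, mul_comm u]
          change α (p j) * (algebraMap _ _ q * u) - _ = 0
          rw [hu, mul_one, sub_self])
      rw [map_sub, map_mul, MvPolynomial.aeval_rename, MvPolynomial.aeval_rename,
        MvPolynomial.aeval_X, sub_eq_zero] at this
      exact this
  · rintro y ⟨hyT, hy⟩
    obtain ⟨φ, h, -⟩ := hφ y (hq _ hyT) hy
    exact ⟨φ, h⟩

omit [Finite σ] [Finite τ] in
theorem isPullback_affineSpace_sum : IsPullback
    (specMap (MvPolynomial.rename (R := k) (Sum.inl : σ → σ ⊕ τ)))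
    (specMap (MvPolynomial.rename (R := k) (Sum.inr : τ → σ ⊕ τ)))
    (Spec.map (CommRingCat.ofHom (algebraMap k (MvPolynomial σ k))))
    (Spec.map (CommRingCat.ofHom (algebraMap k (MvPolynomial τ k)))) := by
  let _ : Algebra (MvPolynomial τ k) (MvPolynomial τ (MvPolynomial σ k)) :=
    MvPolynomial.algebraMvPolynomial
  have hmap : algebraMap (MvPolynomial τ k) (MvPolynomial τ (MvPolynomial σ k)) =
    MvPolynomial.map (algebraMap k (MvPolynomial σ k)) := rfl
  have h := (isPullback_SpecMap_of_isPushout _ _ _ _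
    (CommRingCat.isPushout_of_isPushout k (MvPolynomial σ k) (MvPolynomial τ k)
      (MvPolynomial τ (MvPolynomial σ k))))
  let e : MvPolynomial (σ ⊕ τ) k ≃ₐ[k] MvPolynomial τ (MvPolynomial σ k) :=
    (MvPolynomial.renameEquiv k (Equiv.sumComm σ τ)).trans (MvPolynomial.sumAlgEquiv k τ σ)
  let e' : Spec (CommRingCat.of (MvPolynomial τ (MvPolynomial σ k))) ≅
      Spec (CommRingCat.of (MvPolynomial (σ ⊕ τ) k)) :=
    ⟨specMap e.toAlgHom, specMap e.symm.toAlgHom, by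
      rw [specMap_comp]
      have : (e.toAlgHom.comp e.symm.toAlgHom) = AlgHom.id k _ :=
        AlgHom.ext fun x => e.apply_symm_apply x
      rw [this]; exact Spec.map_id _, by
      rw [specMap_comp]
      have : (e.symm.toAlgHom.comp e.toAlgHom) = AlgHom.id k _ :=
        AlgHom.ext fun x => e.symm_apply_apply x
      rw [this]; exact Spec.map_id _⟩
  refine IsPullback.of_iso h e' (Iso.refl _) (Iso.refl _) (Iso.refl _) ?_ ?_ (by simp) (by simp)
  · simp only [Iso.refl_hom, Category.comp_id]
    change _ = specMap _ ≫ specMap _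
    rw [specMap_comp]
    rw [specMap]
    congr 2
    ext i
    · simp [e]
    · simp [e]
  · simp only [Iso.refl_hom, Category.comp_id]
    change _ = specMap _ ≫ specMap _
    rw [specMap_comp]
    rw [specMap]
    congr 2
    rw [hmap]
    ext i
    · simp [e]
    · simp [e]

/-- Needed so that the product of a variety with an affine space stays reduced. The coordinates are
relabelled by a lifted index type in order to compare with `AffineSpace`. -/
theorem geometricallyReduced_affineSpace : GeometricallyReduced (affineSpace k τ).X.hom := by
  have h1 : (affineSpace k τ).X.hom = specMap
      (MvPolynomial.rename (R := k) (ULift.down.{u} : ULift τ → τ)) ≫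
      Spec.map (CommRingCat.ofHom MvPolynomial.C) :=
    (specMap_over (MvPolynomial.rename (R := k) (ULift.down.{u} : ULift τ → τ))).symm
  have h2 : IsIso (specMap (MvPolynomial.rename (R := k) (ULift.down.{u} : ULift τ → τ))) := by
    refine ⟨specMap (MvPolynomial.rename ULift.up), ?_, ?_⟩
    · rw [specMap_comp]
      have : (MvPolynomial.rename ULift.down).comp (MvPolynomial.rename (ULift.up : τ → _)) =
          AlgHom.id k _ := by ext : 1; simp
      rw [this]; exact Spec.map_id _
    · rw [specMap_comp]
      have : (MvPolynomial.rename (ULift.up : τ → _)).comp (MvPolynomial.rename ULift.down) =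
          AlgHom.id k _ := by ext : 1; simp
      rw [this]; exact Spec.map_id _
  have h3 := AffineSpace.SpecIso_inv_over (n := ULift.{u} τ) (CommRingCat.of k)
  have h4 : IsPullback (specMap (MvPolynomial.rename (R := k) (ULift.down.{u} : ULift τ → τ)) ≫
      (AffineSpace.SpecIso (ULift.{u} τ) (CommRingCat.of k)).inv) (affineSpace k τ).X.hom
      (AffineSpace (ULift.{u} τ) (Spec (CommRingCat.of k)) ↘ Spec (CommRingCat.of k)) (𝟙 _) := by
    refine IsPullback.of_horiz_isIso ⟨?_⟩
    rw [Category.assoc, h3, h1, Category.comp_id]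
  exact MorphismProperty.of_isPullback h4 inferInstance

instance : Flat (affineSpace k τ).X.hom := by
  change Flat (Spec.map (CommRingCat.ofHom (algebraMap k (MvPolynomial τ k))))
  rw [HasRingHomProperty.Spec_iff (P := @Flat)]
  exact RingHom.flat_algebraMap_iff.2 inferInstance

/-- The inverse image under the projection is the fibre product with the affine space, by pasting
two pullback squares; the relation for products then gives its class. -/
theorem IsSubvariety.prod {T : Set (σ → F)} {c : GrothendieckRing k}
    (h : IsSubvariety k T c) :
    IsSubvariety k {y : σ ⊕ τ → F | y ∘ Sum.inl ∈ T} (c * (affineSpace k τ).cls) := by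
  obtain ⟨V, f, hf, hT, rfl⟩ := h
  let pr : (affineSpace k (σ ⊕ τ)).X.left ⟶ (affineSpace k σ).X.left :=
    specMap (MvPolynomial.rename (R := k) (Sum.inl : σ → σ ⊕ τ))
  let qr : (affineSpace k (σ ⊕ τ)).X.left ⟶ (affineSpace k τ).X.left :=
    specMap (MvPolynomial.rename (R := k) (Sum.inr : τ → σ ⊕ τ))
  have hpq : IsPullback pr qr (affineSpace k σ).X.hom (affineSpace k τ).X.hom :=
    isPullback_affineSpace_sum
  have hP : IsPullback (Limits.pullback.fst f.left pr) (Limits.pullback.snd f.left pr ≫ qr)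
      V.X.hom (affineSpace k τ).X.hom := by
    have := (IsPullback.of_hasPullback f.left pr).flip.paste_horiz hpq.flip
    rw [Over.w] at this
    exact this.flip
  have hred : IsReduced (Limits.pullback f.left pr) := by
    have := geometricallyReduced_affineSpace (k := k) (τ := τ)
    have h1 : IsReduced (Limits.pullback V.X.hom (affineSpace k τ).X.hom) := inferInstance
    exact isReduced_of_isOpenImmersion hP.isoPullback.hom
  have : IsNoetherian (affineSpace k (σ ⊕ τ)).X.left := {}
  have : QuasiCompact (Limits.pullback.snd f.left pr) := inferInstance
  have hc2 : (Limits.pullback.snd f.left pr ≫ qr) ≫ (affineSpace k τ).X.hom =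
      Limits.pullback.snd f.left pr ≫ (affineSpace k (σ ⊕ τ)).X.hom := by
    rw [Category.assoc]
    congr 1
    exact specMap_over _
  let W := (affineSpace k (σ ⊕ τ)).sub (Limits.pullback.snd f.left pr)
  refine ⟨W, Variety.subHom _ _, inferInstanceAs (IsImmersion (Limits.pullback.snd f.left pr)),
    ?_, ?_⟩
  · ext y
    have h1 : Set.range (Variety.subHom (affineSpace k (σ ⊕ τ))
      (Limits.pullback.snd f.left pr)).left = pr ⁻¹' Set.range f.left :=
      Scheme.Pullback.range_snd _ _
    have h2 : pr (affinePoint k y) = affinePoint k (y ∘ Sum.inl) := by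
      change specMap _ (kerPoint (MvPolynomial.aeval y) : PrimeSpectrum (MvPolynomial (σ ⊕ τ) k)) = _
      rw [specMap_kerPoint]
      have : (MvPolynomial.aeval y).comp (MvPolynomial.rename Sum.inl) =
          MvPolynomial.aeval (R := k) (y ∘ Sum.inl) := by
        ext i; simp
      rw [this]; rfl
    rw [Set.mem_preimage, h1, Set.mem_preimage, h2, hT]; rfl
  · refine cls_eq_mul (Over.homMk (Limits.pullback.fst f.left pr) ?_)
      (Over.homMk (Limits.pullback.snd f.left pr ≫ qr) ?_) ?_
    · exact hP.w.trans hc2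
    · exact hc2
    · exact hP

end SchemeMaps

/-! ### An additive class function on constructible sets -/

section ClassFunction

open MvPolynomial (aeval)

variable (k : Type u) [Field k] {F : Type u} [Field F] [Algebra k F]
variable {σ τ ρ : Type}

/-- The elements of `S` which do not vanish at `x`. -/
def cellIndex (S : Finset (MvPolynomial σ k)) (x : σ → F) : Finset (MvPolynomial σ k) :=
  open Classical in S.filter fun p => aeval x p ≠ 0

/-- The set of points where exactly the elements of `U` among those of `S` do not vanish. -/
def cell (S U : Finset (MvPolynomial σ k)) : Set (σ → F) := {x | cellIndex k S x = U}

variable {k}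

theorem mem_cellIndex {S : Finset (MvPolynomial σ k)} {x : σ → F} {p : MvPolynomial σ k} :
    p ∈ cellIndex k S x ↔ p ∈ S ∧ aeval x p ≠ 0 := by
  classical simp [cellIndex]

theorem cellIndex_subset (S : Finset (MvPolynomial σ k)) (x : σ → F) : cellIndex k S x ⊆ S := by
  intro p hp
  exact (mem_cellIndex.1 hp).1

theorem cellIndex_mono {S S' : Finset (MvPolynomial σ k)} (h : S ⊆ S') {x y : σ → F}
    (hxy : cellIndex k S' x = cellIndex k S' y) : cellIndex k S x = cellIndex k S y := by
  ext p
  have := Finset.ext_iff.1 hxy p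
  simp only [mem_cellIndex] at this ⊢
  constructor
  · rintro ⟨hp, h1⟩; exact ⟨hp, (this.1 ⟨h hp, h1⟩).2⟩
  · rintro ⟨hp, h1⟩; exact ⟨hp, (this.2 ⟨h hp, h1⟩).2⟩

theorem aeval_eq_zero_iff_of_cellIndex_eq {S : Finset (MvPolynomial σ k)} {x y : σ → F}
    (hxy : cellIndex k S x = cellIndex k S y) {p : MvPolynomial σ k} (hp : p ∈ S) :
    aeval x p = 0 ↔ aeval y p = 0 := by
  have := Finset.ext_iff.1 hxy p
  simp only [mem_cellIndex, hp, true_and] at this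
  exact not_iff_not.1 this

theorem inter_cell_insert_left [DecidableEq (MvPolynomial σ k)] {S U : Finset (MvPolynomial σ k)}
    {p : MvPolynomial σ k} (hp : p ∉ S) (hU : U ⊆ S) (T : Set (σ → F)) :
    T ∩ cell k (insert p S) U = T ∩ cell k S U ∩ {x | aeval x p = 0} := by
  have hpU : p ∉ U := fun h => hp (hU h)
  ext x
  simp only [cell, Set.mem_inter_iff, Set.mem_ofPred_eq, and_assoc, and_congr_right_iff]
  intro _
  simp only [Finset.ext_iff, mem_cellIndex, Finset.mem_insert]
  constructor
  · intro h
    have h0 : aeval x p = 0 := by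
      by_contra h0
      exact hpU ((h p).1 ⟨Or.inl rfl, h0⟩)
    refine ⟨fun q => ⟨fun hq => (h q).1 ⟨Or.inr hq.1, hq.2⟩, fun hq => ⟨hU hq, ((h q).2 hq).2⟩⟩, h0⟩
  · rintro ⟨h, h0⟩ q
    refine ⟨?_, fun hq => ⟨Or.inr (hU hq), ((h q).2 hq).2⟩⟩
    rintro ⟨rfl | hq, h1⟩
    · exact absurd h0 h1
    · exact (h q).1 ⟨hq, h1⟩

theorem inter_cell_insert_right [DecidableEq (MvPolynomial σ k)] {S U : Finset (MvPolynomial σ k)}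
    {p : MvPolynomial σ k} (hp : p ∉ S) (hU : U ⊆ S) (T : Set (σ → F)) :
    T ∩ cell k (insert p S) (insert p U) = T ∩ cell k S U ∩ {x | aeval x p ≠ 0} := by
  have hpU : p ∉ U := fun h => hp (hU h)
  ext x
  simp only [cell, Set.mem_inter_iff, Set.mem_ofPred_eq, and_assoc, and_congr_right_iff]
  intro _
  simp only [Finset.ext_iff, mem_cellIndex, Finset.mem_insert]
  constructor
  · intro h
    refine ⟨fun q => ⟨fun hq => ?_, fun hq => ⟨hU hq, ((h q).2 (Or.inr hq)).2⟩⟩,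
      ((h p).2 (Or.inl rfl)).2⟩
    rcases (h q).1 ⟨Or.inr hq.1, hq.2⟩ with rfl | h1
    · exact absurd hq.1 hp
    · exact h1
  · rintro ⟨h, h0⟩ q
    constructor
    · rintro ⟨rfl | hq, h1⟩
      · exact Or.inl rfl
      · exact Or.inr ((h q).1 ⟨hq, h1⟩)
    · rintro (rfl | hq)
      · exact ⟨Or.inl rfl, h0⟩
      · exact ⟨Or.inr (hU hq), ((h q).2 hq).2⟩

variable (k) in
/-- The class of the set of points of a subvariety of an affine space. -/
def subvarietyClass [Finite σ] (T : Set (σ → F)) : GrothendieckRing k :=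
  open Classical in if h : ∃ c, IsSubvariety k T c then h.choose else 0

theorem IsSubvariety.subvarietyClass_eq [Finite σ] [IsAlgClosed F] {T : Set (σ → F)}
    {c : GrothendieckRing k} (h : IsSubvariety k T c) : subvarietyClass k T = c := by
  have h' : ∃ c, IsSubvariety k T c := ⟨c, h⟩
  rw [subvarietyClass, dif_pos h']
  exact h'.choose_spec.unique h

/-- Each additional polynomial cuts every cell in two, an open and a closed part. -/
theorem exists_isSubvariety_inter_cell [Finite σ] [IsAlgClosed F] (S : Finset (MvPolynomial σ k))
    {T : Set (σ → F)} (hT : ∃ c, IsSubvariety k T c) :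
    (∀ U ⊆ S, ∃ c, IsSubvariety k (T ∩ cell k S U) c) ∧
    subvarietyClass k T = ∑ U ∈ S.powerset, subvarietyClass k (T ∩ cell k S U) := by
  classical
  induction S using Finset.induction_on with
  | empty =>
    have h0 : (cell k ∅ ∅ : Set (σ → F)) = Set.univ := by ext; simp [cell, cellIndex]
    simpa [h0] using hT
  | insert p S hp ih =>
    obtain ⟨ih1, ih2⟩ := ih
    have hs : ∀ U ⊆ S, ∃ c₁ c₂, IsSubvariety k (T ∩ cell k (insert p S) (insert p U)) c₁ ∧
        IsSubvariety k (T ∩ cell k (insert p S) U) c₂ ∧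
        subvarietyClass k (T ∩ cell k S U) = c₁ + c₂ := by
      intro U hU
      obtain ⟨c, hc⟩ := ih1 U hU
      obtain ⟨c₁, c₂, h1, h2, h3⟩ := hc.split p
      rw [inter_cell_insert_left hp hU, inter_cell_insert_right hp hU]
      exact ⟨c₁, c₂, h1, h2, hc.subvarietyClass_eq.trans h3⟩
    constructor
    · intro U hU
      by_cases hpU : p ∈ U
      · obtain ⟨c₁, c₂, h1, h2, h3⟩ := hs (U.erase p) (by rwa [← Finset.subset_insert_iff])
        rw [Finset.insert_erase hpU] at h1
        exact ⟨c₁, h1⟩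
      · obtain ⟨c₁, c₂, h1, h2, h3⟩ := hs U (by rwa [Finset.subset_insert_iff_of_notMem hpU] at hU)
        exact ⟨c₂, h2⟩
    · rw [ih2, Finset.sum_powerset_insert hp, ← Finset.sum_add_distrib]
      refine Finset.sum_congr rfl fun U hU => ?_
      obtain ⟨c₁, c₂, h1, h2, h3⟩ := hs U (Finset.mem_powerset.1 hU)
      rw [h3, h1.subvarietyClass_eq, h2.subvarietyClass_eq, add_comm]

/-- The intersections of `X` with the cells defined by `S` are subvarieties. -/
def IsAdapted (S : Finset (MvPolynomial σ k)) [Finite σ] (X : Set (σ → F)) : Prop :=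
  ∀ U ⊆ S, ∃ c, IsSubvariety k (X ∩ cell k S U) c

variable (k) in
/-- The class of a constructible subset of an affine space. -/
def affineClass [Finite σ] (X : Set (σ → F)) : GrothendieckRing k :=
  open Classical in
  if h : ∃ S : Finset (MvPolynomial σ k), IsAdapted S X then
    ∑ U ∈ h.choose.powerset, subvarietyClass k (X ∩ cell k h.choose U) else 0

/-- Two adapted families have a common refinement: both sums become the same double sum over pairs
of cells. -/
theorem affineClass_eq_sum [Finite σ] [IsAlgClosed F] {S : Finset (MvPolynomial σ k)}
    {X : Set (σ → F)} (hS : IsAdapted S X) :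
    affineClass k X = ∑ U ∈ S.powerset, subvarietyClass k (X ∩ cell k S U) := by
  have h : ∃ S : Finset (MvPolynomial σ k), IsAdapted S X := ⟨S, hS⟩
  rw [affineClass, dif_pos h]
  have h' := h.choose_spec
  generalize h.choose = S' at h'
  rw [Finset.sum_congr rfl fun U hU =>
    (exists_isSubvariety_inter_cell S (h' U (Finset.mem_powerset.1 hU))).2,
    Finset.sum_congr rfl (fun U hU =>
    (exists_isSubvariety_inter_cell S' (hS U (Finset.mem_powerset.1 hU))).2), Finset.sum_comm]
  refine Finset.sum_congr rfl fun U _ => Finset.sum_congr rfl fun U' _ => ?_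
  rw [Set.inter_right_comm]

theorem IsSubvariety.affineClass_eq [Finite σ] [IsAlgClosed F] {X : Set (σ → F)}
    {c : GrothendieckRing k} (h : IsSubvariety k X c) : affineClass k X = c := by
  have h0 : (cell k ∅ ∅ : Set (σ → F)) = Set.univ := by ext; simp [cell, cellIndex]
  have hA : IsAdapted (∅ : Finset (MvPolynomial σ k)) X := by
    intro U hU
    rw [Finset.subset_empty.1 hU, h0, Set.inter_univ]
    exact ⟨c, h⟩
  rw [affineClass_eq_sum hA]
  simpa [h0] using h.subvarietyClass_eq

variable (k) in
/-- The constructible subsets over `k` of an affine space. -/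
def IsCons [Finite σ] (X : Set (σ → F)) : Prop :=
  ∃ C : Set (affineSpace k σ).X.left, Topology.IsConstructible C ∧ X = affinePoint k ⁻¹' C

theorem isCons_aeval_ne [Finite σ] (p : MvPolynomial σ k) :
    IsCons k {x : σ → F | aeval x p ≠ 0} :=
  ⟨_, PrimeSpectrum.isConstructible_basicOpen (f := p), rfl⟩

theorem IsCons.compl [Finite σ] {X : Set (σ → F)} (h : IsCons k X) : IsCons k Xᶜ := by
  obtain ⟨C, hC, rfl⟩ := h
  exact ⟨Cᶜ, hC.compl, rfl⟩

theorem IsCons.inter [Finite σ] {X Y : Set (σ → F)} (h : IsCons k X) (h' : IsCons k Y) :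
    IsCons k (X ∩ Y) := by
  obtain ⟨C, hC, rfl⟩ := h
  obtain ⟨C', hC', rfl⟩ := h'
  exact ⟨C ∩ C', hC.inter hC', rfl⟩

theorem IsCons.union [Finite σ] {X Y : Set (σ → F)} (h : IsCons k X) (h' : IsCons k Y) :
    IsCons k (X ∪ Y) := by
  obtain ⟨C, hC, rfl⟩ := h
  obtain ⟨C', hC', rfl⟩ := h'
  exact ⟨C ∪ C', hC.union hC', rfl⟩

theorem isCons_empty [Finite σ] : IsCons k (∅ : Set (σ → F)) :=
  ⟨∅, Topology.IsConstructible.empty, rfl⟩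

theorem isCons_univ [Finite σ] : IsCons k (Set.univ : Set (σ → F)) :=
  ⟨Set.univ, Topology.IsConstructible.univ, rfl⟩

theorem IsCons.sdiff [Finite σ] {X Y : Set (σ → F)} (h : IsCons k X) (h' : IsCons k Y) :
    IsCons k (X \ Y) := h.inter h'.compl

theorem IsCons.iUnion [Finite σ] {ι : Type*} [Finite ι] {X : ι → Set (σ → F)}
    (h : ∀ i, IsCons k (X i)) : IsCons k (⋃ i, X i) := by
  choose C hC hX using h
  exact ⟨⋃ i, C i, Topology.IsConstructible.iUnion hC, by simp [hX, Set.preimage_iUnion]⟩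

theorem IsCons.iInter [Finite σ] {ι : Type*} [Finite ι] {X : ι → Set (σ → F)}
    (h : ∀ i, IsCons k (X i)) : IsCons k (⋂ i, X i) := by
  choose C hC hX using h
  exact ⟨⋂ i, C i, Topology.IsConstructible.iInter hC, by simp [hX, Set.preimage_iInter]⟩

theorem IsCons.setOf_forall [Finite σ] {ι : Type*} [Finite ι] {P : ι → (σ → F) → Prop}
    (h : ∀ i, IsCons k {x | P i x}) : IsCons k {x | ∀ i, P i x} := by
  have := IsCons.iInter h
  rwa [← Set.ofPred_forall] at this

theorem IsCons.setOf_exists [Finite σ] {ι : Type*} [Finite ι] {P : ι → (σ → F) → Prop}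
    (h : ∀ i, IsCons k {x | P i x}) : IsCons k {x | ∃ i, P i x} := by
  have := IsCons.iUnion h
  rwa [← Set.ofPred_exists] at this

theorem isCons_const [Finite σ] (P : Prop) : IsCons k {_x : σ → F | P} := by
  by_cases hP : P
  · simpa [hP] using isCons_univ
  · simpa [hP] using isCons_empty

theorem IsCons.setOf_imp [Finite σ] {P Q : (σ → F) → Prop}
    (hP : IsCons k {x | P x}) (hQ : IsCons k {x | Q x}) : IsCons k {x | P x → Q x} := by
  have := hP.compl.union hQ
  convert this using 1
  ext x; simp [imp_iff_not_or]

theorem IsCons.setOf_and [Finite σ] {P Q : (σ → F) → Prop}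
    (hP : IsCons k {x | P x}) (hQ : IsCons k {x | Q x}) : IsCons k {x | P x ∧ Q x} :=
  hP.inter hQ

theorem isCons_cell [Finite σ] (S U : Finset (MvPolynomial σ k)) :
    IsCons k (cell k S U : Set (σ → F)) := by
  by_cases hU : U ⊆ S
  · have : (cell k S U : Set (σ → F)) =
        {x | ∀ p : S, (p.1 ∈ U → aeval x p.1 ≠ 0) ∧ (aeval x p.1 ≠ 0 → p.1 ∈ U)} := by
      ext x
      simp only [cell, Set.mem_ofPred_eq, Finset.ext_iff, mem_cellIndex]
      constructor
      · exact fun h p => ⟨fun hp => ((h p).2 hp).2, fun hp => (h p).1 ⟨p.2, hp⟩⟩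
      · exact fun h p => ⟨fun hp => (h ⟨p, hp.1⟩).2 hp.2, fun hp => ⟨hU hp, (h ⟨p, hU hp⟩).1 hp⟩⟩
    rw [this]
    exact IsCons.setOf_forall fun p => ((isCons_const _).setOf_imp (isCons_aeval_ne _)).inter
      ((isCons_aeval_ne _).setOf_imp (isCons_const _))
  · have : (cell k S U : Set (σ → F)) = ∅ := by
      ext x
      simp only [cell, Set.mem_ofPred_eq, Set.mem_empty_iff_false, iff_false]
      rintro rfl
      exact hU (cellIndex_subset _ _)
    rw [this]; exact isCons_empty

/-- Together with `IsCons.exists_cellIndex`, this identifies the constructible sets with the unions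
of cells of a finite set of polynomials; later arguments only use this combinatorial form. -/
theorem isCons_of_cellIndex [Finite σ] (S : Finset (MvPolynomial σ k)) {X : Set (σ → F)}
    (h : ∀ x y, cellIndex k S x = cellIndex k S y → x ∈ X → y ∈ X) : IsCons k X := by
  have : X = ⋃ U : {U : S.powerset // ∃ x ∈ X, cellIndex k S x = U}, cell k S U := by
    ext x
    simp only [Set.mem_iUnion, cell, Set.mem_ofPred_eq]
    constructor
    · intro hx
      exact ⟨⟨⟨cellIndex k S x, Finset.mem_powerset.2 (cellIndex_subset _ _)⟩, x, hx, rfl⟩, rfl⟩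
    · rintro ⟨⟨U, y, hy, hyU⟩, hx⟩
      exact h y x (hyU.trans hx.symm) hy
  rw [this]
  exact IsCons.iUnion fun U => isCons_cell _ _

theorem IsCons.exists_cellIndex [Finite σ] {X : Set (σ → F)} (h : IsCons k X) :
    ∃ S : Finset (MvPolynomial σ k), ∀ x y, cellIndex k S x = cellIndex k S y →
      x ∈ X → y ∈ X := by
  classical
  obtain ⟨C, hC, rfl⟩ := h
  obtain ⟨D, rfl⟩ := PrimeSpectrum.exists_constructibleSetData_iff.2 hC
  refine ⟨D.biUnion fun B => insert B.f (Finset.univ.image B.g), fun x y hxy hx => ?_⟩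
  obtain ⟨B, hB, hx⟩ := Set.mem_iUnion₂.1 hx
  refine Set.mem_iUnion₂.2 ⟨B, hB, ?_⟩
  have hmem : ∀ p ∈ insert B.f (Finset.univ.image B.g), (aeval x p = 0 ↔ aeval y p = 0) :=
    fun p hp => aeval_eq_zero_iff_of_cellIndex_eq hxy (Finset.mem_biUnion.2 ⟨B, hB, hp⟩)
  refine ⟨?_, fun h => hx.2 ?_⟩
  · refine affinePoint_mem_zeroLocus.2 ?_
    rintro _ ⟨i, rfl⟩
    exact (hmem (B.g i) (by simp)).1 (affinePoint_mem_zeroLocus.1 hx.1 _ ⟨i, rfl⟩)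
  · refine affinePoint_mem_zeroLocus.2 ?_
    rintro _ rfl
    exact (hmem B.f (by simp)).2 (affinePoint_mem_zeroLocus.1 h _ rfl)

theorem inter_cell_eq_or [Finite σ] {S : Finset (MvPolynomial σ k)} {X : Set (σ → F)}
    (h : ∀ x y, cellIndex k S x = cellIndex k S y → x ∈ X → y ∈ X)
    (U : Finset (MvPolynomial σ k)) : X ∩ cell k S U = ∅ ∨ X ∩ cell k S U = cell k S U := by
  rcases (X ∩ cell k S U).eq_empty_or_nonempty with h0 | ⟨x, hx, hxU⟩
  · exact Or.inl h0
  · exact Or.inr (Set.inter_eq_right.2 fun y hy => h x y (hxU.trans hy.symm) hx)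

theorem isAdapted_of_cellIndex [Finite σ] [IsAlgClosed F] {S : Finset (MvPolynomial σ k)}
    {X : Set (σ → F)} (h : ∀ x y, cellIndex k S x = cellIndex k S y → x ∈ X → y ∈ X) :
    IsAdapted S X := by
  intro U hU
  rcases inter_cell_eq_or h U with h0 | h0
  · rw [h0]; exact ⟨0, isSubvariety_empty⟩
  · rw [h0]
    have := (exists_isSubvariety_inter_cell S ⟨_, isSubvariety_univ (k := k) (F := F)⟩).1 U hU
    rwa [Set.univ_inter] at this

/-- For a set of polynomials that serves both sets, each cell lies inside or outside each of them,
and no nonempty cell lies in both. -/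
theorem affineClass_union [Finite σ] [IsAlgClosed F] {X Y : Set (σ → F)} (hX : IsCons k X)
    (hY : IsCons k Y) (hd : Disjoint X Y) :
    affineClass k (X ∪ Y) = affineClass k X + affineClass k Y := by
  classical
  obtain ⟨S, hS⟩ := hX.exists_cellIndex
  obtain ⟨S', hS'⟩ := hY.exists_cellIndex
  have h1 : ∀ x y, cellIndex k (S ∪ S') x = cellIndex k (S ∪ S') y → x ∈ X → y ∈ X :=
    fun x y h => hS x y (cellIndex_mono Finset.subset_union_left h)
  have h2 : ∀ x y, cellIndex k (S ∪ S') x = cellIndex k (S ∪ S') y → x ∈ Y → y ∈ Y :=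
    fun x y h => hS' x y (cellIndex_mono Finset.subset_union_right h)
  have h3 : ∀ x y, cellIndex k (S ∪ S') x = cellIndex k (S ∪ S') y → x ∈ X ∪ Y → y ∈ X ∪ Y :=
    fun x y h => Or.imp (h1 x y h) (h2 x y h)
  rw [affineClass_eq_sum (isAdapted_of_cellIndex h1), affineClass_eq_sum (isAdapted_of_cellIndex h2),
    affineClass_eq_sum (isAdapted_of_cellIndex h3), ← Finset.sum_add_distrib]
  have hempty : subvarietyClass k (∅ : Set (σ → F)) = 0 := isSubvariety_empty.subvarietyClass_eq
  refine Finset.sum_congr rfl fun U _ => ?_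
  rw [Set.union_inter_distrib_right]
  rcases inter_cell_eq_or h1 U with h0 | h0
  · rw [h0, Set.empty_union, hempty, zero_add]
  rcases inter_cell_eq_or h2 U with h0' | h0'
  · rw [h0', Set.union_empty, hempty, add_zero]
  · have : (cell k (S ∪ S') U : Set (σ → F)) = ∅ := by
      have := hd.mono (Set.inter_subset_left (t := cell k (S ∪ S') U))
        (Set.inter_subset_left (t := cell k (S ∪ S') U))
      rw [h0, h0'] at this
      exact disjoint_self.1 this
    simp [this, hempty]

theorem affineClass_empty [Finite σ] [IsAlgClosed F] : affineClass k (∅ : Set (σ → F)) = 0 :=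
  isSubvariety_empty.affineClass_eq

theorem affineClass_biUnion [Finite σ] [IsAlgClosed F] {ι : Type*} (s : Finset ι)
    {X : ι → Set (σ → F)} (hX : ∀ i ∈ s, IsCons k (X i))
    (hd : (s : Set ι).PairwiseDisjoint X) :
    IsCons k (⋃ i ∈ s, X i) ∧
    affineClass k (⋃ i ∈ s, X i) = ∑ i ∈ s, affineClass k (X i) := by
  classical
  induction s using Finset.induction_on with
  | empty => simpa using ⟨isCons_empty, affineClass_empty⟩
  | insert a s ha ih =>
    obtain ⟨ih1, ih2⟩ := ih (fun i hi => hX i (Finset.mem_insert_of_mem hi))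
      (hd.subset (by simp))
    have h1 := hX a (Finset.mem_insert_self _ _)
    rw [Finset.set_biUnion_insert, Finset.sum_insert ha]
    refine ⟨h1.union ih1, ?_⟩
    rw [affineClass_union h1 ih1, ih2]
    rw [Set.disjoint_iUnion₂_right]
    intro i hi
    exact hd (by simp) (by simp [hi]) (by rintro rfl; exact ha hi)

theorem affineClass_iUnion [Finite σ] [IsAlgClosed F] {ι : Type*} [Fintype ι]
    {X : ι → Set (σ → F)} (hX : ∀ i, IsCons k (X i))
    (hd : Pairwise fun i j => Disjoint (X i) (X j)) :
    affineClass k (⋃ i, X i) = ∑ i, affineClass k (X i) := by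
  have := (affineClass_biUnion (k := k) Finset.univ (X := X) (fun i _ => hX i)
    (fun i _ j _ hij => hd hij)).2
  simpa using this

theorem affineClass_sdiff [Finite σ] [IsAlgClosed F] {X Y : Set (σ → F)} (hX : IsCons k X)
    (hY : IsCons k Y) (h : Y ⊆ X) :
    affineClass k (X \ Y) = affineClass k X - affineClass k Y := by
  rw [eq_sub_iff_add_eq, ← affineClass_union (hX.sdiff hY) hY Set.disjoint_sdiff_left,
    Set.sdiff_union_of_subset h]

end ClassFunction

/-! ### Piecewise rational functions and invariance of classes under them -/

section DefinableFunctions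

open MvPolynomial (aeval)

variable (k : Type u) [Field k] {F : Type u} [Field F] [Algebra k F]
variable {σ τ ρ : Type}

/-- The smallest set of functions on an affine space which contains the constants of `k` and the
coordinates, and is stable under sums, products and inverses (with `0⁻¹ = 0`). -/
inductive Definable : ((σ → F) → F) → Prop
  | const (a : k) : Definable fun _ => algebraMap k F a
  | coord (i : σ) : Definable fun x => x i
  | add {f g : (σ → F) → F} : Definable f → Definable g → Definable fun x => f x + g x
  | mul {f g : (σ → F) → F} : Definable f → Definable g → Definable fun x => f x * g x
  | inv {f : (σ → F) → F} : Definable f → Definable fun x => (f x)⁻¹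

variable {k}

namespace Definable

theorem zero : Definable k fun _ : σ → F => (0 : F) := by
  simpa using Definable.const (k := k) (F := F) (σ := σ) 0

theorem one : Definable k fun _ : σ → F => (1 : F) := by
  simpa using Definable.const (k := k) (F := F) (σ := σ) 1

theorem neg {f : (σ → F) → F} (hf : Definable k f) : Definable k fun x => -f x := by
  simpa using (Definable.const (k := k) (F := F) (σ := σ) (-1)).mul hf

theorem sub {f g : (σ → F) → F} (hf : Definable k f) (hg : Definable k g) :
    Definable k fun x => f x - g x := by
  simpa [sub_eq_add_neg] using hf.add hg.neg

theorem div {f g : (σ → F) → F} (hf : Definable k f) (hg : Definable k g) :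
    Definable k fun x => f x / g x := by
  simpa [div_eq_mul_inv] using hf.mul hg.inv

theorem sum {ι : Type*} (s : Finset ι) {f : ι → (σ → F) → F} (h : ∀ i ∈ s, Definable k (f i)) :
    Definable k fun x => ∑ i ∈ s, f i x := by
  classical
  induction s using Finset.induction_on with
  | empty => simpa using zero
  | insert a s ha ih =>
    simp only [Finset.sum_insert ha]
    exact (h a (by simp)).add (ih fun i hi => h i (by simp [hi]))

theorem prod {ι : Type*} (s : Finset ι) {f : ι → (σ → F) → F} (h : ∀ i ∈ s, Definable k (f i)) :
    Definable k fun x => ∏ i ∈ s, f i x := by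
  classical
  induction s using Finset.induction_on with
  | empty => simpa using one
  | insert a s ha ih =>
    simp only [Finset.prod_insert ha]
    exact (h a (by simp)).mul (ih fun i hi => h i (by simp [hi]))

theorem comp {f : (τ → F) → F} (hf : Definable k f) {g : (σ → F) → τ → F}
    (hg : ∀ j, Definable k fun x => g x j) : Definable k fun x => f (g x) := by
  induction hf with
  | const a => exact .const a
  | coord i => exact hg i
  | add _ _ h1 h2 => exact h1.add h2
  | mul _ _ h1 h2 => exact h1.mul h2
  | inv _ h1 => exact h1.inv

theorem aeval_comp {g : (σ → F) → τ → F} (hg : ∀ j, Definable k fun x => g x j)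
    (p : MvPolynomial τ k) : Definable k fun x => aeval (g x) p := by
  induction p using MvPolynomial.induction_on with
  | C a => simpa using Definable.const a
  | add p q hp hq => simpa using hp.add hq
  | mul_X p i hp => simpa using hp.mul (hg i)

theorem aeval_self (p : MvPolynomial σ k) : Definable k fun x : σ → F => aeval x p :=
  aeval_comp (fun j => .coord j) p

/-- On each cell of a suitable family the function is a quotient of two fixed polynomials. For
inverses the cells must also tell where the numerator vanishes, because there the value is `0`. -/
theorem exists_rational {f : (σ → F) → F} (hf : Definable k f) :
    ∃ S : Finset (MvPolynomial σ k), ∀ U, ∃ p q : MvPolynomial σ k, ∀ x ∈ cell k S U,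
      MvPolynomial.aeval x q ≠ 0 ∧ f x * MvPolynomial.aeval x q = MvPolynomial.aeval x p := by
  classical
  have mono : ∀ {S S' : Finset (MvPolynomial σ k)} {f : (σ → F) → F}, S ⊆ S' →
      (∀ U, ∃ p q : MvPolynomial σ k, ∀ x ∈ cell k S U,
      MvPolynomial.aeval x q ≠ 0 ∧ f x * MvPolynomial.aeval x q = MvPolynomial.aeval x p) →
      (∀ U, ∃ p q : MvPolynomial σ k, ∀ x ∈ cell k S' U,
      MvPolynomial.aeval x q ≠ 0 ∧ f x * MvPolynomial.aeval x q = MvPolynomial.aeval x p) := by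
    intro S S' f hS h U
    rcases (cell k S' U : Set (σ → F)).eq_empty_or_nonempty with h0 | ⟨y, hy⟩
    · exact ⟨0, 0, by simp [h0]⟩
    · obtain ⟨p, q, hpq⟩ := h (cellIndex k S y)
      exact ⟨p, q, fun x hx => hpq x (cellIndex_mono hS (hx.trans hy.symm))⟩
  induction hf with
  | const a => exact ⟨∅, fun U => ⟨MvPolynomial.C a, 1, fun x _ => by simp⟩⟩
  | coord i => exact ⟨∅, fun U => ⟨MvPolynomial.X i, 1, fun x _ => by simp⟩⟩
  | add _ _ h1 h2 =>
    obtain ⟨S, hS⟩ := h1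
    obtain ⟨S', hS'⟩ := h2
    refine ⟨S ∪ S', fun U => ?_⟩
    obtain ⟨p, q, h⟩ := mono Finset.subset_union_left hS U
    obtain ⟨p', q', h'⟩ := mono Finset.subset_union_right hS' U
    refine ⟨p * q' + p' * q, q * q', fun x hx => ?_⟩
    obtain ⟨a1, a2⟩ := h x hx
    obtain ⟨b1, b2⟩ := h' x hx
    simp only [map_mul, map_add, ← a2, ← b2]
    exact ⟨mul_ne_zero a1 b1, by ring⟩
  | mul _ _ h1 h2 =>
    obtain ⟨S, hS⟩ := h1
    obtain ⟨S', hS'⟩ := h2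
    refine ⟨S ∪ S', fun U => ?_⟩
    obtain ⟨p, q, h⟩ := mono Finset.subset_union_left hS U
    obtain ⟨p', q', h'⟩ := mono Finset.subset_union_right hS' U
    refine ⟨p * p', q * q', fun x hx => ?_⟩
    obtain ⟨a1, a2⟩ := h x hx
    obtain ⟨b1, b2⟩ := h' x hx
    simp only [map_mul, ← a2, ← b2]
    exact ⟨mul_ne_zero a1 b1, by ring⟩
  | inv _ h1 =>
    obtain ⟨S, hS⟩ := h1
    choose p q h using hS
    -- All numerators are added to the family, so that each has a constant vanishing behaviour on
    -- every new cell.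
    refine ⟨S ∪ S.powerset.image p, fun U => ?_⟩
    rcases (cell k (S ∪ S.powerset.image p) U : Set (σ → F)).eq_empty_or_nonempty with h0 | ⟨y, hy⟩
    · exact ⟨0, 0, by simp [h0]⟩
    have hc : ∀ x ∈ cell k (S ∪ S.powerset.image p) U, x ∈ cell k S (cellIndex k S y) :=
      fun x hx => cellIndex_mono Finset.subset_union_left (hx.trans hy.symm)
    have hp : p (cellIndex k S y) ∈ S ∪ S.powerset.image p :=
      Finset.mem_union_right _ (Finset.mem_image_of_mem _
        (Finset.mem_powerset.2 (cellIndex_subset _ _)))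
    have hz : ∀ x ∈ cell k (S ∪ S.powerset.image p) U,
        (MvPolynomial.aeval x (p (cellIndex k S y)) = 0 ↔
          MvPolynomial.aeval y (p (cellIndex k S y)) = 0) :=
      fun x hx => aeval_eq_zero_iff_of_cellIndex_eq (hx.trans hy.symm) hp
    by_cases hpy : MvPolynomial.aeval y (p (cellIndex k S y)) = 0
    · refine ⟨0, 1, fun x hx => ?_⟩
      obtain ⟨a1, a2⟩ := h _ x (hc x hx)
      rw [(hz x hx).2 hpy] at a2
      have := (mul_eq_zero.1 a2).resolve_right a1
      simp [this]
    · refine ⟨q (cellIndex k S y), p (cellIndex k S y), fun x hx => ?_⟩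
      obtain ⟨a1, a2⟩ := h _ x (hc x hx)
      have hpx := fun h0 => hpy ((hz x hx).1 h0)
      refine ⟨hpx, ?_⟩
      rw [← a2] at hpx ⊢
      rw [inv_mul_cancel_left₀ (left_ne_zero_of_mul hpx)]

theorem exists_rational_family [Finite τ] {f : (σ → F) → τ → F}
    (hf : ∀ j, Definable k fun x => f x j) :
    ∃ S : Finset (MvPolynomial σ k), ∀ U, ∃ (p : τ → MvPolynomial σ k) (q : MvPolynomial σ k),
      ∀ x ∈ cell k S U, MvPolynomial.aeval x q ≠ 0 ∧
        ∀ j, f x j * MvPolynomial.aeval x q = MvPolynomial.aeval x (p j) := by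
  classical
  have := Fintype.ofFinite τ
  choose S hS using fun j => (hf j).exists_rational
  refine ⟨Finset.univ.biUnion S, fun U => ?_⟩
  rcases (cell k (Finset.univ.biUnion S) U : Set (σ → F)).eq_empty_or_nonempty with h0 | ⟨y, hy⟩
  · exact ⟨0, 0, by simp [h0]⟩
  choose p q h using fun j => hS j (cellIndex k (S j) y)
  have hc : ∀ x ∈ cell k (Finset.univ.biUnion S) U, ∀ j, x ∈ cell k (S j) (cellIndex k (S j) y) :=
    fun x hx j => cellIndex_mono (Finset.subset_biUnion_of_mem S (Finset.mem_univ j))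
      (hx.trans hy.symm)
  refine ⟨fun j => p j * ∏ i ∈ Finset.univ.erase j, q i, ∏ i, q i, fun x hx => ⟨?_, fun j => ?_⟩⟩
  · rw [map_prod]
    exact Finset.prod_ne_zero_iff.2 fun j _ => (h j x (hc x hx j)).1
  · rw [map_mul, ← (h j x (hc x hx j)).2, ← Finset.mul_prod_erase _ _ (Finset.mem_univ j), map_mul,
      mul_assoc]

/-- Once the numerators belong to the family, vanishing of the function depends only on the cell. -/
theorem isCons_eq_zero [Finite σ] {f : (σ → F) → F} (hf : Definable k f) :
    IsCons k {x | f x = 0} := by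
  classical
  obtain ⟨S, hS⟩ := hf.exists_rational
  choose p q h using hS
  refine isCons_of_cellIndex (S ∪ S.powerset.image p) fun x y hxy hx => ?_
  have h1 := cellIndex_mono Finset.subset_union_left hxy
  have hp : p (cellIndex k S y) ∈ S ∪ S.powerset.image p :=
    Finset.mem_union_right _ (Finset.mem_image_of_mem _
      (Finset.mem_powerset.2 (cellIndex_subset _ _)))
  obtain ⟨a1, a2⟩ := h _ x h1
  obtain ⟨b1, b2⟩ := h _ y rfl
  have hx' : f x = 0 := hx
  rw [hx', zero_mul] at a2
  rw [(aeval_eq_zero_iff_of_cellIndex_eq hxy hp).1 a2.symm] at b2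
  exact (mul_eq_zero.1 b2).resolve_right b1

theorem isCons_eq [Finite σ] {f g : (σ → F) → F} (hf : Definable k f) (hg : Definable k g) :
    IsCons k {x | f x = g x} := by
  have := (hf.sub hg).isCons_eq_zero
  simpa only [sub_eq_zero] using this

end Definable

theorem IsCons.preimage [Finite σ] [Finite τ] {X : Set (τ → F)} (hX : IsCons k X)
    {f : (σ → F) → τ → F} (hf : ∀ j, Definable k fun x => f x j) : IsCons k (f ⁻¹' X) := by
  obtain ⟨S, hS⟩ := hX.exists_cellIndex
  have h : f ⁻¹' X = {x | ∃ U : S.powerset, (∃ y ∈ X, cellIndex k S y = U) ∧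
      f x ∈ cell k S U} := by
    ext x
    constructor
    · intro hx
      exact ⟨⟨cellIndex k S (f x), Finset.mem_powerset.2 (cellIndex_subset _ _)⟩, ⟨_, hx, rfl⟩, rfl⟩
    · rintro ⟨U, ⟨y, hy, hyU⟩, hx⟩
      exact hS y (f x) (hyU.trans hx.symm) hy
  rw [h]
  refine IsCons.setOf_exists fun U => (isCons_const _).setOf_and ?_
  have hU : {x | f x ∈ cell k S U} = {x | ∀ p : S, (p.1 ∈ U.1 → aeval (f x) p.1 ≠ 0) ∧
      (aeval (f x) p.1 ≠ 0 → p.1 ∈ U.1)} := by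
    ext x
    simp only [cell, Set.mem_ofPred_eq, Finset.ext_iff, mem_cellIndex]
    have hUS := Finset.mem_powerset.1 U.2
    constructor
    · exact fun h p => ⟨fun hp => ((h p).2 hp).2, fun hp => (h p).1 ⟨p.2, hp⟩⟩
    · exact fun h p => ⟨fun hp => (h ⟨p, hp.1⟩).2 hp.2, fun hp => ⟨hUS hp, (h ⟨p, hUS hp⟩).1 hp⟩⟩
  rw [hU]
  have hp : ∀ p : MvPolynomial τ k, IsCons k {x | aeval (f x) p ≠ 0} := fun p =>
    (Definable.aeval_comp hf p).isCons_eq_zero.compl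
  exact IsCons.setOf_forall fun p => ((isCons_const _).setOf_imp (hp _)).inter
      ((hp _).setOf_imp (isCons_const _))

theorem Definable.comp_inl {f : (σ → F) → F} (hf : Definable k f) :
    Definable k fun y : σ ⊕ τ → F => f (y ∘ Sum.inl) := hf.comp fun _ => .coord _

theorem IsCons.prod_univ [Finite σ] [Finite τ] {X : Set (σ → F)} (hX : IsCons k X) :
    IsCons k {y : σ ⊕ τ → F | y ∘ Sum.inl ∈ X} :=
  hX.preimage fun _ => .coord _

theorem Definable.ite [Finite σ] {X : Set (σ → F)} (hX : IsCons k X) {f g : (σ → F) → F}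
    [∀ x, Decidable (x ∈ X)] (hf : Definable k f) (hg : Definable k g) :
    Definable k fun x => if x ∈ X then f x else g x := by
  classical
  obtain ⟨S, hS⟩ := hX.exists_cellIndex
  let V := S.powerset.filter fun U => ∃ y ∈ X, cellIndex k S y = U
  -- With `0⁻¹ = 0`, the product `a * a⁻¹` is the indicator of `a ≠ 0`; `χ U` is the indicator of
  -- the cell of `U`.
  let χ : Finset (MvPolynomial σ k) → (σ → F) → F := fun U x =>
    ∏ p ∈ S, if p ∈ U then aeval x p * (aeval x p)⁻¹ else 1 - aeval x p * (aeval x p)⁻¹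
  have hχ : ∀ U ⊆ S, ∀ x, χ U x = if cellIndex k S x = U then 1 else 0 := by
    intro U hU x
    split_ifs with h
    · refine Finset.prod_eq_one fun p hp => ?_
      have := mem_cellIndex (S := S) (x := x) (p := p)
      rw [h] at this
      split_ifs with h1
      · exact mul_inv_cancel₀ (this.1 h1).2
      · have h0 : aeval x p = 0 := by
          by_contra h0
          exact h1 (this.2 ⟨hp, h0⟩)
        simp [h0]
    · have : ∃ p ∈ S, ¬ (p ∈ U ↔ aeval x p ≠ 0) := by
        by_contra hcon
        push Not at hcon
        refine h (Finset.ext fun p => mem_cellIndex.trans ⟨fun hp => (hcon p hp.1).2 hp.2,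
          fun hp => ⟨hU hp, (hcon p (hU hp)).1 hp⟩⟩)
      obtain ⟨p, hp, h1⟩ := this
      refine Finset.prod_eq_zero hp ?_
      split_ifs with h2
      · have : aeval x p = 0 := by tauto
        simp [this]
      · have : aeval x p ≠ 0 := by tauto
        simp [this]
  have hi : ∀ x, ∑ U ∈ V, χ U x = if x ∈ X then 1 else 0 := by
    intro x
    rw [Finset.sum_congr rfl fun U hU =>
      hχ U (Finset.mem_powerset.1 (Finset.mem_filter.1 hU).1) x, Finset.sum_ite_eq]
    congr 1
    refine propext ⟨fun h => ?_, fun h => ?_⟩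
    · obtain ⟨y, hy, hxy⟩ := (Finset.mem_filter.1 h).2
      exact hS y x hxy hy
    · exact Finset.mem_filter.2 ⟨Finset.mem_powerset.2 (cellIndex_subset _ _), x, h, rfl⟩
  have hd : Definable k fun x : σ → F => ∑ U ∈ V, χ U x := by
    refine Definable.sum _ fun U _ => Definable.prod _ fun p _ => ?_
    split_ifs
    · exact (Definable.aeval_self p).mul (Definable.aeval_self p).inv
    · exact Definable.one.sub ((Definable.aeval_self p).mul (Definable.aeval_self p).inv)
  have hfin := (hd.mul hf).add ((Definable.one.sub hd).mul hg)
  convert hfin using 2 with x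
  rw [hi]
  split_ifs <;> simp

theorem isCons_graph [Finite σ] [Finite τ] {X : Set (σ → F)} (hX : IsCons k X)
    {f : (σ → F) → τ → F} (hf : ∀ j, Definable k fun x => f x j) :
    IsCons k {y : σ ⊕ τ → F | y ∘ Sum.inl ∈ X ∧ y ∘ Sum.inr = f (y ∘ Sum.inl)} :=
  hX.prod_univ.inter (by
    simp only [funext_iff]
    exact IsCons.setOf_forall fun j => Definable.isCons_eq (.coord _) (hf j).comp_inl)

variable [IsAlgClosed F]

/-- Cell by cell, the graph is the graph of a rational map with nonvanishing denominator, which is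
isomorphic to its source. -/
theorem affineClass_graph [Finite σ] [Finite τ] {X : Set (σ → F)} (hX : IsCons k X)
    {f : (σ → F) → τ → F} (hf : ∀ j, Definable k fun x => f x j) :
    affineClass k {y : σ ⊕ τ → F | y ∘ Sum.inl ∈ X ∧ y ∘ Sum.inr = f (y ∘ Sum.inl)} =
      affineClass k X := by
  classical
  obtain ⟨S₁, hS₁⟩ := hX.exists_cellIndex
  obtain ⟨S₂, hS₂⟩ := Definable.exists_rational_family hf
  let S := S₁ ∪ S₂
  have hS : ∀ x y, cellIndex k S x = cellIndex k S y → x ∈ X → y ∈ X :=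
    fun x y h => hS₁ x y (cellIndex_mono Finset.subset_union_left h)
  let G : Finset (MvPolynomial σ k) → Set (σ ⊕ τ → F) := fun U =>
    {y | y ∘ Sum.inl ∈ X ∩ cell k S U ∧ y ∘ Sum.inr = f (y ∘ Sum.inl)}
  have hG : {y : σ ⊕ τ → F | y ∘ Sum.inl ∈ X ∧ y ∘ Sum.inr = f (y ∘ Sum.inl)} =
      ⋃ U ∈ S.powerset, G U := by
    ext y
    simp only [G, Set.mem_iUnion, Set.mem_ofPred_eq]
    constructor
    · rintro ⟨h1, h2⟩
      exact ⟨cellIndex k S (y ∘ Sum.inl), Finset.mem_powerset.2 (cellIndex_subset _ _),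
        ⟨h1, rfl⟩, h2⟩
    · rintro ⟨U, -, h1, h2⟩
      exact ⟨h1.1, h2⟩
  have hXU : X = ⋃ U ∈ S.powerset, X ∩ cell k S U := by
    ext x
    simp only [Set.mem_iUnion]
    constructor
    · intro hx
      exact ⟨cellIndex k S x, Finset.mem_powerset.2 (cellIndex_subset _ _), hx, rfl⟩
    · rintro ⟨U, -, hx, -⟩
      exact hx
  have hconsG : ∀ U, IsCons k (G U) := fun U =>
    ((hX.inter (isCons_cell S U)).prod_univ).inter (by
      simp only [funext_iff]
      exact IsCons.setOf_forall fun j => Definable.isCons_eq (.coord _) (hf j).comp_inl)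
  rw [hG]
  conv_rhs => rw [hXU]
  rw [(affineClass_biUnion (k := k) S.powerset (fun U _ => hconsG U) ?_).2,
    (affineClass_biUnion (k := k) S.powerset (fun U _ => hX.inter (isCons_cell S U)) ?_).2]
  · refine Finset.sum_congr rfl fun U hU => ?_
    obtain ⟨c, hc⟩ := isAdapted_of_cellIndex hS U (Finset.mem_powerset.1 hU)
    rw [hc.affineClass_eq]
    rcases (X ∩ cell k S U).eq_empty_or_nonempty with h0 | ⟨z, hz⟩
    · have : G U = ∅ := by
        ext y
        simp only [G, h0]
        simp
      rw [this, affineClass_empty]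
      rw [h0] at hc
      exact (hc.unique isSubvariety_empty).symm
    obtain ⟨p, q, hpq⟩ := hS₂ (cellIndex k S₂ z)
    have hpq' : ∀ x ∈ X ∩ cell k S U, aeval x q ≠ 0 ∧ ∀ j, f x j * aeval x q = aeval x (p j) :=
      fun x hx => hpq x (cellIndex_mono Finset.subset_union_right (hx.2.trans hz.2.symm))
    have := hc.graph p q fun x hx => (hpq' x hx).1
    rw [← this.affineClass_eq]
    congr 1
    ext y
    simp only [G, Set.mem_ofPred_eq, and_congr_right_iff]
    intro hy
    obtain ⟨h1, h2⟩ := hpq' _ hy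
    rw [funext_iff]
    refine forall_congr' fun j => ?_
    rw [← h2 j]
    exact ⟨fun h => congrArg (· * _) h, fun h => mul_right_cancel₀ h1 h⟩
  · intro U _ U' _ hne
    refine Set.disjoint_left.2 ?_
    rintro x ⟨-, h1⟩ ⟨-, h2⟩
    exact hne (h1.symm.trans h2)
  · intro U _ U' _ hne
    refine Set.disjoint_left.2 ?_
    rintro x ⟨⟨-, h1⟩, -⟩ ⟨⟨-, h2⟩, -⟩
    exact hne (h1.symm.trans h2)

theorem affineClass_reindex [Finite σ] [Finite τ] {X : Set (σ → F)} (hX : IsCons k X) (e : σ ≃ τ) :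
    affineClass k {y : τ → F | y ∘ e ∈ X} = affineClass k X := by
  classical
  obtain ⟨S, hS⟩ := hX.exists_cellIndex
  have hX' : {y : τ → F | y ∘ e ∈ X} = ⋃ U ∈ S.powerset, {y : τ → F | y ∘ e ∈ X ∩ cell k S U} := by
    ext y
    simp only [Set.mem_iUnion, Set.mem_ofPred_eq]
    constructor
    · intro hx
      exact ⟨cellIndex k S (y ∘ e), Finset.mem_powerset.2 (cellIndex_subset _ _), hx, rfl⟩
    · rintro ⟨U, -, hx, -⟩
      exact hx
  have hc : ∀ U, IsCons k {y : τ → F | y ∘ e ∈ X ∩ cell k S U} := fun U =>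
    (hX.inter (isCons_cell S U)).preimage fun _ => .coord _
  rw [hX', (affineClass_biUnion S.powerset (fun U _ => hc U) ?_).2,
    affineClass_eq_sum (isAdapted_of_cellIndex hS)]
  · refine Finset.sum_congr rfl fun U hU => ?_
    obtain ⟨c, hc⟩ := isAdapted_of_cellIndex hS U (Finset.mem_powerset.1 hU)
    rw [(hc.reindex e).affineClass_eq, hc.subvarietyClass_eq]
  · intro U _ U' _ hne
    refine Set.disjoint_left.2 ?_
    rintro x ⟨-, h1⟩ ⟨-, h2⟩
    exact hne (h1.symm.trans h2)

/-- The graphs of `f` and of its inverse `g` are the same set up to exchanging the two groups of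
coordinates, and each graph has the class of its source. -/
theorem affineClass_eq_of_bijOn [Finite σ] [Finite τ] {X : Set (σ → F)} {Y : Set (τ → F)}
    (hX : IsCons k X) (hY : IsCons k Y) (f : (σ → F) → τ → F) (g : (τ → F) → σ → F)
    (hf : ∀ j, Definable k fun x => f x j) (hg : ∀ i, Definable k fun y => g y i)
    (hfX : ∀ x ∈ X, f x ∈ Y ∧ g (f x) = x) (hgY : ∀ y ∈ Y, g y ∈ X ∧ f (g y) = y) :
    affineClass k X = affineClass k Y := by
  rw [← affineClass_graph hX hf, ← affineClass_graph hY hg,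
    ← affineClass_reindex (isCons_graph hY hg) (Equiv.sumComm τ σ)]
  congr 1
  ext y
  have e1 : (y ∘ Equiv.sumComm τ σ) ∘ Sum.inl = y ∘ Sum.inr := rfl
  have e2 : (y ∘ Equiv.sumComm τ σ) ∘ Sum.inr = y ∘ Sum.inl := rfl
  simp only [Set.mem_ofPred_eq, e1, e2]
  constructor
  · rintro ⟨h1, h2⟩
    rw [h2]
    exact ⟨(hfX _ h1).1, (hfX _ h1).2.symm⟩
  · rintro ⟨h1, h2⟩
    rw [h2]
    exact ⟨(hgY _ h1).1, (hgY _ h1).2.symm⟩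

theorem affineClass_prod_affineSpace [Finite σ] [Finite τ] {X : Set (σ → F)} (hX : IsCons k X) :
    affineClass k {y : σ ⊕ τ → F | y ∘ Sum.inl ∈ X} = affineClass k X * (affineSpace k τ).cls := by
  classical
  obtain ⟨S, hS⟩ := hX.exists_cellIndex
  have hX' : {y : σ ⊕ τ → F | y ∘ Sum.inl ∈ X} =
      ⋃ U ∈ S.powerset, {y : σ ⊕ τ → F | y ∘ Sum.inl ∈ X ∩ cell k S U} := by
    ext y
    simp only [Set.mem_iUnion, Set.mem_ofPred_eq]
    constructor
    · intro hx
      exact ⟨cellIndex k S (y ∘ Sum.inl), Finset.mem_powerset.2 (cellIndex_subset _ _), hx, rfl⟩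
    · rintro ⟨U, -, hx, -⟩
      exact hx
  have hc : ∀ U, IsCons k {y : σ ⊕ τ → F | y ∘ Sum.inl ∈ X ∩ cell k S U} := fun U =>
    (hX.inter (isCons_cell S U)).prod_univ
  rw [hX', (affineClass_biUnion S.powerset (fun U _ => hc U) ?_).2,
    affineClass_eq_sum (isAdapted_of_cellIndex hS), Finset.sum_mul]
  · refine Finset.sum_congr rfl fun U hU => ?_
    obtain ⟨c, hc⟩ := isAdapted_of_cellIndex hS U (Finset.mem_powerset.1 hU)
    rw [(hc.prod (τ := τ)).affineClass_eq, hc.subvarietyClass_eq]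
  · intro U _ U' _ hne
    refine Set.disjoint_left.2 ?_
    rintro x ⟨-, h1⟩ ⟨-, h2⟩
    exact hne (h1.symm.trans h2)

theorem affineSpace_cls_of_isEmpty [IsEmpty τ] : (affineSpace k τ).cls = 1 := by
  refine cls_eq_one ?_
  change IsIso (Spec.map (CommRingCat.ofHom (algebraMap k (MvPolynomial τ k))))
  have : IsIso (CommRingCat.ofHom (algebraMap k (MvPolynomial τ k))) :=
    (MvPolynomial.isEmptyAlgEquiv k τ).symm.toRingEquiv.toCommRingCatIso.isIso_hom
  infer_instance

-- Induction on the index type, one coordinate at a time, through the class of `X × 𝔸¹`. The points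
-- are taken in the algebraic closure of `k`, merely as an auxiliary field.
variable (k) in
theorem affineSpace_cls (τ : Type) [Finite τ] :
    (affineSpace k τ).cls = lefschetz k ^ Nat.card τ := by
  have huniv : ∀ (τ : Type) [Finite τ],
      affineClass k (Set.univ : Set (τ → AlgebraicClosure k)) =
      (affineSpace k τ).cls := fun τ _ => isSubvariety_univ.affineClass_eq
  refine Finite.induction_empty_option
    (P := fun τ => ∀ _ : Finite τ, (affineSpace k τ).cls = lefschetz k ^ Nat.card τ) ?_ ?_ ?_ τ ‹_›
  · intro α β e ih _
    have : Finite α := Finite.of_equiv _ e.symm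
    rw [← Nat.card_congr e, ← ih this, ← huniv, ← huniv, ← affineClass_reindex isCons_univ e]
    rfl
  · intro _
    rw [affineSpace_cls_of_isEmpty]; simp
  · intro α _ ih _
    rw [← huniv, Nat.card_eq_fintype_card, Fintype.card_option, ← Nat.card_eq_fintype_card, pow_succ,
      ← ih inferInstance, lefschetz, ← huniv α, ← affineClass_prod_affineSpace isCons_univ,
      ← affineClass_reindex (k := k) (isCons_univ.prod_univ (τ := Fin 1))
        ((Equiv.sumCongr (Equiv.refl α) (Equiv.ofUnique (Fin 1) PUnit.{1})).trans
          (Equiv.optionEquivSumPUnit.{0} α).symm)]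
    rfl

theorem affineClass_prod [Finite σ] [Finite τ] {X : Set (σ → F)} (hX : IsCons k X) :
    affineClass k {y : σ ⊕ τ → F | y ∘ Sum.inl ∈ X} =
      affineClass k X * lefschetz k ^ Nat.card τ := by
  rw [affineClass_prod_affineSpace hX, affineSpace_cls k]

end DefinableFunctions

/-! ### Linear algebra in families -/

section LinearFamilies

variable {k : Type u} [Field k] {F : Type u} [Field F] [Algebra k F]
variable {σ τ ρ : Type} [Finite σ]

/-- Gaussian elimination with parameters. The induction removes one unknown; the case distinction on
the pivot row is made by definable functions, so one formula solves all the solvable systems of the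
family. -/
theorem Definable.exists_solution [Finite ρ] [Fintype τ] (A : ρ → τ → (σ → F) → F)
    (b : ρ → (σ → F) → F) (hA : ∀ i j, Definable k (A i j)) (hb : ∀ i, Definable k (b i)) :
    ∃ s : τ → (σ → F) → F, (∀ j, Definable k (s j)) ∧
      ∀ x, (∃ v : τ → F, ∀ i, ∑ j, A i j x * v j = b i x) → ∀ i, ∑ j, A i j x * s j x = b i x := by
  classical
  revert A b hA hb
  refine Finite.induction_empty_option (P := fun τ => ∀ _ : Fintype τ, ∀ (A : ρ → τ → (σ → F) → F)
    (b : ρ → (σ → F) → F), (∀ i j, Definable k (A i j)) → (∀ i, Definable k (b i)) →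
    ∃ s : τ → (σ → F) → F, (∀ j, Definable k (s j)) ∧
      ∀ x, (∃ v : τ → F, ∀ i, ∑ j, A i j x * v j = b i x) → ∀ i, ∑ j, A i j x * s j x = b i x)
    ?_ ?_ ?_ τ inferInstance
  · intro α β e ih _ A b hA hb
    have : Fintype α := Fintype.ofEquiv _ e.symm
    obtain ⟨s, hs, h⟩ := ih this (fun i j => A i (e j)) b (fun i j => hA i _) hb
    refine ⟨fun j => s (e.symm j), fun j => hs _, fun x ⟨v, hv⟩ i => ?_⟩
    have := h x ⟨fun j => v (e j), fun i => by rw [← hv i, ← e.sum_comp]⟩ i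
    rw [← this, ← e.sum_comp]
    simp
  · intro _ A b hA hb
    exact ⟨fun j => j.elim, fun j => j.elim, fun x ⟨v, hv⟩ i => by simpa using hv i⟩
  · intro α _ ih _ A b hA hb
    have hsum : ∀ (f : Option α → F), ∑ j, f j = f none + ∑ j, f (some j) := by
      intro f
      convert Fintype.sum_option f
    have := Fintype.ofFinite ρ
    -- elimination of the first unknown with a given row
    have hrow : ∀ r : ρ, ∃ s : Option α → (σ → F) → F, (∀ j, Definable k (s j)) ∧
        ∀ x, A r none x ≠ 0 → (∃ v : Option α → F, ∀ i, ∑ j, A i j x * v j = b i x) →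
          ∀ i, ∑ j, A i j x * s j x = b i x := by
      intro r
      obtain ⟨s, hs, h⟩ := ih inferInstance
        (fun i j x => A i (some j) x - A i none x / A r none x * A r (some j) x)
        (fun i x => b i x - A i none x / A r none x * b r x)
        (fun i j => (hA _ _).sub (((hA _ _).div (hA _ _)).mul (hA _ _)))
        (fun i => (hb _).sub (((hA _ _).div (hA _ _)).mul (hb _)))
      -- Back-substitution: the eliminated unknown is recovered from row `r`, whose coefficient is
      -- not `0` in the case considered.
      refine ⟨fun j x => j.elim ((b r x - ∑ j, A r (some j) x * s j x) / A r none x)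
        fun j => s j x, ?_, fun x hx ⟨v, hv⟩ i => ?_⟩
      · rintro (_ | j)
        · exact ((hb r).sub (Definable.sum _ fun j _ => (hA _ _).mul (hs j))).div (hA _ _)
        · exact hs j
      · have hv' : ∀ i, A i none x * v none + ∑ j, A i (some j) x * v (some j) = b i x :=
          fun i => by rw [← hv i, hsum]
        have := h x ⟨fun j => v (some j), fun i => by
          simp only [sub_mul, Finset.sum_sub_distrib, mul_assoc, ← Finset.mul_sum]
          rw [← hv' i, ← hv' r]
          field_simp
          ring⟩ i
        simp only [sub_mul, Finset.sum_sub_distrib, mul_assoc, ← Finset.mul_sum] at this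
        rw [hsum]
        simp only [Option.elim]
        rw [sub_eq_iff_eq_add] at this
        rw [this]
        field_simp
        ring
    -- Gluing over the possible pivot rows: among the rows of `R`, one with nonzero first
    -- coefficient is selected by successive tests.
    have hfin : ∀ R : Finset ρ, ∃ s : Option α → (σ → F) → F, (∀ j, Definable k (s j)) ∧
        ∀ x, (∃ r ∈ R, A r none x ≠ 0) → (∃ v : Option α → F, ∀ i, ∑ j, A i j x * v j = b i x) →
          ∀ i, ∑ j, A i j x * s j x = b i x := by
      intro R
      induction R using Finset.induction_on with
      | empty => exact ⟨fun _ _ => 0, fun _ => Definable.zero, by simp⟩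
      | insert r R _ ihR =>
        obtain ⟨s, hs, h⟩ := ihR
        obtain ⟨s', hs', h'⟩ := hrow r
        refine ⟨fun j x => if x ∈ {x | A r none x ≠ 0} then s' j x else s j x,
          fun j => Definable.ite (hA r none).isCons_eq_zero.compl (hs' j) (hs j), ?_⟩
        rintro x ⟨r', hr', hx⟩ hv i
        by_cases h0 : x ∈ {x | A r none x ≠ 0}
        · simp only [if_pos h0]
          exact h' x h0 hv i
        · simp only [if_neg h0]
          refine h x ⟨r', ?_, hx⟩ hv i
          rcases Finset.mem_insert.1 hr' with rfl | h1
          · exact absurd hx h0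
          · exact h1
    obtain ⟨s, hs, h⟩ := hfin Finset.univ
    -- Without a pivot the first unknown does not occur; it is given the value `0` below.
    obtain ⟨s', hs', h'⟩ := ih inferInstance (fun i j => A i (some j)) b (fun i j => hA _ _) hb
    have hX : IsCons k {x : σ → F | ∃ r, A r none x ≠ 0} :=
      IsCons.setOf_exists fun r => (hA r none).isCons_eq_zero.compl
    refine ⟨fun j x => if x ∈ {x : σ → F | ∃ r, A r none x ≠ 0} then s j x else
      j.elim 0 fun j => s' j x, fun j => Definable.ite hX (hs j) ?_, fun x hv i => ?_⟩
    · rcases j with _ | j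
      · exact Definable.zero
      · exact hs' j
    · by_cases h0 : x ∈ {x : σ → F | ∃ r, A r none x ≠ 0}
      · simp only [if_pos h0]
        obtain ⟨r, hr⟩ := h0
        exact h x ⟨r, Finset.mem_univ _, hr⟩ hv i
      · simp only [if_neg h0]
        have h1 : ∀ i, A i none x = 0 := fun i => by
          by_contra h1; exact h0 ⟨i, h1⟩
        obtain ⟨v, hv⟩ := hv
        have := h' x ⟨fun j => v (some j), fun i => by rw [← hv i, hsum, h1, zero_mul, zero_add]⟩ i
        rw [hsum, h1, zero_mul, zero_add]
        exact this

theorem isCons_exists_solution [Finite ρ] [Fintype τ] (A : ρ → τ → (σ → F) → F)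
    (b : ρ → (σ → F) → F) (hA : ∀ i j, Definable k (A i j)) (hb : ∀ i, Definable k (b i)) :
    IsCons k {x | ∃ v : τ → F, ∀ i, ∑ j, A i j x * v j = b i x} := by
  obtain ⟨s, hs, h⟩ := Definable.exists_solution A b hA hb
  have : {x | ∃ v : τ → F, ∀ i, ∑ j, A i j x * v j = b i x} =
      {x | ∀ i, ∑ j, A i j x * s j x = b i x} := by
    ext x
    exact ⟨fun hv => h x hv, fun hv => ⟨_, hv⟩⟩
  rw [this]
  exact IsCons.setOf_forall fun i => Definable.isCons_eq
    (Definable.sum _ fun j _ => (hA i j).mul (hs j)) (hb i)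

theorem mem_span_range_iff_solution [Fintype ρ] {w : ρ → τ → F} {v : τ → F} :
    v ∈ Submodule.span F (Set.range w) ↔ ∃ c : ρ → F, ∀ i, ∑ j, w j i * c j = v i := by
  rw [Submodule.mem_span_range_iff_exists_fun]
  refine exists_congr fun c => ?_
  rw [funext_iff]
  refine forall_congr' fun i => ?_
  simp [Finset.sum_apply, mul_comm]

theorem isCons_mem_span [Finite ρ] [Finite τ] {w : ρ → (σ → F) → τ → F}
    (hw : ∀ i j, Definable k fun x => w i x j) {v : (σ → F) → τ → F}
    (hv : ∀ j, Definable k fun x => v x j) :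
    IsCons k {x | v x ∈ Submodule.span F (Set.range fun i => w i x)} := by
  have := Fintype.ofFinite ρ
  simp only [mem_span_range_iff_solution]
  exact isCons_exists_solution (fun i j x => w j x i) (fun i x => v x i) (fun i j => hw j i) hv

theorem isCons_span [Finite τ] [Finite ρ] (w : ρ → (σ → F) → τ → F)
    (hw : ∀ i j, Definable k fun x => w i x j) {X : Set (σ → F)} (hX : IsCons k X) :
    IsCons k {y : σ ⊕ τ → F | y ∘ Sum.inl ∈ X ∧
      y ∘ Sum.inr ∈ Submodule.span F (Set.range fun i => w i (y ∘ Sum.inl))} :=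
  hX.prod_univ.inter (isCons_mem_span (fun i j => (hw i j).comp_inl) fun _ => .coord _)

variable [IsAlgClosed F]

/-- Induction on the number of vectors. Where the last vector depends on the others it can be
dropped; elsewhere its coefficient is an additional free coordinate, which contributes one factor
`𝐋`. -/
theorem affineClass_span_fin [Finite τ] {m : ℕ} (w : Fin m → (σ → F) → τ → F)
    (hw : ∀ i j, Definable k fun x => w i x j) {X : Set (σ → F)} (hX : IsCons k X) (r : ℕ)
    (hr : ∀ x ∈ X, Module.finrank F (Submodule.span F (Set.range fun i => w i x)) = r) :
    affineClass k {y : σ ⊕ τ → F | y ∘ Sum.inl ∈ X ∧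
      y ∘ Sum.inr ∈ Submodule.span F (Set.range fun i => w i (y ∘ Sum.inl))} =
    affineClass k X * lefschetz k ^ r := by
  have hcons : ∀ {m : ℕ} (w : Fin m → (σ → F) → τ → F) (_ : ∀ i j, Definable k fun x => w i x j)
      {X : Set (σ → F)} (_ : IsCons k X), IsCons k {y : σ ⊕ τ → F | y ∘ Sum.inl ∈ X ∧
      y ∘ Sum.inr ∈ Submodule.span F (Set.range fun i => w i (y ∘ Sum.inl))} :=
    fun w hw X hX => hX.prod_univ.inter
      (isCons_mem_span (fun i j => (hw i j).comp_inl) fun j => .coord _)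
  induction m generalizing X r with
  | zero =>
    have h0 : ∀ x, Submodule.span F (Set.range fun i => w i x) = ⊥ := fun x => by
      rw [Set.range_eq_empty, Submodule.span_empty]
    rcases X.eq_empty_or_nonempty with rfl | ⟨x, hx⟩
    · simp [affineClass_empty]
    have hr0 : r = 0 := by
      rw [← hr x hx, h0, finrank_bot]
    simp only [h0, Submodule.mem_bot]
    rw [hr0, pow_zero, mul_one]
    exact affineClass_graph hX (f := fun _ => 0) fun j => Definable.zero
  | succ m ih =>
    let w' : Fin m → (σ → F) → τ → F := fun i => w i.castSucc
    have hw' : ∀ i j, Definable k fun x => w' i x j := fun i j => hw _ j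
    have hspan : ∀ x, Submodule.span F (Set.range fun i => w i x) =
        Submodule.span F (Set.range fun i => w' i x) ⊔ Submodule.span F {w (Fin.last m) x} := by
      intro x
      rw [← Submodule.span_union]
      congr 1
      ext v
      simp only [Set.mem_range, Fin.exists_fin_succ', Set.mem_union, Set.mem_singleton_iff, w', eq_comm]
    let Z : Set (σ → F) := {x | w (Fin.last m) x ∈ Submodule.span F (Set.range fun i => w' i x)}
    have hZ : IsCons k Z := isCons_mem_span hw' (hw _)
    let E : Set (σ → F) → Set (σ ⊕ τ → F) := fun X => {y | y ∘ Sum.inl ∈ X ∧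
      y ∘ Sum.inr ∈ Submodule.span F (Set.range fun i => w i (y ∘ Sum.inl))}
    have h1 : affineClass k (E (X ∩ Z)) = affineClass k (X ∩ Z) * lefschetz k ^ r := by
      have hs : ∀ x ∈ X ∩ Z, Submodule.span F (Set.range fun i => w i x) =
          Submodule.span F (Set.range fun i => w' i x) := by
        intro x hx
        rw [hspan, sup_eq_left, Submodule.span_singleton_le_iff_mem]
        exact hx.2
      rw [← ih w' hw' (hX.inter hZ) r fun x hx => by rw [← hs x hx, hr x hx.1]]
      congr 1
      ext y
      refine and_congr_right fun hy => ?_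
      rw [hs _ hy]
    have h2 : affineClass k (E (X \ Z)) = affineClass k (X \ Z) * lefschetz k ^ r := by
      rcases (X \ Z).eq_empty_or_nonempty with h0 | ⟨x₀, hx₀⟩
      · simp [E, h0, affineClass_empty]
      have hfr : ∀ x ∈ X \ Z, Module.finrank F (Submodule.span F (Set.range fun i => w' i x)) + 1 = r := by
        intro x hx
        rw [← hr x hx.1, hspan]
        have hne : w (Fin.last m) x ≠ 0 := fun h0 => hx.2 (by
          change w (Fin.last m) x ∈ Submodule.span F (Set.range fun i => w' i x)
          rw [h0]; exact Submodule.zero_mem _)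
        have hinf : Submodule.span F (Set.range fun i => w' i x) ⊓
            Submodule.span F {w (Fin.last m) x} = ⊥ := by
          rw [← disjoint_iff]
          exact (Submodule.disjoint_span_singleton' hne).2 hx.2
        have := Submodule.finrank_sup_add_finrank_inf_eq
          (Submodule.span F (Set.range fun i => w' i x)) (Submodule.span F {w (Fin.last m) x})
        rw [hinf, finrank_bot, finrank_span_singleton hne] at this
        omega
      obtain ⟨r', rfl⟩ : ∃ r', r = r' + 1 := ⟨_, (hfr x₀ hx₀).symm⟩
      have hX2 := hX.sdiff hZ
      rw [pow_succ, ← mul_assoc, ← ih w' hw' hX2 r' fun x hx => by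
        have := hfr x hx; omega]
      have hE' := hcons w' hw' hX2
      have hL := affineClass_prod (τ := Fin 1) hE'
      rw [Nat.card_eq_fintype_card, Fintype.card_fin, pow_one] at hL
      rw [← hL]
      symm
      -- A definable expression of a vector of the span in the given generators. It is not unique,
      -- but outside `Z` the coefficient of the last generator is, and only this coefficient enters
      -- the inverse map.
      obtain ⟨s, hs, hsol⟩ := Definable.exists_solution (σ := σ ⊕ τ)
        (fun (i : τ) (j : Fin (m + 1)) y => w j (y ∘ Sum.inl) i) (fun i y => y (Sum.inr i))
        (fun i j => (hw j i).comp_inl) (fun i => .coord _)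
      refine affineClass_eq_of_bijOn hE'.prod_univ (hcons w hw hX2)
        (fun y => Sum.elim (fun i => y (Sum.inl (Sum.inl i)))
          fun j => y (Sum.inl (Sum.inr j)) + y (Sum.inr 0) * w (Fin.last m) (y ∘ Sum.inl ∘ Sum.inl) j)
        (fun y => Sum.elim (Sum.elim (fun i => y (Sum.inl i))
          fun j => y (Sum.inr j) - s (Fin.last m) y * w (Fin.last m) (y ∘ Sum.inl) j)
          fun _ => s (Fin.last m) y) ?_ ?_ ?_ ?_
      · rintro (i | j)
        · exact .coord _
        · exact (Definable.coord _).add ((Definable.coord _).mul ((hw _ j).comp fun i => .coord _))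
      · rintro ((i | j) | i)
        · exact .coord _
        · exact (Definable.coord _).sub ((hs _).mul (hw _ j).comp_inl)
        · exact hs _
      · rintro y ⟨hy1, hy2⟩
        set x : σ → F := y ∘ Sum.inl ∘ Sum.inl with hx
        set z : σ ⊕ τ → F := Sum.elim (fun i => y (Sum.inl (Sum.inl i)))
          fun j => y (Sum.inl (Sum.inr j)) + y (Sum.inr 0) * w (Fin.last m) x j with hz
        have hzl : z ∘ Sum.inl = x := rfl
        have hzr : z ∘ Sum.inr = (y ∘ Sum.inl) ∘ Sum.inr + y (Sum.inr 0) • w (Fin.last m) x := rfl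
        have hmem : z ∘ Sum.inr ∈ Submodule.span F (Set.range fun i => w i x) := by
          rw [hspan, hzr]
          exact Submodule.add_mem_sup hy2 (Submodule.smul_mem _ _ (Submodule.mem_span_singleton_self _))
        have hxX : x ∈ X \ Z := hy1
        refine ⟨⟨hxX, hmem⟩, ?_⟩
        have hs' := hsol z (mem_span_range_iff_solution.1 (hzl ▸ hmem))
        -- Two different values of the last coefficient would put the last vector in the span of the
        -- others, against `x ∉ Z`.
        have hlam : s (Fin.last m) z = y (Sum.inr 0) := by
          by_contra hne
          refine hxX.2 ?_
          have hsum : ∑ j, s (Fin.castSucc j) z • w' j x + s (Fin.last m) z • w (Fin.last m) x =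
              z ∘ Sum.inr := by
            ext i
            have := hs' i
            rw [Fin.sum_univ_castSucc] at this
            simp only [hzl] at this
            simp only [Pi.add_apply, Finset.sum_apply, Pi.smul_apply, smul_eq_mul, Function.comp, w']
            rw [← this, mul_comm (w (Fin.last m) x i)]
            congr 1
            exact Finset.sum_congr rfl fun j _ => mul_comm _ _
          have h3 : (s (Fin.last m) z - y (Sum.inr 0)) • w (Fin.last m) x =
              (y ∘ Sum.inl) ∘ Sum.inr - ∑ j, s (Fin.castSucc j) z • w' j x := by
            rw [sub_smul, sub_eq_sub_iff_add_eq_add, ← hzr, ← hsum, add_comm]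
          have h4 : (s (Fin.last m) z - y (Sum.inr 0)) • w (Fin.last m) x ∈
              Submodule.span F (Set.range fun i => w' i x) := by
            rw [h3]
            refine Submodule.sub_mem _ hy2 (Submodule.sum_mem _ fun j _ => Submodule.smul_mem _ _
              (Submodule.subset_span ⟨j, rfl⟩))
          exact (Submodule.smul_mem_iff _ (sub_ne_zero.2 hne)).1 h4
        funext i
        rcases i with (i | j) | i
        · rfl
        · simp only [Sum.elim_inl, Sum.elim_inr, hlam, hzl]
          simp [hz]
        · simp only [Sum.elim_inr, hlam]
          rw [Subsingleton.elim i 0]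
      · rintro z ⟨hz1, hz2⟩
        have hs' := hsol z (mem_span_range_iff_solution.1 hz2)
        have hsum : z ∘ Sum.inr - s (Fin.last m) z • w (Fin.last m) (z ∘ Sum.inl) =
            ∑ j, s (Fin.castSucc j) z • w' j (z ∘ Sum.inl) := by
          ext i
          have := hs' i
          rw [Fin.sum_univ_castSucc] at this
          simp only [Pi.sub_apply, Finset.sum_apply, Pi.smul_apply, smul_eq_mul, Function.comp_apply, w']
          rw [← this, mul_comm (w (Fin.last m) (z ∘ Sum.inl) i), add_sub_cancel_right]
          exact Finset.sum_congr rfl fun j _ => mul_comm _ _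
        refine ⟨⟨hz1, ?_⟩, ?_⟩
        · change z ∘ Sum.inr - s (Fin.last m) z • w (Fin.last m) (z ∘ Sum.inl) ∈
            Submodule.span F (Set.range fun i => w' i (z ∘ Sum.inl))
          rw [hsum]
          exact Submodule.sum_mem _ fun j _ => Submodule.smul_mem _ _
              (Submodule.subset_span ⟨j, rfl⟩)
        · funext i
          rcases i with i | j
          · rfl
          · exact sub_add_cancel _ _
    have hE : E X = E (X ∩ Z) ∪ E (X \ Z) := by
      ext y
      simp only [E, Set.mem_union, Set.mem_ofPred_eq, Set.mem_inter_iff, Set.mem_sdiff]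
      tauto
    change affineClass k (E X) = _
    rw [hE, affineClass_union (hcons w hw (hX.inter hZ)) (hcons w hw (hX.sdiff hZ)), h1, h2,
      ← add_mul, ← affineClass_union (hX.inter hZ) (hX.sdiff hZ), Set.inter_union_sdiff]
    · exact Set.disjoint_left.2 fun x h h' => h'.2 h.2
    · exact Set.disjoint_left.2 fun y h h' => h'.1.2 h.1.2

theorem affineClass_span [Finite τ] [Finite ρ] (w : ρ → (σ → F) → τ → F)
    (hw : ∀ i j, Definable k fun x => w i x j) {X : Set (σ → F)} (hX : IsCons k X) (r : ℕ)
    (hr : ∀ x ∈ X, Module.finrank F (Submodule.span F (Set.range fun i => w i x)) = r) :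
    affineClass k {y : σ ⊕ τ → F | y ∘ Sum.inl ∈ X ∧
      y ∘ Sum.inr ∈ Submodule.span F (Set.range fun i => w i (y ∘ Sum.inl))} =
    affineClass k X * lefschetz k ^ r := by
  have := Fintype.ofFinite ρ
  let e := Fintype.equivFin ρ
  have hrange : ∀ x, (Set.range fun i => w (e.symm i) x) = Set.range fun i => w i x :=
    fun x => e.symm.surjective.range_comp fun i => w i x
  have := affineClass_span_fin (fun i => w (e.symm i)) (fun i j => hw _ j) hX r
    (fun x hx => by rw [hrange]; exact hr x hx)
  rw [← this]
  congr 1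
  ext y
  change (_ ∧ _) ↔ (_ ∧ _)
  rw [hrange]

end LinearFamilies

/-! ### Classes computed from charts -/

section Atlases

variable (k : Type u) [Field k] {F : Type u} [Field F] [Algebra k F]
variable {ι ι' : Type} {σ : ι → Type} [∀ i, Finite (σ i)] {σ' : ι' → Type} [∀ i, Finite (σ' i)]
  {Y : Type u}

/-- Two systems of charts are related by definable changes of coordinates. -/
def Compatible (φ : ∀ i, (σ i → F) → Y) (φ' : ∀ i, (σ' i → F) → Y) : Prop :=
  ∀ i i', ∃ (t : (σ i → F) → σ' i' → F) (t' : (σ' i' → F) → σ i → F),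
    (∀ j, Definable k fun x => t x j) ∧ (∀ j, Definable k fun y => t' y j) ∧
    IsCons k {x | φ i x ∈ Set.range (φ' i')} ∧ IsCons k {y | φ' i' y ∈ Set.range (φ i)} ∧
    ∀ x y, φ i x = φ' i' y → t x = y ∧ t' y = x

/-- `A` is the disjoint union of the images of the constructible sets `X j` in charts. -/
structure IsPresentation {J : Type*} (φ : ∀ i, (σ i → F) → Y) (A : Set Y) (i : J → ι)
    (X : ∀ j, Set (σ (i j) → F)) : Prop where
  isCons : ∀ j, IsCons k (X j)
  disjoint : Pairwise fun j j' => Disjoint (φ (i j) '' X j) (φ (i j') '' X j')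
  eq : A = ⋃ j, φ (i j) '' X j

variable {k} [IsAlgClosed F]

theorem HasClass.exists_presentation {φ : ∀ i, (σ i → F) → Y} {A : Set Y} {c : GrothendieckRing k}
    (h : HasClass k φ A c) : ∃ (r : ℕ) (i : Fin r → ι) (X : ∀ j, Set (σ (i j) → F)),
      IsPresentation k φ A i X ∧ c = ∑ j, affineClass k (X j) := by
  obtain ⟨r, i, V, f, hf, hd, hA, rfl⟩ := h
  refine ⟨r, i, fun j => affinePoint k ⁻¹' Set.range (f j).left, ⟨fun j => ?_, hd, hA⟩, ?_⟩
  · have := hf j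
    exact ⟨_, isConstructible_range_of_isImmersion _ _, rfl⟩
  · refine Finset.sum_congr rfl fun j _ => ?_
    exact (IsSubvariety.affineClass_eq (F := F) ⟨V j, f j, hf j, rfl, rfl⟩).symm

/-- Each constructible piece is cut further into cells, which are subvarieties of the charts. -/
theorem IsPresentation.hasClass {J : Type*} [Fintype J] {φ : ∀ i, (σ i → F) → Y} {A : Set Y}
    {i : J → ι} {X : ∀ j, Set (σ (i j) → F)} (h : IsPresentation k φ A i X)
    (hφ : ∀ i, Function.Injective (φ i)) : HasClass k φ A (∑ j, affineClass k (X j)) := by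
  classical
  choose S hS using fun j => (h.isCons j).exists_cellIndex
  choose c hc using fun (p : Σ j, (S j).powerset) =>
    isAdapted_of_cellIndex (hS p.1) p.2 (Finset.mem_powerset.1 p.2.2)
  choose V f hf hV hcV using hc
  let e := (Fintype.equivFin (Σ j, (S j).powerset)).symm
  have hsum : ∀ j, affineClass k (X j) = ∑ U : (S j).powerset, c ⟨j, U⟩ := by
    intro j
    rw [affineClass_eq_sum (isAdapted_of_cellIndex (hS j)),
      ← Finset.sum_coe_sort _ fun U => subvarietyClass k (X j ∩ cell k (S j) U)]
    refine Finset.sum_congr rfl fun U _ => ?_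
    exact IsSubvariety.subvarietyClass_eq ⟨V ⟨j, U⟩, f ⟨j, U⟩, hf _, hV ⟨j, U⟩, hcV _⟩
  refine ⟨_, fun n => i (e n).1, fun n => V (e n), fun n => f (e n), fun n => hf _, ?_, ?_, ?_⟩
  · intro n n' hne
    have hne' : e n ≠ e n' := e.injective.ne hne
    simp only [← hV]
    generalize e n = p at hne'
    generalize e n' = p' at hne'
    obtain ⟨j, U⟩ := p
    obtain ⟨j', U'⟩ := p'
    by_cases hj : j = j'
    · subst hj
      refine (Set.disjoint_image_iff (hφ _)).2 (Set.disjoint_left.2 ?_)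
      rintro x ⟨-, h1⟩ ⟨-, h2⟩
      have hU : U = U' := Subtype.ext (h1.symm.trans h2)
      exact hne' (hU ▸ rfl)
    · exact (h.disjoint hj).mono (Set.image_mono Set.inter_subset_left)
        (Set.image_mono Set.inter_subset_left)
  · rw [h.eq]
    simp only [← hV]
    rw [e.surjective.iUnion_comp fun p : Σ j, (S j).powerset =>
      φ (i p.1) '' (X p.1 ∩ cell k (S p.1) p.2)]
    ext y
    simp only [Set.mem_iUnion]
    constructor
    · rintro ⟨j, x, hx, rfl⟩
      exact ⟨⟨j, ⟨cellIndex k (S j) x, Finset.mem_powerset.2 (cellIndex_subset _ _)⟩⟩, x,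
        ⟨hx, rfl⟩, rfl⟩
    · rintro ⟨p, x, hx, rfl⟩
      exact ⟨p.1, x, hx.1, rfl⟩
  · simp only [hcV]
    rw [e.sum_comp, Fintype.sum_sigma]
    exact Finset.sum_congr rfl fun j _ => hsum j

/-- Intersect the pieces of the two presentations: the part of `X j` lying in the image of `X' j'`
and the part of `X' j'` lying in the image of `X j` correspond under the changes of charts, so they
have the same class. -/
theorem IsPresentation.sum_eq {J J' : Type*} [Fintype J] [Fintype J'] {φ : ∀ i, (σ i → F) → Y}
    {φ' : ∀ i, (σ' i → F) → Y} {A : Set Y} {i : J → ι} {X : ∀ j, Set (σ (i j) → F)}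
    {i' : J' → ι'} {X' : ∀ j, Set (σ' (i' j) → F)} (h : IsPresentation k φ A i X)
    (h' : IsPresentation k φ' A i' X') (hc : Compatible k φ φ') :
    ∑ j, affineClass k (X j) = ∑ j, affineClass k (X' j) := by
  choose t t' ht ht' hr hr' htt using hc
  have e1 : ∀ j j', {x | x ∈ X j ∧ φ (i j) x ∈ φ' (i' j') '' X' j'} =
      X j ∩ ({x | φ (i j) x ∈ Set.range (φ' (i' j'))} ∩ t (i j) (i' j') ⁻¹' X' j') := by
    intro j j'
    ext x
    constructor
    · rintro ⟨hx, y, hy, hxy⟩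
      refine ⟨hx, ⟨y, hxy⟩, ?_⟩
      rw [Set.mem_preimage, (htt _ _ x y hxy.symm).1]; exact hy
    · rintro ⟨hx, ⟨y, hxy⟩, hy⟩
      rw [Set.mem_preimage, (htt _ _ x y hxy.symm).1] at hy
      exact ⟨hx, y, hy, hxy⟩
  have e2 : ∀ j j', {y | y ∈ X' j' ∧ φ' (i' j') y ∈ φ (i j) '' X j} =
      X' j' ∩ ({y | φ' (i' j') y ∈ Set.range (φ (i j))} ∩ t' (i j) (i' j') ⁻¹' X j) := by
    intro j j'
    ext y
    constructor
    · rintro ⟨hy, x, hx, hxy⟩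
      refine ⟨hy, ⟨x, hxy⟩, ?_⟩
      rw [Set.mem_preimage, (htt _ _ x y hxy).2]; exact hx
    · rintro ⟨hy, ⟨x, hxy⟩, hx⟩
      rw [Set.mem_preimage, (htt _ _ x y hxy).2] at hx
      exact ⟨hy, x, hx, hxy⟩
  have c1 : ∀ j j', IsCons k {x | x ∈ X j ∧ φ (i j) x ∈ φ' (i' j') '' X' j'} := fun j j' => by
    rw [e1]; exact (h.isCons j).inter ((hr _ _).inter ((h'.isCons j').preimage (ht _ _)))
  have c2 : ∀ j j', IsCons k {y | y ∈ X' j' ∧ φ' (i' j') y ∈ φ (i j) '' X j} := fun j j' => by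
    rw [e2]; exact (h'.isCons j').inter ((hr' _ _).inter ((h.isCons j).preimage (ht' _ _)))
  have key : ∀ j j', affineClass k {x | x ∈ X j ∧ φ (i j) x ∈ φ' (i' j') '' X' j'} =
      affineClass k {y | y ∈ X' j' ∧ φ' (i' j') y ∈ φ (i j) '' X j} := by
    intro j j'
    refine affineClass_eq_of_bijOn (c1 j j') (c2 j j') (t _ _) (t' _ _) (ht _ _) (ht' _ _) ?_ ?_
    · rintro x ⟨hx, y, hy, hxy⟩
      obtain ⟨h1, h2⟩ := htt _ _ x y hxy.symm
      rw [h1]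
      exact ⟨⟨hy, x, hx, hxy.symm⟩, h2⟩
    · rintro y ⟨hy, x, hx, hxy⟩
      obtain ⟨h1, h2⟩ := htt _ _ x y hxy
      rw [h2]
      exact ⟨⟨hx, y, hy, hxy.symm⟩, h1⟩
  have s1 : ∀ j, affineClass k (X j) =
      ∑ j', affineClass k {x | x ∈ X j ∧ φ (i j) x ∈ φ' (i' j') '' X' j'} := by
    intro j
    rw [← affineClass_iUnion (c1 j)]
    · congr 1
      ext x
      simp only [Set.mem_iUnion, Set.mem_ofPred_eq, exists_and_left]
      refine ⟨fun hx => ⟨hx, ?_⟩, fun hx => hx.1⟩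
      have : φ (i j) x ∈ A := by rw [h.eq]; exact Set.mem_iUnion.2 ⟨j, x, hx, rfl⟩
      rw [h'.eq] at this
      exact Set.mem_iUnion.1 this
    · intro j' j'' hne
      exact Set.disjoint_left.2 fun x hx hx' => Set.disjoint_left.1 (h'.disjoint hne) hx.2 hx'.2
  have s2 : ∀ j', affineClass k (X' j') =
      ∑ j, affineClass k {y | y ∈ X' j' ∧ φ' (i' j') y ∈ φ (i j) '' X j} := by
    intro j'
    rw [← affineClass_iUnion (fun j => c2 j j')]
    · congr 1
      ext x
      simp only [Set.mem_iUnion, Set.mem_ofPred_eq, exists_and_left]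
      refine ⟨fun hx => ⟨hx, ?_⟩, fun hx => hx.1⟩
      have : φ' (i' j') x ∈ A := by rw [h'.eq]; exact Set.mem_iUnion.2 ⟨j', x, hx, rfl⟩
      rw [h.eq] at this
      exact Set.mem_iUnion.1 this
    · intro j j'' hne
      exact Set.disjoint_left.2 fun x hx hx' => Set.disjoint_left.1 (h.disjoint hne) hx.2 hx'.2
  rw [Finset.sum_congr rfl fun j _ => s1 j, Finset.sum_congr rfl fun j _ => s2 j, Finset.sum_comm]
  exact Finset.sum_congr rfl fun j' _ => Finset.sum_congr rfl fun j _ => key j j'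

/-- The arbitrary choice in the definition of `setClass` is harmless: any decomposition into
subvarieties is itself a presentation. -/
theorem IsPresentation.setClass_eq {J : Type*} [Fintype J] {φ : ∀ i, (σ i → F) → Y} {A : Set Y}
    {i : J → ι} {X : ∀ j, Set (σ (i j) → F)} (h : IsPresentation k φ A i X)
    (hφ : ∀ i, Function.Injective (φ i)) (hc : Compatible k φ φ) :
    setClass k φ A = ∑ j, affineClass k (X j) := by
  have hex : ∃ c, HasClass k φ A c := ⟨_, h.hasClass hφ⟩
  rw [setClass, dif_pos hex]
  obtain ⟨r, i', X', h', hc'⟩ := hex.choose_spec.exists_presentation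
  rw [hc']
  exact h'.sum_eq h hc

-- Number the charts and keep in each of them the points of the set that no earlier chart covers.
omit [IsAlgClosed F] in
theorem IsConstructibleSet.exists_presentation [Fintype ι] {φ : ∀ i, (σ i → F) → Y} {A : Set Y}
    (h : IsConstructibleSet k φ A) (hc : Compatible k φ φ) :
    ∃ X : ∀ i, Set (σ i → F), IsPresentation k φ A (fun i : ι => i) X := by
  let e := Fintype.equivFin ι
  have hr : ∀ i i', IsCons k {x | φ i x ∈ Set.range (φ i')} := fun i i' => by
    obtain ⟨_, _, -, -, h, -⟩ := hc i i'
    exact h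
  refine ⟨fun i => {x | φ i x ∈ A ∧ ∀ i', e i' < e i → ¬ φ i x ∈ Set.range (φ i')}, ?_, ?_, ?_⟩
  · intro i
    refine IsCons.setOf_and (h.2 i) (IsCons.setOf_forall fun i' => ?_)
    exact (isCons_const _).setOf_imp (hr i i').compl
  · have : ∀ i i', e i < e i' →
        Disjoint (φ i '' {x | φ i x ∈ A ∧ ∀ i', e i' < e i → ¬ φ i x ∈ Set.range (φ i')})
        (φ i' '' {x | φ i' x ∈ A ∧ ∀ i'', e i'' < e i' → ¬ φ i' x ∈ Set.range (φ i'')}) := by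
      intro i i' hlt
      refine Set.disjoint_left.2 ?_
      rintro y ⟨x, hx, rfl⟩ ⟨x', hx', h'⟩
      exact hx'.2 i hlt ⟨x, h'.symm⟩
    intro i i' hne
    rcases lt_or_gt_of_ne (e.injective.ne hne) with h1 | h1
    · exact this _ _ h1
    · exact (this _ _ h1).symm
  · ext y
    simp only [Set.mem_iUnion]
    constructor
    · intro hy
      obtain ⟨i₀, x₀, hx₀⟩ := Set.mem_iUnion.1 (h.1 hy)
      have hex : ∃ n : ℕ, ∃ i, (e i : ℕ) = n ∧ y ∈ Set.range (φ i) := ⟨_, i₀, rfl, x₀, hx₀⟩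
      classical
      obtain ⟨i, hi, x, rfl⟩ := Nat.find_spec hex
      refine ⟨i, x, ⟨hy, fun i' hlt hmem => ?_⟩, rfl⟩
      exact Nat.find_min hex (m := e i') (by rw [← hi]; exact hlt) ⟨i', rfl, hmem⟩
    · rintro ⟨i, x, hx, rfl⟩
      exact hx.1

omit [IsAlgClosed F] in
theorem compatible_affineChart (τ : Type) [Finite τ] :
    Compatible k (affineChart F τ) (affineChart F τ) := by
  intro i i'
  refine ⟨id, id, fun j => .coord j, fun j => .coord j, ?_, ?_, fun x y h => ⟨h, h.symm⟩⟩
  · convert isCons_univ (k := k) (F := F) (σ := τ)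
    ext x
    exact ⟨fun _ => trivial, fun _ => ⟨x, rfl⟩⟩
  · convert isCons_univ (k := k) (F := F) (σ := τ)
    ext x
    exact ⟨fun _ => trivial, fun _ => ⟨x, rfl⟩⟩

theorem setClass_affineChart {τ : Type} [Finite τ] {C : Set (τ → F)} (hC : IsCons k C) :
    setClass k (affineChart F τ) C = affineClass k C := by
  have h : IsPresentation k (affineChart F τ) C (fun i : Unit => i) (fun _ => C) :=
    ⟨fun _ => hC, fun i j hij => (hij (Subsingleton.elim i j)).elim, by
      ext x; simp [affineChart]⟩
  rw [h.setClass_eq (fun _ => Function.injective_id) (compatible_affineChart τ)]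
  simp

end Atlases

/-! ### Coefficients and finite windows of Laurent vectors -/

section LaurentVectors

variable {F : Type u} [Field F] {d : ℕ}

theorem coeff_single_one_mul (n m : ℤ) (x : F⸨X⸩) :
    (HahnSeries.single n (1 : F) * x).coeff m = x.coeff (m - n) := by
  have := HahnSeries.coeff_single_mul_add (r := (1 : F)) (x := x) (a := m - n) (b := n)
  rwa [sub_add_cancel, one_mul] at this

theorem coeff_algebraMap_of_neg (f : F⟦X⟧) {m : ℤ} (hm : m < 0) :
    (algebraMap F⟦X⟧ F⸨X⸩ f).coeff m = 0 := by
  change ((f : F⟦X⟧) : F⸨X⸩).coeff m = 0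
  rw [PowerSeries.coeff_coe, if_pos hm]

theorem coeff_algebraMap_natCast (f : F⟦X⟧) (m : ℕ) :
    (algebraMap F⟦X⟧ F⸨X⸩ f).coeff m = PowerSeries.coeff m f :=
  LaurentSeries.coeff_coe_powerSeries f m

theorem exists_eq_single_mul {x : F⸨X⸩} {n : ℤ} (hx : ∀ j < n, x.coeff j = 0) :
    ∃ g : F⟦X⟧, x = HahnSeries.single n (1 : F) * algebraMap F⟦X⟧ F⸨X⸩ g := by
  refine ⟨PowerSeries.mk fun m => x.coeff (m + n), ?_⟩
  ext j
  rw [coeff_single_one_mul]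
  rcases lt_or_ge j n with h | h
  · rw [hx j h, coeff_algebraMap_of_neg _ (by omega)]
  · obtain ⟨m, hm⟩ := Int.eq_ofNat_of_zero_le (sub_nonneg.2 h)
    rw [hm, coeff_algebraMap_natCast, PowerSeries.coeff_mk, ← hm, sub_add_cancel]

theorem coeff_smul_of_lt {x : F⸨X⸩} {n : ℤ} (hx : ∀ j < n, x.coeff j = 0) (f : F⟦X⟧) {j : ℤ}
    (hj : j < n) : (f • x).coeff j = 0 := by
  obtain ⟨g, rfl⟩ := exists_eq_single_mul hx
  rw [Algebra.smul_def, mul_left_comm, ← map_mul, coeff_single_one_mul,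
    coeff_algebraMap_of_neg _ (by omega)]

theorem coeff_X_smul (x : F⸨X⸩) (j : ℤ) : ((PowerSeries.X : F⟦X⟧) • x).coeff j = x.coeff (j - 1) := by
  rw [Algebra.smul_def]
  change (((PowerSeries.X : F⟦X⟧) : F⸨X⸩) * x).coeff j = _
  rw [PowerSeries.coe_X, coeff_single_one_mul]

theorem coeff_X_pow_smul (x : F⸨X⸩) (n : ℕ) (j : ℤ) :
    ((PowerSeries.X ^ n : F⟦X⟧) • x).coeff j = x.coeff (j - n) := by
  induction n generalizing j with
  | zero => simp
  | succ n ih =>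
    rw [pow_succ', mul_smul, coeff_X_smul, ih]
    congr 1
    push_cast
    ring

theorem C_smul_eq (a : F) (x : F⸨X⸩) : (PowerSeries.C a : F⟦X⟧) • x = a • x := by
  rw [← algebraMap_smul F⟦X⟧ a x]
  rfl

theorem C_smul_eq_pi (a : F) (x : LaurentSpace F d) : (PowerSeries.C a : F⟦X⟧) • x = a • x :=
  funext fun i => C_smul_eq a (x i)

theorem smul_decomp (f : F⟦X⟧) : ∃ g : F⟦X⟧, f = PowerSeries.C (PowerSeries.constantCoeff f) +
    PowerSeries.X * g :=
  ⟨_, by rw [add_comm]; exact PowerSeries.eq_X_mul_shift_add_const f⟩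

/-- The vector `t ^ e • eᵢ`, for `a = (i, e)`. -/
def monoVec (a : Fin d × ℤ) : LaurentSpace F d := Pi.single a.1 (HahnSeries.single a.2 (1 : F))

/-- The coefficient of `t ^ e • eᵢ`, for `a = (i, e)`. -/
def coeffAt (a : Fin d × ℤ) : LaurentSpace F d →ₗ[F] F where
  toFun v := (v a.1).coeff a.2
  map_add' v w := by simp
  map_smul' c v := by simp

theorem coeffAt_apply (a : Fin d × ℤ) (v : LaurentSpace F d) : coeffAt a v = (v a.1).coeff a.2 := rfl

theorem coeffAt_monoVec (a b : Fin d × ℤ) [Decidable (a = b)] :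
    coeffAt (F := F) a (monoVec b) = if a = b then 1 else 0 := by
  classical
  obtain ⟨i, e⟩ := a
  obtain ⟨i', e'⟩ := b
  simp only [coeffAt_apply, monoVec, Prod.mk.injEq]
  by_cases hi : i = i'
  · subst hi
    by_cases he : e = e'
    · subst he; simp
    · simp [he, HahnSeries.coeff_single_of_ne he]
  · simp [hi]

theorem ext_coeffAt {v w : LaurentSpace F d} (h : ∀ a, coeffAt a v = coeffAt a w) : v = w := by
  funext i
  ext j
  exact h (i, j)

theorem coeffAt_X_pow_smul (n : ℕ) (a : Fin d × ℤ) (v : LaurentSpace F d) :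
    coeffAt a ((PowerSeries.X ^ n : F⟦X⟧) • v) = coeffAt (a.1, a.2 - n) v :=
  coeff_X_pow_smul _ _ _

theorem coeffAt_X_smul (a : Fin d × ℤ) (v : LaurentSpace F d) :
    coeffAt a ((PowerSeries.X : F⟦X⟧) • v) = coeffAt (a.1, a.2 - 1) v :=
  coeff_X_smul _ _

theorem mem_stdLattice_iff {n : ℤ} {v : LaurentSpace F d} :
    v ∈ stdLattice F d n ↔ ∀ a : Fin d × ℤ, a.2 < n → coeffAt a v = 0 := by
  constructor
  · intro hv
    induction hv using Submodule.span_induction with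
    | mem v hv =>
      obtain ⟨i, rfl⟩ := hv
      intro a ha
      classical
      have := coeffAt_monoVec (F := F) a (i, n)
      rw [if_neg (by rintro rfl; exact lt_irrefl _ ha)] at this
      exact this
    | zero => intro a _; exact map_zero _
    | add v w _ _ hv hw => intro a ha; rw [map_add, hv a ha, hw a ha, add_zero]
    | smul f v _ hv =>
      intro a ha
      exact coeff_smul_of_lt (fun j hj => hv (a.1, j) hj) f ha
  · intro h
    choose g hg using fun i => exists_eq_single_mul (x := v i) fun j hj => h (i, j) hj
    have : v = ∑ i, g i • (Pi.single i (HahnSeries.single n (1 : F)) : LaurentSpace F d) := by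
      funext i
      rw [Finset.sum_apply, Finset.sum_eq_single i]
      · rw [Pi.smul_apply, Pi.single_eq_same, Algebra.smul_def, mul_comm]
        exact hg i
      · intro j _ hj
        rw [Pi.smul_apply, Pi.single_eq_of_ne hj.symm, smul_zero]
      · simp
    rw [this]
    exact Submodule.sum_mem _ fun i _ => Submodule.smul_mem _ _ (Submodule.subset_span ⟨i, rfl⟩)

theorem stdLattice_anti {m n : ℤ} (h : m ≤ n) : stdLattice F d n ≤ stdLattice F d m := fun _ hv =>
  mem_stdLattice_iff.2 fun a ha => mem_stdLattice_iff.1 hv a (ha.trans_le h)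

theorem monoVec_mem_stdLattice {n : ℤ} {a : Fin d × ℤ} (h : n ≤ a.2) :
    (monoVec a : LaurentSpace F d) ∈ stdLattice F d n := by
  classical
  refine mem_stdLattice_iff.2 fun b hb => ?_
  rw [coeffAt_monoVec, if_neg]
  rintro rfl
  omega

theorem exists_X_pow_smul_of_mem {n : ℤ} {m : ℕ} {v : LaurentSpace F d}
    (hv : v ∈ stdLattice F d (n + m)) :
    ∃ w ∈ stdLattice F d n, v = (PowerSeries.X ^ m : F⟦X⟧) • w := by
  refine ⟨fun i => HahnSeries.single (-(m : ℤ)) (1 : F) * v i, ?_, ?_⟩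
  · refine mem_stdLattice_iff.2 fun a ha => ?_
    rw [coeffAt_apply, coeff_single_one_mul]
    exact mem_stdLattice_iff.1 hv (a.1, a.2 - -m) (by simp only; omega)
  · refine ext_coeffAt fun a => ?_
    rw [coeffAt_X_pow_smul, coeffAt_apply, coeffAt_apply, coeff_single_one_mul]
    congr 1
    simp

theorem X_pow_smul_mem_stdLattice {n : ℤ} (m : ℕ) {v : LaurentSpace F d}
    (hv : v ∈ stdLattice F d n) : (PowerSeries.X ^ m : F⟦X⟧) • v ∈ stdLattice F d (n + m) := by
  refine mem_stdLattice_iff.2 fun a ha => ?_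
  rw [coeffAt_X_pow_smul]
  exact mem_stdLattice_iff.1 hv _ (by simp only; omega)

theorem Gr_mono {n m : ℕ} (h : n ≤ m) : Gr F d n ⊆ Gr F d m := fun _ hH =>
  ⟨(stdLattice_anti (by omega)).trans hH.1, hH.2.trans (stdLattice_anti (by omega))⟩

/-- The position of a coordinate on `t⁻ⁿ F[[t]]ᵈ / t^(w - n) F[[t]]ᵈ`. -/
def pos (n : ℕ) {w : ℕ} (p : Fin d × Fin w) : Fin d × ℤ := (p.1, (p.2 : ℤ) - n)

theorem pos_injective (n w : ℕ) : Function.Injective (pos n : Fin d × Fin w → Fin d × ℤ) := by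
  rintro ⟨i, j⟩ ⟨i', j'⟩ h
  simp only [pos, Prod.mk.injEq] at h
  obtain ⟨rfl, h⟩ := h
  have : j = j' := Fin.ext (by omega)
  rw [this]

theorem exists_pos_eq {n w : ℕ} {a : Fin d × ℤ} (h1 : -(n : ℤ) ≤ a.2) (h2 : a.2 < w - n) :
    ∃ p : Fin d × Fin w, pos n p = a :=
  ⟨(a.1, ⟨(a.2 + n).toNat, by omega⟩), by
    refine Prod.ext rfl ?_
    simp only [pos]
    omega⟩

/-- The coefficients of `t ^ e`, for `-n ≤ e < w - n`. -/
def window (n w : ℕ) : LaurentSpace F d →ₗ[F] (Fin d × Fin w → F) :=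
  LinearMap.pi fun p => coeffAt (pos n p)

theorem window_apply (n w : ℕ) (v : LaurentSpace F d) (p : Fin d × Fin w) :
    window n w v p = coeffAt (pos n p) v := rfl

theorem coordAt_eq (n : ℕ) (p : Fin d × Fin (2 * n)) (v : LaurentSpace F d) :
    coordAt n p v = coeffAt (pos n p) v := rfl

theorem window_eq_zero_iff {n w : ℕ} {v : LaurentSpace F d} (hv : v ∈ stdLattice F d (-n)) :
    window n w v = 0 ↔ v ∈ stdLattice F d (w - n) := by
  constructor
  · intro h
    refine mem_stdLattice_iff.2 fun a ha => ?_
    rcases lt_or_ge a.2 (-n) with h1 | h1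
    · exact mem_stdLattice_iff.1 hv a h1
    · obtain ⟨p, rfl⟩ := exists_pos_eq h1 ha
      exact congrFun h p
  · intro h
    funext p
    refine mem_stdLattice_iff.1 h _ ?_
    have := p.2.2
    simp only [pos]
    omega

theorem window_monoVec (n w : ℕ) (p : Fin d × Fin w) [DecidableEq (Fin d × Fin w)] :
    window n w (monoVec (pos n p) : LaurentSpace F d) = Pi.single p 1 := by
  classical
  funext q
  rw [window_apply, coeffAt_monoVec, Pi.single_apply]
  exact if_congr (pos_injective n w).eq_iff rfl rfl

/-- The vector with given coefficients in a window and no others. -/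
def liftVec (n : ℕ) {w : ℕ} (f : Fin d × Fin w → F) : LaurentSpace F d :=
  ∑ p, f p • monoVec (pos n p)

theorem liftVec_mem (n : ℕ) {w : ℕ} (f : Fin d × Fin w → F) :
    liftVec n f ∈ stdLattice F d (-n) := by
  refine Submodule.sum_mem _ fun p _ => ?_
  rw [← C_smul_eq_pi]
  exact Submodule.smul_mem _ _ (monoVec_mem_stdLattice (by simp [pos]))

theorem window_liftVec (n : ℕ) {w : ℕ} (f : Fin d × Fin w → F) :
    window n w (liftVec n f) = f := by
  classical
  rw [liftVec, map_sum]
  funext q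
  simp only [map_smul, window_monoVec, Finset.sum_apply, Pi.smul_apply, Pi.single_apply,
    smul_eq_mul, mul_ite, mul_one, mul_zero]
  simp

end LaurentVectors

/-! ### Relative dimensions through finite-dimensional images -/

section RelativeDimension

variable {K : Type*} {V W : Type*} [Field K] [AddCommGroup V] [Module K V] [AddCommGroup W]
  [Module K W]

/-- The hypothesis makes `A / (A ∩ B)` isomorphic to `f(A) / f(A ∩ B)`; codimensions of lattices
thus become differences of ranks of truncations. -/
theorem relDim_add_finrank (A B : Submodule K V) (f : V →ₗ[K] W) [FiniteDimensional K W]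
    (hf : A ⊓ LinearMap.ker f ≤ B) :
    relDim K A B + Module.finrank K ((A ⊓ B).map f) = Module.finrank K (A.map f) ∧
      Module.Finite K (A ⧸ B.submoduleOf A) := by
  let C : Submodule K (A.map f) := ((A ⊓ B).map f).submoduleOf (A.map f)
  let g : A →ₗ[K] A.map f := f.submoduleMap A
  have hg : Function.Surjective g := f.submoduleMap_surjective A
  have hcomap : C.comap g = B.submoduleOf A := by
    ext ⟨x, hx⟩
    simp only [Submodule.mem_comap, Submodule.submoduleOf, C, Submodule.subtype_apply]
    constructor
    · rintro ⟨y, ⟨hyA, hyB⟩, hxy⟩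
      have h1 : x - y ∈ B := hf ⟨A.sub_mem hx hyA, by
        show f (x - y) = 0
        rw [map_sub, hxy]
        exact sub_self _⟩
      have := B.add_mem h1 hyB
      rwa [sub_add_cancel] at this
    · intro hxB
      exact ⟨x, ⟨hx, hxB⟩, rfl⟩
  have hsurj : Function.Surjective (C.mkQ ∘ₗ g) := C.mkQ_surjective.comp hg
  have hker : LinearMap.ker (C.mkQ ∘ₗ g) = B.submoduleOf A := by
    rw [LinearMap.ker_comp, Submodule.ker_mkQ, hcomap]
  let e : (A ⧸ B.submoduleOf A) ≃ₗ[K] (A.map f ⧸ C) :=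
    (Submodule.quotEquivOfEq _ _ hker.symm).trans
      (LinearMap.quotKerEquivOfSurjective _ hsurj)
  have hC : Module.finrank K C = Module.finrank K ((A ⊓ B).map f) :=
    (Submodule.submoduleOfEquivOfLe (Submodule.map_mono inf_le_left)).finrank_eq
  refine ⟨?_, Module.Finite.equiv e.symm⟩
  rw [relDim, e.finrank_eq, ← hC]
  exact Submodule.finrank_quotient_add_finrank C

end RelativeDimension

/-! ### Charts of the Grassmannian and their transitions -/

section Charts

variable (k : Type u) [Field k] {F : Type u} [Field F] [Algebra k F] {d : ℕ}
variable {n : ℕ} (I : Finset (Fin d × Fin (2 * n)))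

/-- The subspace of `F((t))ᵈ` with coordinates `c` in a chart. -/
def chartSpace (c : I × (Iᶜ : Finset _) → F) : Submodule F (LaurentSpace F d) where
  carrier := grChart F d n I c
  zero_mem' := ⟨zero_mem _, fun p => by simp [coordAt_eq]⟩
  add_mem' {v w} hv hw := ⟨add_mem hv.1 hw.1, fun p => by
    have h1 := hv.2 p
    have h2 := hw.2 p
    simp only [coordAt_eq, map_add, mul_add, Finset.sum_add_distrib] at *
    rw [h1, h2]⟩
  smul_mem' a v hv := ⟨by rw [← C_smul_eq_pi]; exact Submodule.smul_mem _ _ hv.1, fun p => by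
    have h1 := hv.2 p
    simp only [coordAt_eq, map_smul, smul_eq_mul] at *
    rw [h1, Finset.mul_sum]
    exact Finset.sum_congr rfl fun q _ => mul_left_comm _ _ _⟩

/-- The generator of `chartSpace I c` with coordinate `q ∉ I` equal to `1`. -/
def chartGen (c : I × (Iᶜ : Finset _) → F) (q : (Iᶜ : Finset _)) : LaurentSpace F d :=
  monoVec (pos n (q : Fin d × Fin (2 * n))) +
    ∑ p : I, c (p, q) • monoVec (pos n (p : Fin d × Fin (2 * n)))

variable {I} {c : I × (Iᶜ : Finset _) → F}

theorem mem_chartSpace {v : LaurentSpace F d} : v ∈ chartSpace I c ↔ v ∈ grChart F d n I c := Iff.rfl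

theorem coe_eq_grChart {H : TLattice F d} :
    (H : Set (LaurentSpace F d)) = grChart F d n I c ↔ H.restrictScalars F = chartSpace I c := by
  exact (SetLike.coe_set_eq (p := H.restrictScalars F) (q := chartSpace I c))

theorem coordAt_chartGen_of_mem (p : I) (q : (Iᶜ : Finset _)) :
    coordAt n p (chartGen I c q) = c (p, q) := by
  have hne : (p : Fin d × Fin (2 * n)) ≠ q := fun h => Finset.mem_compl.1 q.2 (h ▸ p.2)
  rw [coordAt_eq, chartGen, map_add, coeffAt_monoVec, if_neg ((pos_injective _ _).ne hne), map_sum,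
    zero_add, Finset.sum_eq_single p]
  · rw [map_smul, coeffAt_monoVec, if_pos rfl, smul_eq_mul, mul_one]
  · intro p' _ hp
    rw [map_smul, coeffAt_monoVec, if_neg ((pos_injective _ _).ne (Subtype.coe_ne_coe.2 hp.symm)),
      smul_zero]
  · simp

theorem coordAt_chartGen_of_mem_compl (q q' : (Iᶜ : Finset _)) :
    coordAt n q' (chartGen I c q) = if q' = q then 1 else 0 := by
  rw [coordAt_eq, chartGen, map_add, coeffAt_monoVec, map_sum, Finset.sum_eq_zero, add_zero]
  · exact if_congr ((pos_injective _ _).eq_iff.trans Subtype.coe_inj) rfl rfl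
  · intro p _
    have hne : (q' : Fin d × Fin (2 * n)) ≠ p := fun h => Finset.mem_compl.1 q'.2 (h ▸ p.2)
    rw [map_smul, coeffAt_monoVec, if_neg ((pos_injective _ _).ne hne), smul_zero]

theorem chartSpace_le : chartSpace I c ≤ (stdLattice F d (-n)).restrictScalars F := fun _ hv => hv.1

theorem stdLattice_le_chartSpace : (stdLattice F d n).restrictScalars F ≤ chartSpace I c := by
  intro v hv
  have h : ∀ p, coordAt n p v = 0 := fun p => mem_stdLattice_iff.1 hv (pos n p) (by
    have := p.2.2
    simp only [pos]
    omega)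
  exact ⟨stdLattice_anti (by omega) hv, fun p => by simp [h]⟩

theorem chartGen_mem (q : (Iᶜ : Finset _)) : chartGen I c q ∈ chartSpace I c := by
  refine ⟨?_, fun p => ?_⟩
  · have h : ∀ p : Fin d × Fin (2 * n), (monoVec (pos n p) : LaurentSpace F d) ∈
        (stdLattice F d (-n)).restrictScalars F := fun p =>
      monoVec_mem_stdLattice (by simp [pos])
    exact Submodule.add_mem ((stdLattice F d (-n)).restrictScalars F) (h q)
      (Submodule.sum_mem _ fun p _ => Submodule.smul_mem _ _ (h p))
  · rw [coordAt_chartGen_of_mem]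
    simp [coordAt_chartGen_of_mem_compl]

theorem grChart_injective : Function.Injective (grChart F d n I) := by
  intro c c' h
  funext ⟨p, q⟩
  have hq : chartGen I c q ∈ grChart F d n I c' := h ▸ chartGen_mem q
  have := hq.2 p
  rw [coordAt_chartGen_of_mem] at this
  simpa [coordAt_chartGen_of_mem_compl] using this

theorem sub_sum_chartGen_mem {v : LaurentSpace F d} (hv : v ∈ chartSpace I c) :
    v - ∑ q : (Iᶜ : Finset _), coordAt n q v • chartGen I c q ∈ stdLattice F d n := by
  set v' := v - ∑ q : (Iᶜ : Finset _), coordAt n q v • chartGen I c q with hv'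
  have hmem : v' ∈ chartSpace I c :=
    Submodule.sub_mem _ hv (Submodule.sum_mem _ fun q _ => Submodule.smul_mem _ _ (chartGen_mem q))
  have h1 : ∀ q : (Iᶜ : Finset _), coordAt n q v' = 0 := by
    intro q
    have h2 : coordAt n q v' = coordAt n q v -
        ∑ q' : (Iᶜ : Finset _), coordAt n q' v * coordAt n q (chartGen I c q') := by
      simp only [coordAt_eq, hv', map_sub, map_sum, map_smul, smul_eq_mul]
    rw [h2]
    simp [coordAt_chartGen_of_mem_compl]
  have h2 : window n (2 * n) v' = 0 := by
    funext p
    by_cases hp : p ∈ I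
    · exact (hmem.2 ⟨p, hp⟩).trans (by simp [h1])
    · exact h1 ⟨p, Finset.mem_compl.2 hp⟩
  have := (window_eq_zero_iff hmem.1).1 h2
  refine stdLattice_anti ?_ this
  push_cast
  omega

variable (I c) in
open Classical in
/-- Vectors which span `chartSpace I c` modulo `t ^ (w - N)`. -/
def chartVec (N w : ℕ) : (Iᶜ : Finset _) ⊕ (Fin d × Fin w) → LaurentSpace F d :=
  Sum.elim (chartGen I c) fun p => if (n : ℤ) ≤ (pos N p).2 then monoVec (pos N p) else 0

theorem chartVec_mem {N w : ℕ} (r : (Iᶜ : Finset _) ⊕ (Fin d × Fin w)) :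
    chartVec I c N w r ∈ chartSpace I c := by
  rcases r with q | p
  · exact chartGen_mem q
  · simp only [chartVec, Sum.elim_inr]
    split_ifs with h
    · exact stdLattice_le_chartSpace (monoVec_mem_stdLattice h)
    · exact zero_mem _

theorem exists_sub_sum_chartVec_mem (N w : ℕ) {v : LaurentSpace F d} (hv : v ∈ chartSpace I c) :
    ∃ a : (Iᶜ : Finset _) ⊕ (Fin d × Fin w) → F,
      v - ∑ r, a r • chartVec I c N w r ∈ stdLattice F d (w - N) := by
  classical
  have h := sub_sum_chartGen_mem hv
  set v' := v - ∑ q : (Iᶜ : Finset _), coordAt n q v • chartGen I c q with hv'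
  refine ⟨Sum.elim (fun q => coordAt n q v) fun p => coeffAt (pos N p) v', ?_⟩
  rw [Fintype.sum_sum_type]
  simp only [Sum.elim_inl, Sum.elim_inr, chartVec]
  rw [← sub_sub, ← hv', mem_stdLattice_iff]
  intro a ha
  simp only [map_sub, map_sum, map_smul, smul_eq_mul]
  rw [sub_eq_zero]
  rcases lt_or_ge a.2 n with h1 | h1
  · rw [mem_stdLattice_iff.1 h a h1, Finset.sum_eq_zero]
    intro p _
    split_ifs with hp
    · rw [coeffAt_monoVec, if_neg, mul_zero]
      rintro rfl
      omega
    · rw [map_zero, mul_zero]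
  · obtain ⟨p, rfl⟩ := exists_pos_eq (n := N) (w := w) (a := a) (by omega) ha
    rw [Finset.sum_eq_single p]
    · rw [if_pos h1, coeffAt_monoVec, if_pos rfl, mul_one]
    · intro p' _ hp'
      split_ifs
      · rw [coeffAt_monoVec, if_neg ((pos_injective _ _).ne hp'.symm), mul_zero]
      · rw [map_zero, mul_zero]
    · simp

/-- Replaces an infinite-dimensional subspace by a finite spanning family whose coefficients are
definable in `c`, to which linear algebra in families applies. -/
theorem map_window_chartSpace (N w : ℕ) :
    (chartSpace I c).map (window N w) =
      Submodule.span F (Set.range fun r => window N w (chartVec I c N w r)) := by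
  apply le_antisymm
  · rintro _ ⟨v, hv, rfl⟩
    obtain ⟨a, ha⟩ := exists_sub_sum_chartVec_mem N w hv
    have : window N w v = ∑ r, a r • window N w (chartVec I c N w r) := by
      rw [← sub_eq_zero]
      simp only [← map_smul, ← map_sum, ← map_sub]
      funext p
      refine mem_stdLattice_iff.1 ha _ ?_
      have := p.2.2
      simp only [pos]
      omega
    rw [this]
    exact Submodule.sum_mem _ fun r _ => Submodule.smul_mem _ _ (Submodule.subset_span ⟨r, rfl⟩)
  · rw [Submodule.span_le]
    rintro _ ⟨r, rfl⟩
    exact ⟨_, chartVec_mem r, rfl⟩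

/-- A vector with the same window as an element of `S` differs from it by a multiple of `tⁿ`, which
is in `S`: the bound `n + N ≤ w` says that the window reaches `tⁿ`. -/
theorem mem_of_window_mem {N w : ℕ} (hw : n + N ≤ w) {S : Submodule F (LaurentSpace F d)}
    (hS : (stdLattice F d n).restrictScalars F ≤ S)
    (hS' : S ≤ (stdLattice F d (-N)).restrictScalars F)
    {v : LaurentSpace F d} (hv : v ∈ stdLattice F d (-N)) (h : window N w v ∈ S.map (window N w)) :
    v ∈ S := by
  obtain ⟨u, hu, hvu⟩ := h
  have h1 : v - u ∈ S := hS (stdLattice_anti (by omega)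
    ((window_eq_zero_iff (n := N) (w := w) (sub_mem hv (hS' hu))).1
      (by rw [map_sub, hvu, sub_self])))
  have := S.add_mem h1 hu
  rwa [sub_add_cancel] at this

theorem definable_coeffAt_chartVec (N w : ℕ) (a : Fin d × ℤ)
    (r : (Iᶜ : Finset _) ⊕ (Fin d × Fin w)) :
    Definable k fun c : I × (Iᶜ : Finset _) → F => coeffAt a (chartVec I c N w r) := by
  classical
  have hmono : ∀ b : Fin d × ℤ, Definable k fun _ : I × (Iᶜ : Finset _) → F =>
      coeffAt a (monoVec b : LaurentSpace F d) := by
    intro b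
    simp only [coeffAt_monoVec]
    split_ifs
    · exact .one
    · exact .zero
  rcases r with q | p
  · simp only [chartVec, Sum.elim_inl, chartGen, map_add, map_sum, map_smul, smul_eq_mul]
    exact .add (hmono _) (.sum _ fun p _ => .mul (.coord _) (hmono _))
  · simp only [chartVec, Sum.elim_inr]
    split_ifs
    · exact hmono _
    · simpa using Definable.zero

theorem grChart_eq_iff {n' : ℕ} {I' : Finset (Fin d × Fin (2 * n'))}
    {c' : I' × (I'ᶜ : Finset _) → F} :
    grChart F d n I c = grChart F d n' I' c' ↔
      (∀ r, window (max n n') (2 * max n n') (chartVec I c (max n n') (2 * max n n') r) ∈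
        Submodule.span F (Set.range fun r => window (max n n') (2 * max n n')
          (chartVec I' c' (max n n') (2 * max n n') r))) ∧
      (∀ r, window (max n n') (2 * max n n') (chartVec I' c' (max n n') (2 * max n n') r) ∈
        Submodule.span F (Set.range fun r => window (max n n') (2 * max n n')
          (chartVec I c (max n n') (2 * max n n') r))) := by
  have h : grChart F d n I c = grChart F d n' I' c' ↔ chartSpace I c = chartSpace I' c' :=
    (SetLike.coe_set_eq (p := chartSpace I c) (q := chartSpace I' c'))
  have key : ∀ {n n' N w : ℕ} (hn : n ≤ N) (hn' : n' ≤ N) (hw : n' + N ≤ w)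
      {I : Finset (Fin d × Fin (2 * n))} {I' : Finset (Fin d × Fin (2 * n'))}
      {c : I × (Iᶜ : Finset _) → F} {c' : I' × (I'ᶜ : Finset _) → F},
      chartSpace I c ≤ chartSpace I' c' ↔
        ∀ r, window N w (chartVec I c N w r) ∈
          Submodule.span F (Set.range fun r => window N w (chartVec I' c' N w r)) := by
    intro n n' N w hn hn' hw I I' c c'
    rw [← map_window_chartSpace]
    constructor
    · intro h r
      exact ⟨_, h (chartVec_mem r), rfl⟩
    · intro h v hv
      refine mem_of_window_mem hw stdLattice_le_chartSpace
        (chartSpace_le.trans (stdLattice_anti (by omega)))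
        (stdLattice_anti (by omega) (chartSpace_le hv)) ?_
      have h1 : (chartSpace I c).map (window N w) ≤ (chartSpace I' c').map (window N w) := by
        rw [map_window_chartSpace, Submodule.span_le]
        rintro _ ⟨r, rfl⟩
        exact h r
      exact h1 ⟨v, hv, rfl⟩
  have hn := le_max_left n n'
  have hn' := le_max_right n n'
  rw [h, le_antisymm_iff, key (w := 2 * max n n') hn hn' (by omega),
    key (w := 2 * max n n') hn' hn (by omega)]

theorem isCons_grChart_eq {σ : Type} [Finite σ] {n' : ℕ} {I' : Finset (Fin d × Fin (2 * n'))}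
    {f : (σ → F) → I × (Iᶜ : Finset _) → F} {g : (σ → F) → I' × (I'ᶜ : Finset _) → F}
    (hf : ∀ j, Definable k fun x => f x j) (hg : ∀ j, Definable k fun x => g x j) :
    IsCons k {x | grChart F d n I (f x) = grChart F d n' I' (g x)} := by
  simp only [grChart_eq_iff]
  refine .setOf_and (.setOf_forall fun r => isCons_mem_span ?_ ?_)
    (.setOf_forall fun r => isCons_mem_span ?_ ?_)
  · exact fun r p => (definable_coeffAt_chartVec k _ _ _ _).comp hg
  · exact fun p => (definable_coeffAt_chartVec k _ _ _ _).comp hf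
  · exact fun r p => (definable_coeffAt_chartVec k _ _ _ _).comp hf
  · exact fun p => (definable_coeffAt_chartVec k _ _ _ _).comp hg

/-- The matrix `c'` solves the linear system saying that the spanning vectors of the first subspace
satisfy the graph equations of the second chart. It is the only solution: the generators of the
second chart lie in that subspace, and their coordinates are the entries of the matrix. -/
theorem exists_chart_transition {n' : ℕ} (I : Finset (Fin d × Fin (2 * n)))
    (I' : Finset (Fin d × Fin (2 * n'))) :
    ∃ t : (I × (Iᶜ : Finset _) → F) → I' × (I'ᶜ : Finset _) → F,
      (∀ j, Definable k fun c => t c j) ∧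
      ∀ c c', grChart F d n I c = grChart F d n' I' c' → t c = c' := by
  classical
  -- The unknowns are the entries of `c'`; the equation `(r, p)` is the `p`-th graph equation for
  -- the `r`-th spanning vector. Only exponents from `-n'` to `n' - 1` occur in these equations,
  -- whence the window of width `n' + n'`.
  obtain ⟨s, hs, hs'⟩ := Definable.exists_solution (k := k) (F := F)
    (ρ := ((Iᶜ : Finset _) ⊕ (Fin d × Fin (n' + n'))) × I') (τ := I' × (I'ᶜ : Finset _))
    (fun r q c => if q.1 = r.2 then coordAt n' q.2 (chartVec I c n' (n' + n') r.1) else 0)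
    (fun r c => coordAt n' r.2 (chartVec I c n' (n' + n') r.1))
    (fun r q => by
      split_ifs
      · exact definable_coeffAt_chartVec k _ _ (pos n' _) _
      · exact .zero)
    (fun r => definable_coeffAt_chartVec k _ _ (pos n' _) _)
  have hsum : ∀ (b : I' × (I'ᶜ : Finset _) → F) (p : I') (v : LaurentSpace F d),
      (∑ q : I' × (I'ᶜ : Finset _), (if q.1 = p then coordAt n' q.2 v else 0) * b q) =
        ∑ q : (I'ᶜ : Finset _), b (p, q) * coordAt n' q v := by
    intro b p v
    rw [Fintype.sum_prod_type, Finset.sum_eq_single p]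
    · simp [mul_comm]
    · intro p' _ hp'
      simp [hp']
    · simp
  refine ⟨fun c j => s j c, hs, fun c c' h => ?_⟩
  have hsol := hs' c ⟨c', fun ⟨r, p⟩ => by
    rw [hsum]
    have : chartVec I c n' (n' + n') r ∈ grChart F d n' I' c' := h ▸ chartVec_mem r
    exact (this.2 p).symm⟩
  funext ⟨p, q⟩
  have hq : chartGen I' c' q ∈ chartSpace I c := by
    rw [mem_chartSpace, h]
    exact chartGen_mem q
  obtain ⟨a, ha⟩ := exists_sub_sum_chartVec_mem n' (n' + n') hq
  have hcoord : ∀ p, coordAt n' p (chartGen I' c' q) =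
      ∑ r, a r * coordAt n' p (chartVec I c n' (n' + n') r) := by
    intro p
    have : coeffAt (pos n' p) (chartGen I' c' q - ∑ r, a r • chartVec I c n' (n' + n') r) = 0 :=
      mem_stdLattice_iff.1 ha _ (by
        have := p.2.2
        simp only [pos]
        omega)
    simpa only [coordAt_eq, map_sub, map_sum, map_smul, smul_eq_mul, sub_eq_zero] using this
  have h1 : coordAt n' p (chartGen I' c' q) =
      ∑ q' : (I'ᶜ : Finset _), s (p, q') c * coordAt n' q' (chartGen I' c' q) := by
    simp only [hcoord, Finset.mul_sum]
    rw [Finset.sum_comm]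
    refine Finset.sum_congr rfl fun r _ => ?_
    have := hsol (r, p)
    rw [hsum (fun j => s j c)] at this
    rw [← this, Finset.mul_sum]
    exact Finset.sum_congr rfl fun q _ => mul_left_comm _ _ _
  rw [coordAt_chartGen_of_mem] at h1
  simpa [coordAt_chartGen_of_mem_compl] using h1.symm

/-- The candidate transition is defined for all `c`. A point lies in the other chart iff the
candidate gives back the same subspace, which is a condition of membership in spans. -/
theorem compatible_grChart (n n' : ℕ) : Compatible k (grChart F d n) (grChart F d n') := by
  have key : ∀ (n n' : ℕ) (I : Finset (Fin d × Fin (2 * n))) (I' : Finset (Fin d × Fin (2 * n')))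
      (t : (I × (Iᶜ : Finset _) → F) → I' × (I'ᶜ : Finset _) → F)
      (_ : ∀ j, Definable k fun c => t c j)
      (_ : ∀ c c', grChart F d n I c = grChart F d n' I' c' → t c = c'),
      IsCons k {c | grChart F d n I c ∈ Set.range (grChart F d n' I')} := by
    intro n n' I I' t ht ht'
    convert isCons_grChart_eq k (I := I) (I' := I') (f := fun c => c) (g := t)
      (fun j => .coord j) ht using 1
    ext c
    constructor
    · rintro ⟨c', hc'⟩
      change _ = grChart F d n' I' (t c)
      rw [ht' c c' hc'.symm, hc']
    · intro h
      exact ⟨t c, Eq.symm h⟩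
  intro I I'
  obtain ⟨t, ht, ht'⟩ := exists_chart_transition k (F := F) I I'
  obtain ⟨s, hs, hs'⟩ := exists_chart_transition k (F := F) I' I
  exact ⟨t, s, ht, hs, key n n' I I' t ht ht', key n' n I' I s hs hs',
    fun c c' h => ⟨ht' c c' h, hs' c' c h.symm⟩⟩

end Charts

/-! ### The index of a lattice and its value on a chart -/

section Dimension

variable {K : Type*} {V W W' : Type*} [Field K] [AddCommGroup V] [Module K V] [AddCommGroup W]
  [Module K W] [AddCommGroup W'] [Module K W']

theorem finrank_map_eq_of_ker (S : Submodule K V) (f : V →ₗ[K] W) (g : V →ₗ[K] W')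
    (h : ∀ v ∈ S, f v = 0 ↔ g v = 0) :
    Module.finrank K (S.map f) = Module.finrank K (S.map g) := by
  have hker : LinearMap.ker (f.domRestrict S) = LinearMap.ker (g.domRestrict S) := by
    ext ⟨v, hv⟩
    exact h v hv
  have e := ((f.domRestrict S).quotKerEquivRange.symm.trans
    (Submodule.quotEquivOfEq _ _ hker)).trans (g.domRestrict S).quotKerEquivRange
  rw [← LinearMap.range_domRestrict, ← LinearMap.range_domRestrict]
  exact e.finrank_eq

variable {F : Type u} [Field F] {d : ℕ}

theorem map_window_stdLattice (n w : ℕ) :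
    ((stdLattice F d (-n)).restrictScalars F).map (window n w) = ⊤ :=
  eq_top_iff.2 fun f _ => ⟨liftVec n f, liftVec_mem n f, window_liftVec n f⟩

theorem coDim_add_finrank {n N w : ℕ} {H : TLattice F d} (hH : stdLattice F d (w - N) ≤ H)
    (hH' : H ≤ stdLattice F d (-n)) (hN : n ≤ N) :
    coDim N H + Module.finrank F ((H.restrictScalars F).map (window N w)) = d * w := by
  have hle : H ≤ stdLattice F d (-N) := hH'.trans (stdLattice_anti (by omega))
  have := (relDim_add_finrank ((stdLattice F d (-N)).restrictScalars F) (H.restrictScalars F)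
    (window N w) fun v hv => hH ((window_eq_zero_iff hv.1).1 hv.2)).1
  rw [map_window_stdLattice, inf_eq_right.2
    (show H.restrictScalars F ≤ (stdLattice F d (-N)).restrictScalars F from hle)] at this
  rw [coDim, this]
  simp

/-- The windows starting at `t⁻ⁿ` and at `t⁻ᴺ` both end just before `tⁿ`, so they have the same
kernel on `H` and give the same rank. -/
theorem coDim_add_of_le {n N : ℕ} {H : TLattice F d} (hH : H ∈ Gr F d n) (h : n ≤ N) :
    coDim N H + n * d = coDim n H + N * d := by
  have h1 := coDim_add_finrank (n := n) (N := n) (w := 2 * n) (H := H)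
    (by convert hH.1 using 2; push_cast; ring) hH.2 le_rfl
  have h2 := coDim_add_finrank (n := n) (N := N) (w := N + n) (H := H)
    (by convert hH.1 using 2; push_cast; ring) hH.2 h
  have h3 := finrank_map_eq_of_ker (H.restrictScalars F) (window n (2 * n)) (window N (N + n))
    fun v hv => by
      rw [window_eq_zero_iff (hH.2 hv), window_eq_zero_iff (stdLattice_anti (by omega) (hH.2 hv))]
      have e1 : (((2 * n : ℕ) : ℤ) - n) = n := by push_cast; ring
      have e2 : (((N + n : ℕ) : ℤ) - N) = n := by push_cast; ring
      rw [e1, e2]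
  rw [h3] at h1
  linarith

theorem index_eq {n : ℕ} {H : TLattice F d} (hH : H ∈ Gr F d n) :
    index H = (coDim n H : ℤ) - n * d := by
  classical
  have h : ∃ n, H ∈ Gr F d n := ⟨n, hH⟩
  have := coDim_add_of_le (Nat.find_spec h) (Nat.find_min' h hH)
  rw [index, dif_pos h]
  have h' : ((coDim n H + Nat.find h * d : ℕ) : ℤ) = (coDim (Nat.find h) H + n * d : ℕ) :=
    congrArg _ this
  push_cast at h'
  linarith

section

variable {n : ℕ} {I : Finset (Fin d × Fin (2 * n))} {c : I × (Iᶜ : Finset _) → F}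

/-- A basis is given by the generators of the chart and the monomials `t^(n+e) eᵢ` with `e < r`.
Used with `r = 0` for the index and with `r = 1` to see `H` modulo `tⁿ⁺¹`. -/
theorem finrank_map_window_chartSpace (r : ℕ) :
    Module.finrank F ((chartSpace I c).map (window n (2 * n + r))) =
      Fintype.card (Iᶜ : Finset _) + d * r := by
  classical
  let f : (Iᶜ : Finset _) ⊕ (Fin d × Fin r) → LaurentSpace F d :=
    Sum.elim (chartGen I c) fun p => monoVec (p.1, (n : ℤ) + p.2)
  have hspan : (chartSpace I c).map (window n (2 * n + r)) =
      Submodule.span F (Set.range fun s => window n (2 * n + r) (f s)) := by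
    apply le_antisymm
    · rw [map_window_chartSpace, Submodule.span_le]
      rintro _ ⟨q | p, rfl⟩
      · exact Submodule.subset_span ⟨Sum.inl q, rfl⟩
      · simp only [chartVec, Sum.elim_inr]
        split_ifs with hp
        · have h1 := p.2.2
          simp only [pos] at hp
          refine Submodule.subset_span ⟨Sum.inr (p.1, ⟨p.2 - 2 * n, by omega⟩), ?_⟩
          simp only [f, Sum.elim_inr]
          congr 2
          simp only [pos, Prod.mk.injEq, true_and]
          omega
        · rw [map_zero]
          exact zero_mem _
    · rw [Submodule.span_le]
      rintro _ ⟨q | p, rfl⟩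
      · exact ⟨_, chartGen_mem q, rfl⟩
      · exact ⟨_, stdLattice_le_chartSpace (monoVec_mem_stdLattice (by simp)), rfl⟩
  have hgen : ∀ q (a : Fin d × ℤ), (n : ℤ) ≤ a.2 → coeffAt a (chartGen I c q) = 0 := by
    intro q a ha
    have hne : ∀ p : Fin d × Fin (2 * n), a ≠ pos n p := by
      rintro p rfl
      have := p.2.2
      simp only [pos] at ha
      omega
    simp [chartGen, coeffAt_monoVec, hne]
  have hli : LinearIndependent F fun s => window n (2 * n + r) (f s) := by
    rw [Fintype.linearIndependent_iff]
    intro g hg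
    have hg' : ∀ a : Fin d × ℤ, -(n : ℤ) ≤ a.2 → a.2 < n + r → ∑ s, g s * coeffAt a (f s) = 0 := by
      intro a h1 h2
      obtain ⟨p, rfl⟩ := exists_pos_eq (n := n) (w := 2 * n + r) (a := a) h1 (by push_cast; omega)
      have := congrFun hg p
      simpa [window_apply] using this
    rintro (q | ⟨i, e⟩)
    · have h1 := (q : Fin d × Fin (2 * n)).2.2
      have := hg' (pos n (q : Fin d × Fin (2 * n))) (by simp [pos]) (by simp only [pos]; omega)
      rw [Fintype.sum_sum_type, Finset.sum_eq_single q, Finset.sum_eq_zero, add_zero] at this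
      · have h2 := coordAt_chartGen_of_mem_compl (c := c) q q
        rw [if_pos rfl] at h2
        simp only [f, Sum.elim_inl] at this
        rwa [← coordAt_eq, h2, mul_one] at this
      · intro p _
        simp only [f, Sum.elim_inr]
        rw [coeffAt_monoVec, if_neg, mul_zero]
        intro h
        have := congrArg Prod.snd h
        simp only [pos] at this
        omega
      · intro q' _ hq'
        simp only [f, Sum.elim_inl]
        rw [← coordAt_eq, coordAt_chartGen_of_mem_compl, if_neg hq'.symm, mul_zero]
      · simp
    · have := hg' (i, (n : ℤ) + e) (by simp only; omega) (by simp)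
      rw [Fintype.sum_sum_type, Finset.sum_eq_zero, zero_add, Finset.sum_eq_single (i, e)] at this
      · simpa [f, coeffAt_monoVec] using this
      · intro p _ hp
        simp only [f, Sum.elim_inr]
        rw [coeffAt_monoVec, if_neg, mul_zero]
        intro h
        apply hp
        have h1 := congrArg Prod.fst h
        have h2 := congrArg Prod.snd h
        simp only at h1 h2
        exact Prod.ext h1.symm (Fin.ext (by change (p.2 : ℕ) = e; omega))
      · simp
      · intro q _
        simp only [f, Sum.elim_inl]
        rw [hgen q _ (by simp), mul_zero]
  rw [hspan, finrank_span_eq_card hli]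
  simp

/-- The codimension in `t⁻ⁿF[[t]]ᵈ` is `2nd - |Iᶜ|`. The index therefore depends only on the chart,
and sets defined by the index are unions of whole pieces of a presentation. -/
theorem index_eq_of_grChart {H : TLattice F d} (hH : H ∈ Gr F d n)
    (h : (H : Set (LaurentSpace F d)) = grChart F d n I c) :
    index H = (n : ℤ) * d - Fintype.card (Iᶜ : Finset _) := by
  have h1 := coDim_add_finrank (n := n) (N := n) (w := 2 * n) (H := H)
    (by convert hH.1 using 2; push_cast; ring) hH.2 le_rfl
  have h2 := finrank_map_window_chartSpace (c := c) 0
  rw [coe_eq_grChart.1 h] at h1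
  rw [add_zero] at h2
  rw [h2] at h1
  rw [index_eq hH]
  have h3 := congrArg (Nat.cast (R := ℤ)) h1
  push_cast at h3
  linarith

end

end Dimension

/-! ### The motivic measure in terms of charts -/

section Measure

variable (k : Type u) [Field k] {F : Type u} [Field F] [Algebra k F] {d : ℕ}

variable {k}

/-- A condition constant on charts cuts the trace of `A` on each chart to everything or nothing. -/
theorem GrStable.sep {n : ℕ} {A : Set (TLattice F d)} (hA : GrStable k n A)
    (P : TLattice F d → Prop) (Q : Finset (Fin d × Fin (2 * n)) → Prop)
    (h : ∀ H ∈ Gr F d n, ∀ I c, (H : Set (LaurentSpace F d)) = grChart F d n I c → (P H ↔ Q I)) :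
    GrStable k n {H ∈ A | P H} := by
  classical
  have hsub : asSets {H ∈ A | P H} ⊆ asSets A := Set.image_mono fun H hH => hH.1
  refine ⟨fun H hH => hA.1 hH.1, hsub.trans hA.2.1, fun I => ?_⟩
  change IsCons k (grChart F d n I ⁻¹' asSets {H ∈ A | P H})
  have hI : IsCons k (grChart F d n I ⁻¹' asSets A) := hA.2.2 I
  by_cases hQ : Q I
  · convert hI using 1
    refine (Set.preimage_mono hsub).antisymm ?_
    rintro c ⟨H, hH, hc⟩
    exact ⟨H, ⟨hH, (h H (hA.1 hH) I c hc).2 hQ⟩, hc⟩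
  · have hempty : grChart F d n I ⁻¹' asSets {H ∈ A | P H} = ∅ := by
      refine Set.eq_empty_of_forall_notMem ?_
      rintro c ⟨H, hH, hc⟩
      exact hQ ((h H (hA.1 hH.1) I c hc).1 hH.2)
    rw [hempty]
    exact isCons_empty

theorem GrStable.inter_grIndex {n : ℕ} {A : Set (TLattice F d)} (hA : GrStable k n A) (m : ℤ) :
    GrStable k n (A ∩ GrIndex F d m) :=
  hA.sep (fun H => H ∈ GrIndex F d m)
    (fun I => (n : ℤ) * d - Fintype.card (Iᶜ : Finset _) = m) fun H hH I c hc => by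
      rw [← index_eq_of_grChart hH hc]
      exact ⟨fun h => h.2, fun h => ⟨⟨n, hH⟩, h⟩⟩

theorem IsPresentation.index_eq {n : ℕ} {A : Set (TLattice F d)} (hA : A ⊆ Gr F d n)
    {X : ∀ I : Finset (Fin d × Fin (2 * n)), Set (I × (Iᶜ : Finset _) → F)}
    (h : IsPresentation k (grChart F d n) (asSets A) (fun I => I) X) {I} {c} (hc : c ∈ X I) :
    ∃ H ∈ A, (H : Set (LaurentSpace F d)) = grChart F d n I c ∧
      index H = (n : ℤ) * d - Fintype.card (Iᶜ : Finset _) := by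
  have h1 : grChart F d n I c ∈ asSets A := by
    rw [h.eq]
    exact Set.mem_iUnion.2 ⟨I, c, hc, rfl⟩
  obtain ⟨H, hH, hHc⟩ := h1
  exact ⟨H, hH, hHc, index_eq_of_grChart (hA hH) hHc⟩

variable [IsAlgClosed F]

omit [IsAlgClosed F] in
theorem GrStable.exists_presentation {n : ℕ} {A : Set (TLattice F d)} (hA : GrStable k n A) :
    ∃ X : ∀ I : Finset (Fin d × Fin (2 * n)), Set (I × (Iᶜ : Finset _) → F),
      IsPresentation k (grChart F d n) (asSets A) (fun I => I) X :=
  hA.2.exists_presentation (compatible_grChart k n n)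

theorem grClass_eq_sum {n : ℕ} {A : Set (TLattice F d)}
    {X : ∀ I : Finset (Fin d × Fin (2 * n)), Set (I × (Iᶜ : Finset _) → F)}
    (h : IsPresentation k (grChart F d n) (asSets A) (fun I => I) X) :
    grClass k n A = ∑ I, affineClass k (X I) :=
  h.setClass_eq (fun _ => grChart_injective) (compatible_grChart k n n)

/-- The charts of two different levels are compatible, so the class does not see the level. -/
theorem GrStable.grClass_eq {n n' : ℕ} {A : Set (TLattice F d)} (hA : GrStable k n A)
    (hA' : GrStable k n' A) : grClass k n A = grClass k n' A := by
  obtain ⟨X, hX⟩ := hA.exists_presentation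
  obtain ⟨X', hX'⟩ := hA'.exists_presentation
  rw [grClass_eq_sum hX, grClass_eq_sum hX', hX.sum_eq hX' (compatible_grChart k n n')]

omit [IsAlgClosed F] in
open Classical in
theorem IsPresentation.sep {n : ℕ} {A : Set (TLattice F d)} (hA : A ⊆ Gr F d n)
    {X : ∀ I : Finset (Fin d × Fin (2 * n)), Set (I × (Iᶜ : Finset _) → F)}
    (h : IsPresentation k (grChart F d n) (asSets A) (fun I => I) X)
    (P : TLattice F d → Prop) (Q : Finset (Fin d × Fin (2 * n)) → Prop)
    (hPQ : ∀ H ∈ Gr F d n, ∀ I c, (H : Set (LaurentSpace F d)) = grChart F d n I c →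
      (P H ↔ Q I)) :
    IsPresentation k (grChart F d n) (asSets {H ∈ A | P H}) (fun I => I)
      (fun I => if Q I then X I else ∅) := by
  have hsub : ∀ I, (if Q I then X I else ∅) ⊆ X I := fun I => by
    split_ifs
    · exact subset_rfl
    · exact Set.empty_subset _
  refine ⟨fun I => ?_, fun I I' hne =>
    (h.disjoint hne).mono (Set.image_mono (hsub I)) (Set.image_mono (hsub I')), ?_⟩
  · split_ifs
    · exact h.isCons I
    · exact isCons_empty
  · ext S
    simp only [Set.mem_iUnion]
    constructor
    · rintro ⟨H, ⟨hHA, hHP⟩, rfl⟩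
      have h1 : (H : Set (LaurentSpace F d)) ∈ asSets A := ⟨H, hHA, rfl⟩
      rw [h.eq] at h1
      obtain ⟨I, c, hc, hcH⟩ := Set.mem_iUnion.1 h1
      refine ⟨I, c, ?_, hcH⟩
      rwa [if_pos ((hPQ H (hA hHA) I c hcH.symm).1 hHP)]
    · rintro ⟨I, c, hc, rfl⟩
      split_ifs at hc with hQ
      · obtain ⟨H, hH, hHc, -⟩ := h.index_eq hA hc
        exact ⟨H, ⟨hH, (hPQ H (hA hH) I c hHc).2 hQ⟩, hHc⟩
      · exact hc.elim

open Classical in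
theorem grClass_inter_grIndex {n : ℕ} {A : Set (TLattice F d)} (hA : A ⊆ Gr F d n)
    {X : ∀ I : Finset (Fin d × Fin (2 * n)), Set (I × (Iᶜ : Finset _) → F)}
    (h : IsPresentation k (grChart F d n) (asSets A) (fun I => I) X) (m : ℤ) :
    grClass k n (A ∩ GrIndex F d m) = ∑ I : Finset (Fin d × Fin (2 * n)),
      if (n : ℤ) * d - Fintype.card (Iᶜ : Finset _) = m then affineClass k (X I) else 0 := by
  have hpres := h.sep hA (fun H => H ∈ GrIndex F d m)
    (fun I => (n : ℤ) * d - Fintype.card (Iᶜ : Finset _) = m) fun H hH I c hc => by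
      rw [← index_eq_of_grChart hH hc]
      exact ⟨fun h => h.2, fun h => ⟨⟨n, hH⟩, h⟩⟩
  refine (grClass_eq_sum hpres).trans (Finset.sum_congr rfl fun I _ => ?_)
  split_ifs
  · rfl
  · exact affineClass_empty

/-- Each piece lies in a chart of constant index and contributes to a single term of the sum over
`m`. -/
theorem grMeasure_eq_sum {n : ℕ} {A : Set (TLattice F d)} (hA : GrStable k n A)
    {X : ∀ I : Finset (Fin d × Fin (2 * n)), Set (I × (Iᶜ : Finset _) → F)}
    (h : IsPresentation k (grChart F d n) (asSets A) (fun I => I) X) :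
    grMeasure k A = ∑ I : Finset (Fin d × Fin (2 * n)),
      algebraMap (GrothendieckRing k) (GrothendieckRingLoc k) (affineClass k (X I)) *
        lefPow k (-(((n : ℤ) * d - Fintype.card (Iᶜ : Finset _)) * d)) := by
  classical
  have hex : ∃ n, GrStable k n A := ⟨n, hA⟩
  rw [grMeasure, dif_pos hex]
  have h1 : ∀ m, grClass k (Nat.find hex) (A ∩ GrIndex F d m) =
      ∑ I : Finset (Fin d × Fin (2 * n)),
        if (n : ℤ) * d - Fintype.card (Iᶜ : Finset _) = m then affineClass k (X I) else 0 :=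
    fun m => (((Nat.find_spec hex).inter_grIndex m).grClass_eq (hA.inter_grIndex m)).trans
      (grClass_inter_grIndex hA.1 h m)
  let S : Finset ℤ := Finset.univ.image fun I : Finset (Fin d × Fin (2 * n)) =>
    (n : ℤ) * d - Fintype.card (Iᶜ : Finset _)
  simp only [h1, map_sum, Finset.sum_mul]
  rw [finsum_eq_sum_of_support_subset (s := S)]
  · rw [Finset.sum_comm]
    refine Finset.sum_congr rfl fun I _ => ?_
    rw [Finset.sum_eq_single ((n : ℤ) * d - Fintype.card (Iᶜ : Finset _))]
    · rw [if_pos rfl]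
    · intro m _ hm
      rw [if_neg hm.symm, map_zero, zero_mul]
    · intro hm
      exact (hm (Finset.mem_image_of_mem _ (Finset.mem_univ I))).elim
  · intro m hm
    obtain ⟨I, -, hI⟩ := Finset.exists_ne_zero_of_sum_ne_zero (Function.mem_support.1 hm)
    have : (n : ℤ) * d - Fintype.card (Iᶜ : Finset _) = m := by
      by_contra hne
      rw [if_neg hne, map_zero, zero_mul] at hI
      exact hI rfl
    exact Finset.mem_coe.2 (Finset.mem_image.2 ⟨I, Finset.mem_univ I, this⟩)

end Measure

/-! ### Classes of families of frames -/

section Frames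

variable {k : Type u} [Field k] {F : Type u} [Field F] [Algebra k F]
variable {σ ρ ρ' Q : Type}

theorem range_sumElim_snoc {m : ℕ} {V : Type*} (v : ρ' → V) (y : Fin (m + 1) → V) :
    Set.range (Sum.elim v y) =
      Set.range (Sum.elim v fun j : Fin m => y j.castSucc) ∪ {y (Fin.last m)} := by
  ext x
  simp only [Set.mem_range, Sum.exists, Sum.elim_inl, Sum.elim_inr, Fin.exists_fin_succ',
    Set.mem_union, Set.mem_singleton_iff, eq_comm (a := x), or_assoc]

/-- The vectors `y j` lie in the span of the `u i`, and their classes modulo the span of the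
`v i`, which has dimension `s`, are linearly independent. -/
def IsFrame (s : ℕ) {m : ℕ} (u : ρ → Q → F) (v : ρ' → Q → F) (y : Fin m → Q → F) : Prop :=
  (∀ j, y j ∈ Submodule.span F (Set.range u)) ∧
    Module.finrank F (Submodule.span F (Set.range (Sum.elim v y))) = s + m

/-- The rank can grow by at most one per vector, so the maximal rank `s + m + 1` forces it to grow
at every stage. -/
theorem isFrame_succ_iff [Finite ρ'] [Finite Q] {s m : ℕ} {u : ρ → Q → F} {v : ρ' → Q → F} {y : Fin (m + 1) → Q → F}
    (hs : Module.finrank F (Submodule.span F (Set.range v)) = s) :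
    IsFrame s u v y ↔ IsFrame s u v (fun j => y j.castSucc) ∧
      y (Fin.last m) ∈ Submodule.span F (Set.range u) ∧
      y (Fin.last m) ∉ Submodule.span F (Set.range (Sum.elim v fun j : Fin m => y j.castSucc)) := by
  have hle : ∀ {m : ℕ} (y : Fin m → Q → F),
      Module.finrank F (Submodule.span F (Set.range (Sum.elim v y))) ≤ s + m := by
    intro m y
    rw [Set.Sum.elim_range, Submodule.span_union]
    refine (Submodule.finrank_add_le_finrank_add_finrank _ _).trans ?_
    rw [hs]
    exact Nat.add_le_add_left ((finrank_range_le_card y).trans (by simp)) _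
  have hspan : Submodule.span F (Set.range (Sum.elim v y)) =
      Submodule.span F (Set.range (Sum.elim v fun j : Fin m => y j.castSucc)) ⊔
        Submodule.span F {y (Fin.last m)} := by
    rw [range_sumElim_snoc, Submodule.span_union]
  rw [IsFrame, IsFrame, hspan, Fin.forall_fin_succ']
  by_cases h : y (Fin.last m) ∈
      Submodule.span F (Set.range (Sum.elim v fun j : Fin m => y j.castSucc))
  · rw [sup_eq_left.2 ((Submodule.span_singleton_le_iff_mem _ _).2 h)]
    have := hle fun j : Fin m => y j.castSucc
    simp only [h, not_true_eq_false, and_false, iff_false, not_and]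
    intro _
    omega
  · rw [Submodule.finrank_sup_span_singleton h]
    simp only [h, not_false_eq_true, and_true]
    constructor
    · rintro ⟨⟨h1, h2⟩, h3⟩
      exact ⟨⟨h1, by omega⟩, h2⟩
    · rintro ⟨⟨h1, h3⟩, h2⟩
      exact ⟨⟨h1, h2⟩, by omega⟩

/-- The rearrangement of coordinates which splits off the last of `m + 1` vectors. -/
def snocEquiv (σ Q : Type) (m : ℕ) : (σ ⊕ (Fin m × Q)) ⊕ Q ≃ σ ⊕ (Fin (m + 1) × Q) :=
  Equiv.ofBijective (Sum.elim (Sum.elim Sum.inl fun p => Sum.inr (p.1.castSucc, p.2))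
    fun q => Sum.inr (Fin.last m, q)) (by
    constructor
    · rintro ((a | ⟨i, q⟩) | q) ((a' | ⟨i', q'⟩) | q') h <;>
        simp_all [Fin.castSucc_ne_last, (Fin.castSucc_ne_last _).symm]
    · rintro (a | ⟨i, q⟩)
      · exact ⟨Sum.inl (Sum.inl a), rfl⟩
      · induction i using Fin.lastCases with
        | last => exact ⟨Sum.inr q, rfl⟩
        | cast i => exact ⟨Sum.inl (Sum.inr (i, q)), rfl⟩)

variable [IsAlgClosed F] [Finite σ] [Finite ρ] [Finite ρ'] [Finite Q]

/-- The next vector varies in a space of dimension `N` minus a subspace of dimension `s + m`, which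
gives the factor `𝐋^N - 𝐋^(s+m)`; both spaces form families covered by `affineClass_span`. -/
theorem affineClass_isFrame (u : ρ → (σ → F) → Q → F) (hu : ∀ i j, Definable k fun x => u i x j)
    (v : ρ' → (σ → F) → Q → F) (hv : ∀ i j, Definable k fun x => v i x j)
    {X : Set (σ → F)} (hX : IsCons k X) (N s : ℕ)
    (hN : ∀ x ∈ X, Module.finrank F (Submodule.span F (Set.range fun i => u i x)) = N)
    (hs : ∀ x ∈ X, Module.finrank F (Submodule.span F (Set.range fun i => v i x)) = s)
    (hle : ∀ x ∈ X, Submodule.span F (Set.range fun i => v i x) ≤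
      Submodule.span F (Set.range fun i => u i x)) (m : ℕ) :
    IsCons k {y : σ ⊕ (Fin m × Q) → F | y ∘ Sum.inl ∈ X ∧
      IsFrame s (fun i => u i (y ∘ Sum.inl)) (fun i => v i (y ∘ Sum.inl))
        (fun j q => y (Sum.inr (j, q)))} ∧
    affineClass k {y : σ ⊕ (Fin m × Q) → F | y ∘ Sum.inl ∈ X ∧
      IsFrame s (fun i => u i (y ∘ Sum.inl)) (fun i => v i (y ∘ Sum.inl))
        (fun j q => y (Sum.inr (j, q)))} =
      affineClass k X * ∏ j ∈ Finset.range m, (lefschetz k ^ N - lefschetz k ^ (s + j)) := by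
  induction m with
  | zero =>
    have h : {y : σ ⊕ (Fin 0 × Q) → F | y ∘ Sum.inl ∈ X ∧
        IsFrame s (fun i => u i (y ∘ Sum.inl)) (fun i => v i (y ∘ Sum.inl))
          (fun j q => y (Sum.inr (j, q)))} = {y | y ∘ Sum.inl ∈ X} := by
      ext y
      refine and_iff_left_of_imp fun hy => ⟨fun j => j.elim0, ?_⟩
      rw [Set.Sum.elim_range, Set.range_eq_empty (fun (j : Fin 0) q => y (Sum.inr (j, q))),
        Set.union_empty, hs _ hy, add_zero]
    rw [h]
    refine ⟨hX.prod_univ, ?_⟩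
    rw [affineClass_prod hX]
    simp
  | succ m ih =>
    obtain ⟨hE, hcls⟩ := ih
    set E := {y : σ ⊕ (Fin m × Q) → F | y ∘ Sum.inl ∈ X ∧
      IsFrame s (fun i => u i (y ∘ Sum.inl)) (fun i => v i (y ∘ Sum.inl))
        (fun j q => y (Sum.inr (j, q)))} with hEdef
    have hu' : ∀ i j, Definable k fun y : σ ⊕ (Fin m × Q) → F => u i (y ∘ Sum.inl) j :=
      fun i j => (hu i j).comp_inl
    have hw' : ∀ (i : ρ' ⊕ Fin m) (j : Q), Definable k fun y : σ ⊕ (Fin m × Q) → F =>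
        Sum.elim (fun i => v i (y ∘ Sum.inl)) (fun j q => y (Sum.inr (j, q))) i j := by
      rintro (i | i) j
      · exact (hv i j).comp_inl
      · exact .coord _
    have h1 := isCons_span (fun i (y : σ ⊕ (Fin m × Q) → F) => u i (y ∘ Sum.inl)) hu' hE
    have h2 := isCons_span (fun i (y : σ ⊕ (Fin m × Q) → F) => Sum.elim
      (fun i => v i (y ∘ Sum.inl)) (fun j q => y (Sum.inr (j, q))) i) hw' hE
    have c1 := affineClass_span (fun i (y : σ ⊕ (Fin m × Q) → F) => u i (y ∘ Sum.inl)) hu' hE N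
      fun y hy => hN _ hy.1
    have c2 := affineClass_span (fun i (y : σ ⊕ (Fin m × Q) → F) => Sum.elim
      (fun i => v i (y ∘ Sum.inl)) (fun j q => y (Sum.inr (j, q))) i) hw' hE (s + m)
      fun y hy => hy.2.2
    have hsub : {z : (σ ⊕ (Fin m × Q)) ⊕ Q → F | z ∘ Sum.inl ∈ E ∧ z ∘ Sum.inr ∈
          Submodule.span F (Set.range fun i => Sum.elim (fun i => v i ((z ∘ Sum.inl) ∘ Sum.inl))
            (fun j q => (z ∘ Sum.inl) (Sum.inr (j, q))) i)} ⊆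
        {z | z ∘ Sum.inl ∈ E ∧ z ∘ Sum.inr ∈
          Submodule.span F (Set.range fun i => u i ((z ∘ Sum.inl) ∘ Sum.inl))} := by
      rintro z ⟨hz, hz'⟩
      refine ⟨hz, ?_⟩
      have hle' : Submodule.span F (Set.range fun i => Sum.elim
          (fun i => v i ((z ∘ Sum.inl) ∘ Sum.inl))
            (fun j q => (z ∘ Sum.inl) (Sum.inr (j, q))) i) ≤
          Submodule.span F (Set.range fun i => u i ((z ∘ Sum.inl) ∘ Sum.inl)) := by
        rw [Submodule.span_le]
        rintro _ ⟨i | j, rfl⟩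
        · exact hle _ hz.1 (Submodule.subset_span ⟨i, rfl⟩)
        · exact hz.2.1 j
      exact hle' hz'
    have hD := h1.sdiff h2
    have cD := affineClass_sdiff h1 h2 hsub
    rw [c1, c2, ← mul_sub, hcls, mul_assoc, ← Finset.prod_range_succ
      (fun j => lefschetz k ^ N - lefschetz k ^ (s + j))] at cD
    rw [← cD, ← affineClass_reindex hD (snocEquiv σ Q m)]
    have hset : {y : σ ⊕ (Fin (m + 1) × Q) → F | y ∘ Sum.inl ∈ X ∧
        IsFrame s (fun i => u i (y ∘ Sum.inl)) (fun i => v i (y ∘ Sum.inl))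
          (fun j q => y (Sum.inr (j, q)))} = {y | y ∘ snocEquiv σ Q m ∈
        {z : (σ ⊕ (Fin m × Q)) ⊕ Q → F | z ∘ Sum.inl ∈ E ∧ z ∘ Sum.inr ∈
          Submodule.span F (Set.range fun i => u i ((z ∘ Sum.inl) ∘ Sum.inl))} \
        {z : (σ ⊕ (Fin m × Q)) ⊕ Q → F | z ∘ Sum.inl ∈ E ∧ z ∘ Sum.inr ∈
          Submodule.span F (Set.range fun i => Sum.elim (fun i => v i ((z ∘ Sum.inl) ∘ Sum.inl))
            (fun j q => (z ∘ Sum.inl) (Sum.inr (j, q))) i)}} := by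
      ext y
      change (y ∘ Sum.inl ∈ X ∧ IsFrame s _ _ _) ↔ (((y ∘ Sum.inl ∈ X ∧ IsFrame s
        (fun i => u i (y ∘ Sum.inl)) (fun i => v i (y ∘ Sum.inl))
          (fun (j : Fin m) q => y (Sum.inr (j.castSucc, q)))) ∧
        (fun q => y (Sum.inr (Fin.last m, q))) ∈
          Submodule.span F (Set.range fun i => u i (y ∘ Sum.inl))) ∧
        ¬ ((y ∘ Sum.inl ∈ X ∧ IsFrame s
        (fun i => u i (y ∘ Sum.inl)) (fun i => v i (y ∘ Sum.inl))
          (fun (j : Fin m) q => y (Sum.inr (j.castSucc, q)))) ∧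
        (fun q => y (Sum.inr (Fin.last m, q))) ∈
          Submodule.span F (Set.range (Sum.elim (fun i => v i (y ∘ Sum.inl))
            (fun (j : Fin m) q => y (Sum.inr (j.castSucc, q)))))))
      by_cases hy : y ∘ Sum.inl ∈ X
      · rw [isFrame_succ_iff (hs _ hy)]
        tauto
      · tauto
    rw [hset]
    exact ⟨hD.preimage (f := fun y => y ∘ snocEquiv σ Q m) fun j => .coord _, rfl⟩

end Frames

/-! ### Generators of a lattice and Nakayama's lemma -/

section Generators

variable {F : Type u} [Field F] {d : ℕ}

theorem exists_eq_sum_add_X_smul {V : Type*} [AddCommGroup V] [Module F⟦X⟧ V] {ι : Type*}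
    [Fintype ι] {w : ι → V} {h : V}
    (hh : h ∈ Submodule.span F⟦X⟧ (Set.range w)) :
    ∃ (a : ι → F), ∃ h' ∈ Submodule.span F⟦X⟧ (Set.range w),
      h = ∑ j, (PowerSeries.C (a j) : F⟦X⟧) • w j + (PowerSeries.X : F⟦X⟧) • h' := by
  obtain ⟨f, rfl⟩ := (Submodule.mem_span_range_iff_exists_fun _).1 hh
  choose g hg using fun j => smul_decomp (f j)
  refine ⟨fun j => PowerSeries.constantCoeff (f j), ∑ j, g j • w j,
    Submodule.sum_mem _ fun j _ => Submodule.smul_mem _ _ (Submodule.subset_span ⟨j, rfl⟩), ?_⟩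
  rw [Finset.smul_sum, ← Finset.sum_add_distrib]
  refine Finset.sum_congr rfl fun j _ => ?_
  rw [smul_smul, ← add_smul, ← hg j]

/-- Nakayama: `H ⊆ S + tH` with `H` finitely generated, and `t` generates the maximal ideal of
`F[[t]]`. -/
theorem le_of_le_sup_X_smul {V : Type*} [AddCommGroup V] [Module F⟦X⟧ V] {H S : Submodule F⟦X⟧ V}
    (hH : H.FG) (h : ∀ v ∈ H, ∃ s ∈ S, ∃ v' ∈ H, v = s + (PowerSeries.X : F⟦X⟧) • v') : H ≤ S := by
  refine Submodule.le_of_le_smul_of_le_jacobson_bot (I := Ideal.span {(PowerSeries.X : F⟦X⟧)}) hH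
    ?_ fun v hv => ?_
  · rw [IsLocalRing.jacobson_eq_maximalIdeal _ bot_ne_top, ← PowerSeries.maximalIdeal_eq_span_X]
  · obtain ⟨s, hs, v', hv', rfl⟩ := h v hv
    exact Submodule.add_mem_sup hs
      (Submodule.smul_mem_smul (Ideal.mem_span_singleton_self _) hv')

theorem fg_of_le_stdLattice {n : ℤ} {H : TLattice F d} (h : H ≤ stdLattice F d n) : H.FG := by
  have : IsNoetherian F⟦X⟧ (stdLattice F d n) :=
    isNoetherian_of_fg_of_noetherian _ (Submodule.fg_span (Set.finite_range _))
  exact (isNoetherian_submodule.1 this) H h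

variable (F d) in
/-- Multiplication by `t` as a linear map over `F`. -/
def mulX : LaurentSpace F d →ₗ[F] LaurentSpace F d :=
  (LinearMap.lsmul F⟦X⟧ (LaurentSpace F d) PowerSeries.X).restrictScalars F

theorem mulX_apply (v : LaurentSpace F d) : mulX F d v = (PowerSeries.X : F⟦X⟧) • v := rfl

theorem mulX_mem {n : ℤ} {v : LaurentSpace F d} (h : v ∈ stdLattice F d n) :
    mulX F d v ∈ stdLattice F d (n + 1) := by
  have := X_pow_smul_mem_stdLattice 1 h
  rwa [pow_one] at this

theorem exists_mulX_eq {n : ℤ} {v : LaurentSpace F d} (h : v ∈ stdLattice F d (n + 1)) :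
    ∃ w ∈ stdLattice F d n, v = mulX F d w := by
  obtain ⟨w, hw, hv⟩ := exists_X_pow_smul_of_mem (m := 1) h
  exact ⟨w, hw, by rw [hv, pow_one]; rfl⟩

theorem coeffAt_mulX (a : Fin d × ℤ) (v : LaurentSpace F d) :
    coeffAt a (mulX F d v) = coeffAt (a.1, a.2 - 1) v := coeffAt_X_smul a v

theorem mulX_mem_iff {n : ℤ} {v : LaurentSpace F d} :
    mulX F d v ∈ stdLattice F d (n + 1) ↔ v ∈ stdLattice F d n := by
  refine ⟨fun h => mem_stdLattice_iff.2 fun a ha => ?_, mulX_mem⟩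
  have := mem_stdLattice_iff.1 h (a.1, a.2 + 1) (by simp only; omega)
  rwa [coeffAt_mulX, add_sub_cancel_right] at this

variable {n : ℕ} {I : Finset (Fin d × Fin (2 * n))} {c : I × (Iᶜ : Finset _) → F}

theorem map_window_mulX_chartSpace :
    (chartSpace I c).map (window n (2 * n + 1) ∘ₗ mulX F d) =
      Submodule.span F (Set.range fun q => window n (2 * n + 1) (mulX F d (chartGen I c q))) := by
  apply le_antisymm
  · rintro _ ⟨v, hv, rfl⟩
    have h1 := mulX_mem (sub_sum_chartGen_mem hv)
    have h2 : window n (2 * n + 1) (mulX F d (v - ∑ q : (Iᶜ : Finset _),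
        coordAt n q v • chartGen I c q)) = 0 := by
      rw [window_eq_zero_iff (stdLattice_anti (by omega) h1)]
      convert h1 using 2
      push_cast
      ring
    rw [map_sub, map_sub, sub_eq_zero, map_sum, map_sum] at h2
    rw [LinearMap.comp_apply, h2]
    refine Submodule.sum_mem _ fun q _ => ?_
    rw [map_smul, map_smul]
    exact Submodule.smul_mem _ _ (Submodule.subset_span ⟨q, rfl⟩)
  · rw [Submodule.span_le]
    rintro _ ⟨q, rfl⟩
    exact ⟨_, chartGen_mem q, rfl⟩

/-- Multiplication by `t` is injective, and `tv` vanishes modulo `tⁿ⁺¹` iff `v` vanishes modulo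
`tⁿ`. -/
theorem finrank_map_window_mulX_chartSpace :
    Module.finrank F ((chartSpace I c).map (window n (2 * n + 1) ∘ₗ mulX F d)) =
      Fintype.card (Iᶜ : Finset _) := by
  have h := finrank_map_window_chartSpace (c := c) 0
  rw [mul_zero, add_zero, add_zero] at h
  rw [← h]
  refine finrank_map_eq_of_ker _ _ _ fun v hv => ?_
  have hv' := chartSpace_le hv
  rw [LinearMap.comp_apply,
    window_eq_zero_iff (stdLattice_anti (by omega) (mulX_mem hv')), window_eq_zero_iff hv']
  have : (((2 * n + 1 : ℕ) : ℤ) - n) = ((2 * n : ℕ) : ℤ) - n + 1 := by push_cast; ring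
  rw [this, mulX_mem_iff]

theorem mulX_mem_chartSpace {H : TLattice F d} (h : H.restrictScalars F = chartSpace I c)
    {v : LaurentSpace F d} (hv : v ∈ chartSpace I c) : mulX F d v ∈ chartSpace I c := by
  rw [← h] at hv ⊢
  exact H.smul_mem _ hv

theorem map_window_mulX_le {H : TLattice F d} (h : H.restrictScalars F = chartSpace I c) :
    (chartSpace I c).map (window n (2 * n + 1) ∘ₗ mulX F d) ≤
      (chartSpace I c).map (window n (2 * n + 1)) := by
  rintro _ ⟨v, hv, rfl⟩
  exact ⟨_, mulX_mem_chartSpace h hv, rfl⟩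

/-- Nakayama in truncated form. Modulo `tⁿ⁺¹` the lattice `H` has dimension `|Iᶜ| + d` and `tH` has
dimension `|Iᶜ|`, so the frame condition says that the `d` vectors lie in `H` and span `H/tH`.
Nothing is lost by truncating, since `tH` contains `tⁿ⁺¹F[[t]]ᵈ`. -/
theorem span_eq_iff_isFrame {H : TLattice F d} (h : H.restrictScalars F = chartSpace I c)
    {w : Fin d → LaurentSpace F d} (hw : ∀ j, w j ∈ stdLattice F d (-n)) :
    Submodule.span F⟦X⟧ (Set.range w) = H ↔
      IsFrame (Fintype.card (Iᶜ : Finset _))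
        (fun r => window n (2 * n + 1) (chartVec I c n (2 * n + 1) r))
        (fun q => window n (2 * n + 1) (mulX F d (chartGen I c q)))
        (fun j => window n (2 * n + 1) (w j)) := by
  have hn : stdLattice F d n ≤ H := by
    have : (stdLattice F d n).restrictScalars F ≤ H.restrictScalars F :=
      h ▸ stdLattice_le_chartSpace
    exact this
  have hn' : H ≤ stdLattice F d (-n) := by
    have : H.restrictScalars F ≤ (stdLattice F d (-n)).restrictScalars F := h ▸ chartSpace_le
    exact this
  have hU := finrank_map_window_chartSpace (c := c) 1
  rw [mul_one] at hU
  rw [IsFrame, Set.Sum.elim_range, Submodule.span_union, ← map_window_chartSpace,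
    ← map_window_mulX_chartSpace]
  have hcomb : ∀ a : Fin d → F, ∑ j, (PowerSeries.C (a j) : F⟦X⟧) • w j = ∑ j, a j • w j :=
    fun a => Finset.sum_congr rfl fun j _ => C_smul_eq_pi _ _
  constructor
  · rintro hspan
    have hwH : ∀ j, w j ∈ chartSpace I c := fun j => by
      rw [← h]
      change w j ∈ H
      rw [← hspan]
      exact Submodule.subset_span ⟨j, rfl⟩
    refine ⟨fun j => ⟨_, hwH j, rfl⟩, ?_⟩
    rw [← hU]
    refine congrArg (fun S : Submodule F _ => Module.finrank F S) (le_antisymm ?_ ?_)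
    · refine sup_le (map_window_mulX_le h) (Submodule.span_le.2 ?_)
      rintro _ ⟨j, rfl⟩
      exact ⟨_, hwH j, rfl⟩
    · rintro _ ⟨v, hv, rfl⟩
      rw [← h] at hv
      change v ∈ H at hv
      rw [← hspan] at hv
      obtain ⟨a, v', hv', rfl⟩ := exists_eq_sum_add_X_smul hv
      rw [hcomb, map_add, map_sum]
      refine Submodule.add_mem _ (Submodule.mem_sup_right (Submodule.sum_mem _ fun j _ => ?_))
        (Submodule.mem_sup_left ⟨v', ?_, rfl⟩)
      swap
      · rw [hspan] at hv'
        rw [← h]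
        exact hv'
      · rw [map_smul]
        exact Submodule.smul_mem _ _ (Submodule.subset_span ⟨j, rfl⟩)
  · rintro ⟨h1, h2⟩
    have hwH : ∀ j, w j ∈ chartSpace I c := fun j =>
      mem_of_window_mem (by omega) stdLattice_le_chartSpace chartSpace_le (hw j) (h1 j)
    apply le_antisymm
    · rw [Submodule.span_le]
      rintro _ ⟨j, rfl⟩
      have := hwH j
      rw [← h] at this
      exact this
    · have hle : (chartSpace I c).map (window n (2 * n + 1) ∘ₗ mulX F d) ⊔
          Submodule.span F (Set.range fun j => window n (2 * n + 1) (w j)) ≤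
          (chartSpace I c).map (window n (2 * n + 1)) := by
        refine sup_le (map_window_mulX_le h) (Submodule.span_le.2 ?_)
        rintro _ ⟨j, rfl⟩
        exact ⟨_, hwH j, rfl⟩
      have := FiniteDimensional.finiteDimensional_submodule
        ((chartSpace I c).map (window n (2 * n + 1)))
      have heq := Submodule.eq_of_le_of_finrank_eq hle (h2.trans hU.symm)
      refine le_of_le_sup_X_smul (fg_of_le_stdLattice hn') fun v hv => ?_
      have hv1 : window n (2 * n + 1) v ∈ (chartSpace I c).map (window n (2 * n + 1)) :=
        ⟨v, by rw [← h]; exact hv, rfl⟩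
      rw [← heq] at hv1
      obtain ⟨_, ⟨v', hv', rfl⟩, s, hs, hsum⟩ := Submodule.mem_sup.1 hv1
      obtain ⟨a, rfl⟩ := (Submodule.mem_span_range_iff_exists_fun _).1 hs
      have hv'H : v' ∈ H := by
        rw [← h] at hv'
        exact hv'
      set r := v - ∑ j, a j • w j - mulX F d v' with hr
      have hr0 : window n (2 * n + 1) r = 0 := by
        rw [hr, map_sub, map_sub, ← hsum, map_sum]
        simp
      have hsumH : ∑ j, a j • w j ∈ H := by
        have : ∑ j, a j • w j ∈ H.restrictScalars F := by
          rw [h]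
          exact Submodule.sum_mem _ fun j _ => Submodule.smul_mem _ _ (hwH j)
        exact this
      have hrH : r ∈ H := H.sub_mem (H.sub_mem hv hsumH) (H.smul_mem _ hv'H)
      -- The error of the truncation is divisible by `tⁿ⁺¹`, hence is `t` times an element of
      -- `tⁿF[[t]]ᵈ ⊆ H`. This is where the extra coefficient of the window is needed.
      have hr1 : r ∈ stdLattice F d ((n : ℤ) + 1) := by
        have := (window_eq_zero_iff (hn' hrH)).1 hr0
        convert this using 2
        push_cast
        ring
      obtain ⟨r', hr', hrr'⟩ := exists_mulX_eq hr1
      refine ⟨∑ j, a j • w j, ?_, v' + r', H.add_mem hv'H (hn hr'), ?_⟩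
      · rw [← hcomb]
        exact Submodule.sum_mem _ fun j _ => Submodule.smul_mem _ _ (Submodule.subset_span ⟨j, rfl⟩)
      · rw [smul_add, ← mulX_apply, ← mulX_apply, ← hrr', hr]
        abel

/-- Modulo `tⁿ`, the lattice is spanned over `F` by the vectors `t^l w_j` with `l < 2n`, so graph
equations that hold for these hold on all of `H`, and then at the generators of the chart. -/
theorem chartCoord_unique {H : TLattice F d} (h : H.restrictScalars F = chartSpace I c)
    {w : Fin d → LaurentSpace F d} (hw : Submodule.span F⟦X⟧ (Set.range w) = H)
    {s : I × (Iᶜ : Finset _) → F} (hs : ∀ (j : Fin d), ∀ l < 2 * n, ∀ p : I,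
      coordAt n p ((PowerSeries.X ^ l : F⟦X⟧) • w j) =
        ∑ q : (Iᶜ : Finset _), s (p, q) * coordAt n q ((PowerSeries.X ^ l : F⟦X⟧) • w j)) :
    s = c := by
  have hn' : H ≤ stdLattice F d (-n) := by
    have : H.restrictScalars F ≤ (stdLattice F d (-n)).restrictScalars F := h ▸ chartSpace_le
    exact this
  -- Descending induction on the power of `t`: for the power `2n` all the coordinates vanish; for a
  -- smaller one, split off the constant terms of the coefficients of `v`.
  have key : ∀ m ≤ 2 * n, ∀ v ∈ H, ∀ p : I,
      coordAt n p ((PowerSeries.X ^ (2 * n - m) : F⟦X⟧) • v) =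
        ∑ q : (Iᶜ : Finset _), s (p, q) *
          coordAt n q ((PowerSeries.X ^ (2 * n - m) : F⟦X⟧) • v) := by
    intro m
    induction m with
    | zero =>
      intro _ v hv p
      have h1 := X_pow_smul_mem_stdLattice (2 * n) (hn' hv)
      have h0 : ∀ p : Fin d × Fin (2 * n), coordAt n p ((PowerSeries.X ^ (2 * n) : F⟦X⟧) • v) = 0 :=
        fun p => mem_stdLattice_iff.1 h1 (pos n p) (by
          have := p.2.2
          simp only [pos]
          push_cast
          omega)
      simp [h0]
    | succ m ih =>
      intro hm v hv p
      have ih' := ih (by omega)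
      rw [← hw] at hv
      obtain ⟨a, v', hv', rfl⟩ := exists_eq_sum_add_X_smul hv
      rw [hw] at hv'
      have hexp : ∀ p : Fin d × Fin (2 * n),
          coordAt n p ((PowerSeries.X ^ (2 * n - (m + 1)) : F⟦X⟧) •
            (∑ j, (PowerSeries.C (a j) : F⟦X⟧) • w j + (PowerSeries.X : F⟦X⟧) • v')) =
          ∑ j, a j * coordAt n p ((PowerSeries.X ^ (2 * n - (m + 1)) : F⟦X⟧) • w j) +
            coordAt n p ((PowerSeries.X ^ (2 * n - m) : F⟦X⟧) • v') := by
        intro p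
        have e1 : 2 * n - m = 2 * n - (m + 1) + 1 := by omega
        have hC : ∀ j, (PowerSeries.X ^ (2 * n - (m + 1)) : F⟦X⟧) •
            (PowerSeries.C (a j) : F⟦X⟧) • w j =
              a j • (PowerSeries.X ^ (2 * n - (m + 1)) : F⟦X⟧) • w j := fun j => by
          rw [smul_comm, C_smul_eq_pi]
        rw [smul_add, smul_smul, ← pow_succ, ← e1, Finset.smul_sum]
        simp only [hC, coordAt_eq, map_add, map_sum, map_smul, smul_eq_mul]
      simp only [hexp, mul_add, Finset.sum_add_distrib, Finset.mul_sum]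
      rw [← ih' v' hv' p, Finset.sum_comm]
      congr 1
      refine Finset.sum_congr rfl fun j _ => ?_
      rw [hs j _ (by omega) p, Finset.mul_sum]
      exact Finset.sum_congr rfl fun q _ => mul_left_comm _ _ _
  funext ⟨p, q⟩
  have hq : chartGen I c q ∈ H := by
    have := chartGen_mem (c := c) q
    rw [← h] at this
    exact this
  have := key (2 * n) le_rfl _ hq p
  rw [Nat.sub_self, pow_zero, one_smul, coordAt_chartGen_of_mem] at this
  simpa [coordAt_chartGen_of_mem_compl] using this.symm

end Generators

/-! ### Arcs of matrices and the lattices spanned by their columns -/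

section ArcColumns

variable {F : Type u} [Field F] {d : ℕ}

/-- The columns of `t ^ (-n) B`. -/
def arcCol (n : ℕ) (B : Matrix (Fin d) (Fin d) F⟦X⟧) (j : Fin d) : LaurentSpace F d :=
  fun i => HahnSeries.single (-(n : ℤ)) (1 : F) * algebraMap F⟦X⟧ F⸨X⸩ (B i j)

theorem arcCol_mem (n : ℕ) (B : Matrix (Fin d) (Fin d) F⟦X⟧) (j : Fin d) :
    arcCol n B j ∈ stdLattice F d (-n) :=
  mem_stdLattice_iff.2 fun a ha => by
    rw [coeffAt_apply, arcCol, coeff_single_one_mul, coeff_algebraMap_of_neg _ (by omega)]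

theorem window_arcCol (n l : ℕ) (B : Matrix (Fin d) (Fin d) F⟦X⟧) (j : Fin d) :
    window n (l + 1) (arcCol n B j) = fun q => truncate l B (q.1, j, q.2) := by
  funext q
  rw [window_apply, coeffAt_apply, arcCol, coeff_single_one_mul]
  simp only [pos, truncate]
  rw [sub_neg_eq_add, sub_add_cancel, coeff_algebraMap_natCast]

theorem single_mul_single (m n : ℤ) :
    (HahnSeries.single m (1 : F) : F⸨X⸩) * HahnSeries.single n 1 = HahnSeries.single (m + n) 1 := by
  rw [HahnSeries.single_mul_single, one_mul]

theorem single_zero_one : (HahnSeries.single (0 : ℤ) (1 : F) : F⸨X⸩) = 1 := rfl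

theorem map_eq_smul_iff {n : ℕ} {B : Matrix (Fin d) (Fin d) F⟦X⟧}
    {M : Matrix (Fin d) (Fin d) F⸨X⸩} :
    B.map (algebraMap F⟦X⟧ F⸨X⸩) = (HahnSeries.single (n : ℤ) (1 : F) : F⸨X⸩) • M ↔
      ∀ i j, M i j = arcCol n B j i := by
  rw [← Matrix.ext_iff]
  refine forall₂_congr fun i j => ?_
  rw [Matrix.map_apply, Matrix.smul_apply, smul_eq_mul, arcCol]
  constructor
  · intro h
    rw [h, ← mul_assoc, single_mul_single, neg_add_cancel, single_zero_one, one_mul]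
  · intro h
    rw [h, ← mul_assoc, single_mul_single, add_neg_cancel, single_zero_one, one_mul]

/-- Expressing the vectors `tⁿ eᵢ` in the columns produces a right inverse of the matrix. -/
theorem exists_unit_of_span_arcCol {n : ℕ} {B : Matrix (Fin d) (Fin d) F⟦X⟧}
    (h : stdLattice F d n ≤ Submodule.span F⟦X⟧ (Set.range (arcCol n B))) :
    ∃ M : GL (Fin d) F⸨X⸩, ∀ i j, (M : Matrix (Fin d) (Fin d) F⸨X⸩) i j = arcCol n B j i := by
  have h1 : ∀ i : Fin d, ∃ f : Fin d → F⟦X⟧, ∑ j, f j • arcCol n B j =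
      Pi.single i (HahnSeries.single (n : ℤ) (1 : F)) := fun i =>
    (Submodule.mem_span_range_iff_exists_fun _).1 (h (Submodule.subset_span ⟨i, rfl⟩))
  choose f hf using h1
  let N : Matrix (Fin d) (Fin d) F⸨X⸩ := Matrix.of fun i j => arcCol n B j i
  let R : Matrix (Fin d) (Fin d) F⸨X⸩ :=
    Matrix.of fun j i => HahnSeries.single (-(n : ℤ)) (1 : F) * algebraMap F⟦X⟧ F⸨X⸩ (f i j)
  have hNR : N * R = 1 := by
    ext1 i i'
    have h2 := congrFun (hf i') i
    rw [Finset.sum_apply] at h2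
    rw [Matrix.mul_apply]
    have h3 : ∑ j, N i j * R j i' = HahnSeries.single (-(n : ℤ)) (1 : F) *
        ∑ j, (f i' j • arcCol n B j) i := by
      rw [Finset.mul_sum]
      refine Finset.sum_congr rfl fun j _ => ?_
      rw [Pi.smul_apply, Algebra.smul_def]
      simp only [N, R, Matrix.of_apply]
      ring
    rw [h3, h2, Matrix.one_apply, Pi.single_apply]
    split_ifs
    · rw [single_mul_single, neg_add_cancel, single_zero_one]
    · rw [mul_zero]
  exact ⟨⟨N, R, hNR, mul_eq_one_comm.1 hNR⟩, fun i j => rfl⟩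

/-- Invertibility of the matrix need not be imposed: it follows from the columns spanning a lattice
of `Gr_(n)`. -/
theorem shiftedArcs_preimage_Theta {n : ℕ} {A : Set (TLattice F d)} (hA : A ⊆ Gr F d n) :
    shiftedArcs n (Theta ⁻¹' A) =
      {B | Submodule.span F⟦X⟧ (Set.range (arcCol n B)) ∈ A} := by
  have hTheta : ∀ (B : Matrix (Fin d) (Fin d) F⟦X⟧) (M : GL (Fin d) F⸨X⸩),
      (∀ i j, (M : Matrix (Fin d) (Fin d) F⸨X⸩) i j = arcCol n B j i) →
      Theta M = Submodule.span F⟦X⟧ (Set.range (arcCol n B)) := by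
    intro B M h
    rw [Theta]
    congr 2
    funext j i
    exact h i j
  ext B
  constructor
  · rintro ⟨M, hM, hB⟩
    change Submodule.span F⟦X⟧ (Set.range (arcCol n B)) ∈ A
    rw [← hTheta B M (map_eq_smul_iff.1 hB)]
    exact hM
  · intro hB
    obtain ⟨M, hM⟩ := exists_unit_of_span_arcCol (hA hB).1
    exact ⟨M, by rw [Set.mem_preimage, hTheta B M hM]; exact hB, map_eq_smul_iff.2 hM⟩

theorem exists_map_eq_of_Theta_mem {n : ℕ} {M : GL (Fin d) F⸨X⸩} (h : Theta M ∈ Gr F d n) :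
    ∃ B : Matrix (Fin d) (Fin d) F⟦X⟧, B.map (algebraMap F⟦X⟧ F⸨X⸩) =
      (HahnSeries.single (n : ℤ) (1 : F) : F⸨X⸩) • (M : Matrix (Fin d) (Fin d) F⸨X⸩) := by
  have h1 : ∀ i j, ∃ g : F⟦X⟧, (M : Matrix (Fin d) (Fin d) F⸨X⸩) i j =
      HahnSeries.single (-(n : ℤ)) (1 : F) * algebraMap F⟦X⟧ F⸨X⸩ g := by
    intro i j
    have hmem : (fun i => (M : Matrix (Fin d) (Fin d) F⸨X⸩) i j) ∈ stdLattice F d (-n) :=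
      h.2 (Submodule.subset_span ⟨j, rfl⟩)
    exact exists_eq_single_mul fun e he => mem_stdLattice_iff.1 hmem (i, e) he
  choose g hg using h1
  exact ⟨Matrix.of g, map_eq_smul_iff.2 hg⟩

theorem truncate_surjective (l : ℕ) :
    Function.Surjective (truncate l : Matrix (Fin d) (Fin d) F⟦X⟧ → _) := by
  intro x
  refine ⟨Matrix.of fun i j => PowerSeries.mk fun e => if h : e < l + 1 then x (i, j, ⟨e, h⟩) else 0,
    ?_⟩
  funext ⟨i, j, e⟩
  rw [truncate, Matrix.of_apply, PowerSeries.coeff_mk, dif_pos e.2]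

end ArcColumns

/-! ### The class of the truncated arcs over a gr-stable set -/

section ArcCells

variable {k : Type u} [Field k] {F : Type u} [Field F] [Algebra k F] {d n : ℕ}

theorem definable_coeffAt_X_pow_smul_liftVec {σ : Type} {w : ℕ} {f : Fin d × Fin w → (σ → F) → F}
    (hf : ∀ p, Definable k (f p)) (l : ℕ) (a : Fin d × ℤ) :
    Definable k fun x => coeffAt a ((PowerSeries.X ^ l : F⟦X⟧) • liftVec n fun p => f p x) := by
  classical
  simp only [coeffAt_X_pow_smul, liftVec, map_sum, map_smul, smul_eq_mul, coeffAt_monoVec]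
  refine .sum _ fun p _ => .mul (hf p) ?_
  split_ifs
  · exact .one
  · exact .zero

/-- A column of a truncated arc. -/
def truncCol {l : ℕ} (x : Fin d × Fin d × Fin (l + 1) → F) (j : Fin d) : Fin d × Fin (l + 1) → F :=
  fun q => x (q.1, j, q.2)

theorem definable_coordAt_truncCol (l : ℕ) (j : Fin d) (p : Fin d × Fin (2 * n)) :
    Definable k fun x : Fin d × Fin d × Fin (2 * n + 1) → F =>
      coordAt n p ((PowerSeries.X ^ l : F⟦X⟧) • liftVec n (truncCol x j)) :=
  definable_coeffAt_X_pow_smul_liftVec (f := fun q x => x (q.1, j, q.2)) (fun _ => .coord _) l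
    (pos n p)

/-- The chart coordinates are the unique solution of a linear system with coefficients read from the
columns; the vectors `liftVec` stand for an arc with the given truncation. -/
theorem exists_chartCoord (I : Finset (Fin d × Fin (2 * n))) :
    ∃ t : (Fin d × Fin d × Fin (2 * n + 1) → F) → I × (Iᶜ : Finset _) → F,
      (∀ p, Definable k fun x => t x p) ∧
      ∀ x c (H : TLattice F d), H.restrictScalars F = chartSpace I c →
        Submodule.span F⟦X⟧ (Set.range fun j => liftVec n (truncCol x j)) = H → t x = c := by
  classical
  let a : (Fin d × Fin (2 * n)) × I → Fin d × Fin (2 * n) →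
      (Fin d × Fin d × Fin (2 * n + 1) → F) → F := fun r p x =>
    coordAt n p ((PowerSeries.X ^ (r.1.2 : ℕ) : F⟦X⟧) • liftVec n (truncCol x r.1.1))
  have ha : ∀ r p, Definable k (a r p) := fun r p => definable_coordAt_truncCol r.1.2 r.1.1 p
  obtain ⟨s, hs, hs'⟩ := Definable.exists_solution (k := k) (τ := I × (Iᶜ : Finset _))
    (fun r q x => if q.1 = r.2 then a r q.2 x else 0) (fun r x => a r r.2 x)
    (fun r q => by
      split_ifs
      · exact ha r q.2
      · exact .zero)
    (fun r => ha r r.2)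
  have hsum : ∀ (b : I × (Iᶜ : Finset _) → F) (p : I) (v : LaurentSpace F d),
      (∑ q : I × (Iᶜ : Finset _), (if q.1 = p then coordAt n q.2 v else 0) * b q) =
        ∑ q : (Iᶜ : Finset _), b (p, q) * coordAt n q v := by
    intro b p v
    rw [Fintype.sum_prod_type, Finset.sum_eq_single p]
    · simp [mul_comm]
    · intro p' _ hp'
      simp [hp']
    · simp
  refine ⟨fun x p => s p x, hs, fun x c H h hw => ?_⟩
  have hsol := hs' x ⟨c, fun ⟨⟨j, l⟩, p⟩ => by
    rw [hsum]
    have hmem : (PowerSeries.X ^ (l : ℕ) : F⟦X⟧) • liftVec n (truncCol x j) ∈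
        H.restrictScalars F := by
      refine H.smul_mem _ ?_
      rw [← hw]
      exact Submodule.subset_span ⟨j, rfl⟩
    rw [h] at hmem
    exact (hmem.2 p).symm⟩
  refine chartCoord_unique h hw fun j l hl p => ?_
  have := hsol ((j, ⟨l, hl⟩), p)
  rw [hsum (fun q => s q x)] at this
  exact this.symm

/-- The condition that the columns `y` generate the lattice with coordinates `c` in a chart. -/
def IsGenerating (I : Finset (Fin d × Fin (2 * n))) (c : I × (Iᶜ : Finset _) → F)
    (y : Fin d → Fin d × Fin (2 * n + 1) → F) : Prop :=
  IsFrame (Fintype.card (Iᶜ : Finset _))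
    (fun r => window n (2 * n + 1) (chartVec I c n (2 * n + 1) r))
    (fun q => window n (2 * n + 1) (mulX F d (chartGen I c q))) y

theorem definable_window_mulX_chartGen (I : Finset (Fin d × Fin (2 * n))) (q : (Iᶜ : Finset _))
    (p : Fin d × Fin (2 * n + 1)) : Definable k fun c : I × (Iᶜ : Finset _) → F =>
      window n (2 * n + 1) (mulX F d (chartGen I c q)) p := by
  simp only [window_apply, coeffAt_mulX]
  exact definable_coeffAt_chartVec k 0 0 _ (Sum.inl q)

variable [IsAlgClosed F]

/-- Frames for the pair `tH ⊆ H` modulo `tⁿ⁺¹`, of dimensions `|Iᶜ|` and `|Iᶜ| + d`. -/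
theorem affineClass_isGenerating {A : Set (TLattice F d)} {I : Finset (Fin d × Fin (2 * n))}
    {X : Set (I × (Iᶜ : Finset _) → F)} (hX : IsCons k X)
    (hXA : ∀ c ∈ X, ∃ H ∈ A, H.restrictScalars F = chartSpace I c) :
    IsCons k {y : (I × (Iᶜ : Finset _)) ⊕ (Fin d × (Fin d × Fin (2 * n + 1))) → F |
      y ∘ Sum.inl ∈ X ∧ IsGenerating I (y ∘ Sum.inl) fun j q => y (Sum.inr (j, q))} ∧
    affineClass k {y : (I × (Iᶜ : Finset _)) ⊕ (Fin d × (Fin d × Fin (2 * n + 1))) → F |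
      y ∘ Sum.inl ∈ X ∧ IsGenerating I (y ∘ Sum.inl) fun j q => y (Sum.inr (j, q))} =
      affineClass k X * ∏ j ∈ Finset.range d,
        (lefschetz k ^ (Fintype.card (Iᶜ : Finset _) + d) -
          lefschetz k ^ (Fintype.card (Iᶜ : Finset _) + j)) := by
  refine affineClass_isFrame (fun r c => window n (2 * n + 1) (chartVec I c n (2 * n + 1) r))
    (fun r p => definable_coeffAt_chartVec k _ _ _ _)
    (fun q c => window n (2 * n + 1) (mulX F d (chartGen I c q)))
    (definable_window_mulX_chartGen I) hX _ _ (fun c _ => ?_) (fun c _ => ?_) (fun c hc => ?_) d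
  · rw [← map_window_chartSpace, finrank_map_window_chartSpace, mul_one]
  · rw [← map_window_mulX_chartSpace, finrank_map_window_mulX_chartSpace]
  · obtain ⟨H, -, hH⟩ := hXA c hc
    rw [← map_window_chartSpace, ← map_window_mulX_chartSpace]
    exact map_window_mulX_le hH

/-- The truncated arcs whose columns generate a lattice with coordinates in `X`. -/
def arcCell (I : Finset (Fin d × Fin (2 * n))) (X : Set (I × (Iᶜ : Finset _) → F)) :
    Set (Fin d × Fin d × Fin (2 * n + 1) → F) :=
  {x | ∃ c ∈ X, IsGenerating I c (truncCol x)}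

omit [IsAlgClosed F] in
theorem truncate_mem_arcCell_iff {A : Set (TLattice F d)} {I : Finset (Fin d × Fin (2 * n))}
    {X : Set (I × (Iᶜ : Finset _) → F)}
    (hXA : ∀ c ∈ X, ∃ H ∈ A, H.restrictScalars F = chartSpace I c)
    {B : Matrix (Fin d) (Fin d) F⟦X⟧} :
    truncate (2 * n) B ∈ arcCell I X ↔ ∃ c ∈ X, ∃ H ∈ A, H.restrictScalars F = chartSpace I c ∧
      Submodule.span F⟦X⟧ (Set.range (arcCol n B)) = H := by
  have hcol : truncCol (truncate (2 * n) B) = fun j => window n (2 * n + 1) (arcCol n B j) :=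
    funext fun j => (window_arcCol n (2 * n) B j).symm
  refine exists_congr fun c => and_congr_right fun hc => ?_
  rw [hcol]
  constructor
  · intro h
    obtain ⟨H, hHA, hH⟩ := hXA c hc
    exact ⟨H, hHA, hH, (span_eq_iff_isFrame hH (arcCol_mem n B)).2 h⟩
  · rintro ⟨H, -, hH, hspan⟩
    exact (span_eq_iff_isFrame hH (arcCol_mem n B)).1 hspan

/-- The columns determine the lattice, hence its coordinates, in a definable way; so forgetting the
coordinates in the pairs (coordinates, generating columns) is a definable bijection onto the cell.
-/
theorem affineClass_arcCell {A : Set (TLattice F d)} {I : Finset (Fin d × Fin (2 * n))}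
    {X : Set (I × (Iᶜ : Finset _) → F)} (hX : IsCons k X)
    (hXA : ∀ c ∈ X, ∃ H ∈ A, H.restrictScalars F = chartSpace I c) :
    IsCons k (arcCell I X) ∧ affineClass k (arcCell I X) =
      affineClass k X * ∏ j ∈ Finset.range d,
        (lefschetz k ^ (Fintype.card (Iᶜ : Finset _) + d) -
          lefschetz k ^ (Fintype.card (Iᶜ : Finset _) + j)) := by
  obtain ⟨t, ht, ht'⟩ := exists_chartCoord (k := k) (F := F) I
  obtain ⟨hE, hcls⟩ := affineClass_isGenerating hX hXA
  let f : (Fin d × Fin d × Fin (2 * n + 1) → F) →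
      (I × (Iᶜ : Finset _)) ⊕ (Fin d × (Fin d × Fin (2 * n + 1))) → F :=
    fun x => Sum.elim (t x) fun p => x (p.2.1, p.1, p.2.2)
  let g : ((I × (Iᶜ : Finset _)) ⊕ (Fin d × (Fin d × Fin (2 * n + 1))) → F) →
      Fin d × Fin d × Fin (2 * n + 1) → F := fun y p => y (Sum.inr (p.2.1, p.1, p.2.2))
  have hf : ∀ j, Definable k fun x => f x j := by
    rintro (p | p)
    · exact ht p
    · exact .coord _
  have key : ∀ x, ∀ c ∈ X, IsGenerating I c (truncCol x) → t x = c := by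
    intro x c hc hgen
    obtain ⟨H, -, hH⟩ := hXA c hc
    refine ht' x c H hH ((span_eq_iff_isFrame hH fun j => liftVec_mem n _).2 ?_)
    simp only [window_liftVec]
    exact hgen
  have hpre : arcCell I X = f ⁻¹' {y | y ∘ Sum.inl ∈ X ∧
      IsGenerating I (y ∘ Sum.inl) fun j q => y (Sum.inr (j, q))} := by
    ext x
    constructor
    · rintro ⟨c, hc, hgen⟩
      have htx := key x c hc hgen
      change t x ∈ X ∧ IsGenerating I (t x) (truncCol x)
      rw [htx]
      exact ⟨hc, hgen⟩
    · intro hx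
      exact ⟨t x, hx.1, hx.2⟩
  have hcons : IsCons k (arcCell I X) := by
    rw [hpre]
    exact hE.preimage hf
  refine ⟨hcons, ?_⟩
  rw [← hcls]
  refine affineClass_eq_of_bijOn hcons hE f g hf (fun _ => .coord _) (fun x hx => ⟨?_, rfl⟩)
    fun y hy => ?_
  · rw [hpre] at hx
    exact hx
  · have hy2 : IsGenerating I (y ∘ Sum.inl) (truncCol (g y)) := hy.2
    refine ⟨⟨_, hy.1, hy2⟩, ?_⟩
    funext p
    rcases p with p | p
    · exact congrFun (key _ _ hy.1 hy2) p
    · rfl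

/-- The truncated arcs whose columns generate a lattice of a gr-stable set. -/
theorem exists_truncated_arcs {A : Set (TLattice F d)} (hA : A ⊆ Gr F d n)
    {X : ∀ I : Finset (Fin d × Fin (2 * n)), Set (I × (Iᶜ : Finset _) → F)}
    (h : IsPresentation k (grChart F d n) (asSets A) (fun I => I) X) :
    ∃ C : Set (Fin d × Fin d × Fin (2 * n + 1) → F), IsCons k C ∧
      shiftedArcs n (Theta ⁻¹' A) = truncate (2 * n) ⁻¹' C ∧
      affineClass k C = ∑ I : Finset (Fin d × Fin (2 * n)),
        affineClass k (X I) * ∏ j ∈ Finset.range d,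
          (lefschetz k ^ (Fintype.card (Iᶜ : Finset _) + d) -
            lefschetz k ^ (Fintype.card (Iᶜ : Finset _) + j)) := by
  have hXA : ∀ I, ∀ c ∈ X I, ∃ H ∈ A, H.restrictScalars F = chartSpace I c := by
    intro I c hc
    obtain ⟨H, hH, hHc, -⟩ := h.index_eq hA hc
    exact ⟨H, hH, coe_eq_grChart.1 hHc⟩
  have hcell := fun I => affineClass_arcCell (h.isCons I) (hXA I)
  refine ⟨⋃ I, arcCell I (X I), .iUnion fun I => (hcell I).1, ?_, ?_⟩
  · rw [shiftedArcs_preimage_Theta hA]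
    ext B
    simp only [Set.preimage_iUnion, Set.mem_iUnion, Set.mem_preimage]
    constructor
    · intro hB
      have h1 : ((Submodule.span F⟦X⟧ (Set.range (arcCol n B)) : TLattice F d) :
          Set (LaurentSpace F d)) ∈ asSets A := ⟨_, hB, rfl⟩
      rw [h.eq] at h1
      obtain ⟨I, c, hc, hcH⟩ := Set.mem_iUnion.1 h1
      exact ⟨I, (truncate_mem_arcCell_iff (hXA I)).2
        ⟨c, hc, _, hB, coe_eq_grChart.1 hcH.symm, rfl⟩⟩
    · rintro ⟨I, hI⟩
      obtain ⟨c, -, H, hHA, -, rfl⟩ := (truncate_mem_arcCell_iff (hXA I)).1 hI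
      exact hHA
  · rw [affineClass_iUnion fun I => (hcell I).1]
    · exact Finset.sum_congr rfl fun I _ => (hcell I).2
    -- A truncated arc in two cells lifts to an arc, whose columns span one lattice lying in two
    -- disjoint pieces of the presentation.
    · intro I I' hne
      rw [Set.disjoint_left]
      intro x hx hx'
      obtain ⟨B, rfl⟩ := truncate_surjective (2 * n) x
      obtain ⟨c, hc, H, -, hH, rfl⟩ := (truncate_mem_arcCell_iff (hXA I)).1 hx
      obtain ⟨c', hc', H', -, hH', rfl⟩ := (truncate_mem_arcCell_iff (hXA I')).1 hx'
      refine Set.disjoint_left.1 (h.disjoint hne) ⟨c, hc, rfl⟩ ⟨c', hc', ?_⟩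
      rw [← coe_eq_grChart.2 hH, ← coe_eq_grChart.2 hH']

end ArcCells

/-! ### Powers of the Lefschetz class -/

section LefschetzPowers

variable (k : Type u) [Field k]

theorem lefPow_add (m n : ℤ) : lefPow k (m + n) = lefPow k m * lefPow k n := by
  rw [lefPow, zpow_add, Units.val_mul, lefPow, lefPow]

theorem lefPow_zero : lefPow k 0 = 1 := by
  rw [lefPow, zpow_zero, Units.val_one]

theorem lefPow_natCast (n : ℕ) : lefPow k n =
    algebraMap (GrothendieckRing k) (GrothendieckRingLoc k) (lefschetz k ^ n) := by
  rw [lefPow, zpow_natCast, Units.val_pow_eq_pow_val, map_pow]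
  rfl

theorem lefPow_mul_natCast (m : ℤ) (n : ℕ) : lefPow k (m * n) = lefPow k m ^ n := by
  rw [lefPow, zpow_mul, zpow_natCast, Units.val_pow_eq_pow_val, lefPow]

theorem prod_Icc_one_eq {R : Type*} [CommMonoid R] (f : ℕ → R) (d : ℕ) :
    ∏ i ∈ Finset.Icc 1 d, f i = ∏ j ∈ Finset.range d, f (j + 1) := by
  induction d with
  | zero => simp
  | succ d ih => rw [Finset.prod_Icc_succ_top (by omega), ih, Finset.prod_range_succ]

/-- Factor `𝐋^(r+d)` out of each of the `d` terms; the factor of index `j` leaves `1 - 𝐋^(-(d-j))`,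
and the order of the factors is then reversed. -/
theorem algebraMap_prod_frames (r d : ℕ) :
    algebraMap (GrothendieckRing k) (GrothendieckRingLoc k)
      (∏ j ∈ Finset.range d, (lefschetz k ^ (r + d) - lefschetz k ^ (r + j))) =
      lefPow k (((r : ℤ) + d) * d) * ∏ i ∈ Finset.Icc 1 d, (1 - lefPow k (-(i : ℤ))) := by
  rw [map_prod, prod_Icc_one_eq, lefPow_mul_natCast, ← Finset.prod_range_reflect]
  have h : lefPow k ((r : ℤ) + d) ^ d = ∏ _j ∈ Finset.range d, lefPow k ((r : ℤ) + d) := by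
    rw [Finset.prod_const, Finset.card_range]
  rw [h, ← Finset.prod_mul_distrib]
  refine Finset.prod_congr rfl fun j hj => ?_
  have hj' := Finset.mem_range.1 hj
  rw [map_sub, ← lefPow_natCast, ← lefPow_natCast, mul_sub, mul_one, ← lefPow_add]
  congr 2
  push_cast
  omega

end LefschetzPowers

/-! ### Well-definedness of the arc measure and comparison of the two measures -/

section ArcMeasure

variable (k : Type u) [Field k] {F : Type u} [Field F] [Algebra k F] {d : ℕ}

/-- `c` is the measure of `A`, computed from `t ^ N A` and its truncation at level `l`. -/
def HasArcMeasure (N l : ℕ) (A : Set (GL (Fin d) F⸨X⸩)) (c : GrothendieckRingLoc k) : Prop :=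
  (∀ M ∈ A, ∃ B : Matrix (Fin d) (Fin d) F⟦X⟧, B.map (algebraMap F⟦X⟧ F⸨X⸩) =
    (HahnSeries.single (N : ℤ) (1 : F) : F⸨X⸩) • (M : Matrix (Fin d) (Fin d) F⸨X⸩)) ∧
  ∃ C : Set (Fin d × Fin d × Fin (l + 1) → F), IsCons k C ∧
    shiftedArcs N A = truncate l ⁻¹' C ∧
    c = lefPow k ((d : ℤ) ^ 2 * N) *
      algebraMap (GrothendieckRing k) (GrothendieckRingLoc k) (affineClass k C) *
      lefPow k (-(((l : ℤ) + 1) * (d : ℤ) ^ 2))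

variable {k}

theorem HasArcMeasure.unique {N l : ℕ} {A : Set (GL (Fin d) F⸨X⸩)} {c c' : GrothendieckRingLoc k}
    (h : HasArcMeasure k N l A c) (h' : HasArcMeasure k N l A c') : c = c' := by
  obtain ⟨-, C, -, hC, rfl⟩ := h
  obtain ⟨-, C', -, hC', rfl⟩ := h'
  have : C = C' := Set.preimage_injective.2 (truncate_surjective l) (hC.symm.trans hC')
  rw [this]

/-- The coordinates of a truncated arc, those of the last coefficient being split off. -/
def lastCoeffEquiv (d l : ℕ) :
    (Fin d × Fin d × Fin (l + 1)) ⊕ (Fin d × Fin d) ≃ Fin d × Fin d × Fin (l + 1 + 1) :=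
  Equiv.ofBijective (Sum.elim (fun p => (p.1, p.2.1, p.2.2.castSucc))
    fun p => (p.1, p.2, Fin.last (l + 1))) (by
    constructor
    · rintro (⟨i, j, e⟩ | ⟨i, j⟩) (⟨i', j', e'⟩ | ⟨i', j'⟩) h <;>
        simp_all [Fin.castSucc_ne_last, (Fin.castSucc_ne_last _).symm]
    · rintro ⟨i, j, e⟩
      induction e using Fin.lastCases with
      | last => exact ⟨Sum.inr (i, j), rfl⟩
      | cast e => exact ⟨Sum.inl (i, j, e), rfl⟩)

variable [IsAlgClosed F]

/-- One more level adds `d²` free coordinates, compensated by the normalising power of `𝐋`. -/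
theorem HasArcMeasure.succ_level {N l : ℕ} {A : Set (GL (Fin d) F⸨X⸩)}
    {c : GrothendieckRingLoc k} (h : HasArcMeasure k N l A c) :
    HasArcMeasure k N (l + 1) A c := by
  obtain ⟨hA, C, hC, hAC, rfl⟩ := h
  have hP := hC.prod_univ (τ := Fin d × Fin d)
  have hcls := affineClass_prod (τ := Fin d × Fin d) hC
  rw [← affineClass_reindex hP (lastCoeffEquiv d l)] at hcls
  refine ⟨hA, _, hP.preimage (f := fun y => y ∘ lastCoeffEquiv d l) fun _ => .coord _, hAC, ?_⟩
  have hcls' : affineClass k ((fun y => y ∘ lastCoeffEquiv d l) ⁻¹'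
      {y : (Fin d × Fin d × Fin (l + 1)) ⊕ (Fin d × Fin d) → F | y ∘ Sum.inl ∈ C}) =
      affineClass k C * lefschetz k ^ (d * d) := by
    refine Eq.trans hcls ?_
    simp
  rw [hcls', map_mul, ← lefPow_natCast]
  have h1 : lefPow k (-(((l : ℤ) + 1) * (d : ℤ) ^ 2)) = lefPow k ((d * d : ℕ) : ℤ) *
      lefPow k (-((((l + 1 : ℕ) : ℤ) + 1) * (d : ℤ) ^ 2)) := by
    rw [← lefPow_add]
    congr 1
    push_cast
    ring
  rw [h1]
  ring

/-- Multiplication by `t` identifies the truncations of `t^N A` at level `l` with those of `t^(N+1)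
A` at level `l + 1`, and the two normalising powers of `𝐋` change by opposite amounts. -/
theorem HasArcMeasure.succ_succ {N l : ℕ} {A : Set (GL (Fin d) F⸨X⸩)}
    {c : GrothendieckRingLoc k} (h : HasArcMeasure k N l A c) :
    HasArcMeasure k (N + 1) (l + 1) A c := by
  obtain ⟨hA, C, hC, hAC, rfl⟩ := h
  have hX : ∀ (B : Matrix (Fin d) (Fin d) F⟦X⟧) (M : Matrix (Fin d) (Fin d) F⸨X⸩),
      ((PowerSeries.X : F⟦X⟧) • B).map (algebraMap F⟦X⟧ F⸨X⸩) =
        (HahnSeries.single ((N + 1 : ℕ) : ℤ) (1 : F) : F⸨X⸩) • M ↔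
      B.map (algebraMap F⟦X⟧ F⸨X⸩) = (HahnSeries.single (N : ℤ) (1 : F) : F⸨X⸩) • M := by
    intro B M
    rw [map_eq_smul_iff, map_eq_smul_iff]
    have : ∀ i j, arcCol (N + 1) ((PowerSeries.X : F⟦X⟧) • B) j i = arcCol N B j i := by
      intro i j
      have hXs : algebraMap F⟦X⟧ F⸨X⸩ PowerSeries.X = HahnSeries.single 1 1 := PowerSeries.coe_X
      have hN : -((N + 1 : ℕ) : ℤ) + 1 = -N := by
        push_cast
        ring
      rw [arcCol, arcCol, Matrix.smul_apply, smul_eq_mul, map_mul, ← mul_assoc, hXs,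
        single_mul_single, hN]
    simp only [this]
  -- Multiplication by `t` on truncated arcs, which inserts a zero constant coefficient; `g` shifts
  -- the coefficients back.
  let f : (Fin d × Fin d × Fin (l + 1) → F) → Fin d × Fin d × Fin (l + 1 + 1) → F :=
    fun x p => Fin.cases (motive := fun _ => F) 0 (fun e => x (p.1, p.2.1, e)) p.2.2
  let g : (Fin d × Fin d × Fin (l + 1 + 1) → F) → Fin d × Fin d × Fin (l + 1) → F :=
    fun y p => y (p.1, p.2.1, p.2.2.succ)
  have hf : ∀ p, Definable k fun x => f x p := by
    rintro ⟨i, j, e⟩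
    cases e using Fin.cases with
    | zero => exact .zero
    | succ e => exact .coord _
  have hg : ∀ p, Definable k fun y => g y p := fun p => .coord _
  let C' : Set (Fin d × Fin d × Fin (l + 1 + 1) → F) :=
    {y | (∀ p : Fin d × Fin d, y (p.1, p.2, 0) = 0) ∧ g y ∈ C}
  have hC' : IsCons k C' :=
    .setOf_and (.setOf_forall fun p => (Definable.coord _).isCons_eq_zero) (hC.preimage hg)
  have hfg : ∀ y ∈ C', f (g y) = y := by
    intro y hy
    funext ⟨i, j, e⟩
    cases e using Fin.cases with
    | zero => exact (hy.1 (i, j)).symm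
    | succ e => rfl
  have hcls : affineClass k C = affineClass k C' :=
    affineClass_eq_of_bijOn hC hC' f g hf hg (fun x hx => ⟨⟨fun _ => rfl, hx⟩, rfl⟩)
      fun y hy => ⟨hy.2, hfg y hy⟩
  have hgX : ∀ B : Matrix (Fin d) (Fin d) F⟦X⟧,
      g (truncate (l + 1) ((PowerSeries.X : F⟦X⟧) • B)) = truncate l B := by
    intro B
    funext p
    simp only [g, truncate, Matrix.smul_apply, smul_eq_mul, Fin.val_succ,
      PowerSeries.coeff_succ_X_mul]
  refine ⟨fun M hM => ?_, C', hC', ?_, ?_⟩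
  · obtain ⟨B, hB⟩ := hA M hM
    exact ⟨_, (hX B _).2 hB⟩
  · ext B
    constructor
    · rintro ⟨M, hM, hB⟩
      obtain ⟨B', hB'⟩ := hA M hM
      have hBB' : B = (PowerSeries.X : F⟦X⟧) • B' :=
        Matrix.map_injective (IsFractionRing.injective F⟦X⟧ F⸨X⸩) (hB.trans ((hX B' _).2 hB').symm)
      subst hBB'
      refine ⟨fun p => ?_, ?_⟩
      · simp [truncate]
      · rw [hgX]
        have : B' ∈ shiftedArcs N A := ⟨M, hM, hB'⟩
        rw [hAC] at this
        exact this
    · rintro ⟨h0, hB⟩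
      have hdvd : ∀ i j, ∃ b, B i j = PowerSeries.X * b := fun i j =>
        PowerSeries.X_dvd_iff.2 (by simpa [truncate] using h0 (i, j))
      choose B' hB' using hdvd
      have hBB' : B = (PowerSeries.X : F⟦X⟧) • Matrix.of B' := Matrix.ext hB'
      rw [hBB', hgX] at hB
      have hmem : Matrix.of B' ∈ shiftedArcs N A := by
        rw [hAC]
        exact hB
      obtain ⟨M, hM, h⟩ := hmem
      exact ⟨M, hM, by rw [hBB']; exact (hX _ _).2 h⟩
  · rw [hcls]
    have h1 : lefPow k ((d : ℤ) ^ 2 * ((N + 1 : ℕ) : ℤ)) =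
        lefPow k ((d : ℤ) ^ 2 * N) * lefPow k ((d : ℤ) ^ 2) := by
      rw [← lefPow_add, Nat.cast_succ, mul_add_one]
    have h2 : lefPow k (-(((l : ℤ) + 1) * (d : ℤ) ^ 2)) = lefPow k ((d : ℤ) ^ 2) *
        lefPow k (-((((l + 1 : ℕ) : ℤ) + 1) * (d : ℤ) ^ 2)) := by
      rw [← lefPow_add]
      congr 1
      push_cast
      ring
    rw [h1, h2]
    ring

theorem HasArcMeasure.add {N l : ℕ} {A : Set (GL (Fin d) F⸨X⸩)}
    {c : GrothendieckRingLoc k} (h : HasArcMeasure k N l A c) (a b : ℕ) :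
    HasArcMeasure k (N + a) (l + a + b) A c := by
  have h1 : HasArcMeasure k (N + a) (l + a) A c := by
    induction a with
    | zero => exact h
    | succ a ih => exact ih.succ_succ
  induction b with
  | zero => exact h1
  | succ b ih => exact ih.succ_level

/-- From `(N, l)` and from `(N', l')` one reaches the common pair `(N + N', l + l' + N + N')` by the
two elementary moves. -/
theorem HasArcMeasure.eq {N l N' l' : ℕ} {A : Set (GL (Fin d) F⸨X⸩)}
    {c c' : GrothendieckRingLoc k} (h : HasArcMeasure k N l A c) (h' : HasArcMeasure k N' l' A c') :
    c = c' := by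
  have h1 := h.add N' (l' + N)
  have h2 := h'.add N (l + N')
  have e1 : N' + N = N + N' := add_comm _ _
  have e2 : l' + N + (l + N') = l + N' + (l' + N) := by ring
  rw [e1, e2] at h2
  exact h1.unique h2

omit [IsAlgClosed F] in
theorem HasArcMeasure.isCylindrical {N l : ℕ} {A : Set (GL (Fin d) F⸨X⸩)}
    {c : GrothendieckRingLoc k} (h : HasArcMeasure k N l A c) : IsCylindrical k N l A := by
  obtain ⟨hA, C, hC, hAC, -⟩ := h
  refine ⟨hA, C, ⟨fun x _ => Set.mem_iUnion.2 ⟨(), x, rfl⟩, fun _ => ?_⟩, hAC⟩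
  exact hC

theorem HasArcMeasure.arcMeasure_eq {N l : ℕ} {A : Set (GL (Fin d) F⸨X⸩)}
    {c : GrothendieckRingLoc k} (h : HasArcMeasure k N l A c) : arcMeasure k A = c := by
  classical
  have hex : ∃ p : ℕ × ℕ, IsCylindrical k p.1 p.2 A := ⟨(N, l), h.isCylindrical⟩
  rw [arcMeasure, dif_pos hex]
  obtain ⟨hA, C, hC, hAC⟩ := hex.choose_spec
  have hC' : IsCons k C := hC.2 ()
  refine HasArcMeasure.eq (N := hex.choose.1) (l := hex.choose.2) ⟨hA, C, hC', hAC, ?_⟩ h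
  rw [hAC, Set.image_preimage_eq _ (truncate_surjective _), setClass_affineChart hC']

/-- The comparison of measures is checked chart by chart: the frame product gives the factors `1 -
𝐋⁻ⁱ` and a power of `𝐋`. -/
theorem hasArcMeasure_preimage_Theta {n : ℕ} {A : Set (TLattice F d)} (hA : GrStable k n A) :
    HasArcMeasure k n (2 * n) (Theta ⁻¹' A)
      ((∏ i ∈ Finset.Icc 1 d, (1 - lefPow k (-(i : ℤ)))) * grMeasure k A) := by
  obtain ⟨X, hX⟩ := hA.exists_presentation
  obtain ⟨C, hC, hAC, hcls⟩ := exists_truncated_arcs hA.1 hX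
  refine ⟨fun M hM => exists_map_eq_of_Theta_mem (hA.1 hM), C, hC, hAC, ?_⟩
  rw [grMeasure_eq_sum hA hX, hcls, map_sum, Finset.mul_sum, Finset.mul_sum, Finset.sum_mul]
  refine Finset.sum_congr rfl fun I _ => ?_
  rw [map_mul, algebraMap_prod_frames]
  -- Bookkeeping of exponents: with `r = |Iᶜ|`, `d²n + (r + d)d - (2n + 1)d² = -(nd - r)d`.
  have h1 : lefPow k (-(((n : ℤ) * d - Fintype.card (Iᶜ : Finset _)) * d)) =
      lefPow k ((d : ℤ) ^ 2 * n) * lefPow k (((Fintype.card (Iᶜ : Finset _) : ℤ) + d) * d) *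
        lefPow k (-((((2 * n : ℕ) : ℤ) + 1) * (d : ℤ) ^ 2)) := by
    rw [← lefPow_add, ← lefPow_add]
    congr 1
    push_cast
    ring
  rw [h1]
  ring

theorem map_eq_prod_inverse_mul {R S ι : Type*} [CommRing R] [CommRing S] (f : R →+* S)
    (s : Finset ι) (a : ι → R) (ha : ∀ i ∈ s, IsUnit (f (a i))) {x y : R}
    (h : y = (∏ i ∈ s, a i) * x) : f x = (∏ i ∈ s, Ring.inverse (f (a i))) * f y := by
  rw [h, map_mul, map_prod, ← mul_assoc, ← Finset.prod_mul_distrib,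
    Finset.prod_eq_one fun i hi => Ring.inverse_mul_cancel _ (ha i hi), one_mul]

end ArcMeasure

/-! ### Nilpotence of `t` on finite-dimensional quotients -/

section PowerSeriesActions

variable {k : Type u} [Field k] {K : Type v} [Field K] [Algebra k K] [FiniteDimensional k K]

/-- As `t` lies in the Jacobson radical of `k[[t]]`, Nakayama makes the images of the powers of `t`
decrease strictly until they vanish, and the dimension over `K` bounds the number of steps. -/
theorem map_X_pow_eq_zero {Q : Type w} [AddCommGroup Q] [Module k Q] [Module K Q]
    [IsScalarTower k K Q] [Module.Finite K Q] (ρ : k⟦X⟧ →ₐ[k] Module.End K Q) {n : ℕ}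
    (hn : Module.finrank K Q ≤ n) : ρ PowerSeries.X ^ n = 0 := by
  let _ : Module k⟦X⟧ Q := Module.compHom Q (ρ : k⟦X⟧ →+* Module.End K Q)
  have hsmul : ∀ (a : k⟦X⟧) (x : Q), a • x = ρ a x := fun _ _ => rfl
  have : IsScalarTower k k⟦X⟧ Q := ⟨fun c a x => by
    rw [hsmul, hsmul, map_smul, LinearMap.smul_apply]⟩
  have : Module.Finite k Q := Module.Finite.trans K Q
  have : Module.Finite k⟦X⟧ Q := Module.Finite.of_restrictScalars_finite k k⟦X⟧ Q
  by_contra hne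
  set φ := ρ PowerSeries.X with hφ
  have hsub : ∀ i, LinearMap.range (φ ^ (i + 1)) ≤ LinearMap.range (φ ^ i) := by
    rintro i _ ⟨x, rfl⟩
    exact ⟨φ x, by rw [pow_succ]; rfl⟩
  have hlt : ∀ i ≤ n, LinearMap.range (φ ^ (i + 1)) < LinearMap.range (φ ^ i) := by
    intro i hi
    refine lt_of_le_of_ne (hsub i) fun heq => ?_
    -- The image of `φ ^ i` as a `k[[t]]`-module; if the chain stops at `i` it satisfies `N ⊆ tN`,
    -- so it is zero.
    let N : Submodule k⟦X⟧ Q :=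
      { (LinearMap.range (φ ^ i)).toAddSubmonoid with
        smul_mem' := by
          rintro a _ ⟨x, rfl⟩
          refine ⟨a • x, ?_⟩
          rw [hsmul, hsmul, hφ, ← map_pow, ← Module.End.mul_apply, ← Module.End.mul_apply,
            ← map_mul, ← map_mul, mul_comm] }
    have hN : N = ⊥ := by
      refine Submodule.eq_bot_of_le_smul_of_le_jacobson_bot (Ideal.span {(PowerSeries.X : k⟦X⟧)}) N
        (IsNoetherian.noetherian N) (fun x hx => ?_) ?_
      · have hx' : x ∈ LinearMap.range (φ ^ (i + 1)) := heq ▸ hx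
        obtain ⟨y, rfl⟩ := hx'
        rw [pow_succ', Module.End.mul_apply, hφ, ← hsmul]
        exact Submodule.smul_mem_smul (Ideal.mem_span_singleton_self _) ⟨y, rfl⟩
      · rw [IsLocalRing.jacobson_eq_maximalIdeal _ bot_ne_top,
          ← PowerSeries.maximalIdeal_eq_span_X]
    apply hne
    rw [← Nat.sub_add_cancel hi, pow_add]
    have h0 : φ ^ i = 0 := by
      ext x
      have hx : (φ ^ i) x ∈ N := ⟨x, rfl⟩
      rw [hN] at hx
      exact (Submodule.mem_bot _).1 hx
    rw [h0, mul_zero]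
  have hdim : ∀ i ≤ n + 1, Module.finrank K (LinearMap.range (φ ^ i)) + i ≤ n := by
    intro i
    induction i with
    | zero => exact fun _ => (Submodule.finrank_le _).trans hn
    | succ i ih =>
      intro hi
      have := Submodule.finrank_lt_finrank_of_lt (hlt i (by omega))
      have := ih (by omega)
      omega
  have := hdim (n + 1) le_rfl
  omega

variable {V : Type w} [AddCommGroup V] [Module k V] [Module K V] [IsScalarTower k K V]

theorem map_X_pow_apply_mem (ρ : k⟦X⟧ →ₐ[k] Module.End K V) {A B : Submodule K V}
    (hA : ∀ a, ∀ x ∈ A, ρ a x ∈ A) (hB : ∀ a, ∀ x ∈ B, ρ a x ∈ B)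
    (hfin : Module.Finite K (A ⧸ B.submoduleOf A)) {n : ℕ} (hn : relDim K A B ≤ n) :
    ∀ x ∈ A, ρ (PowerSeries.X ^ n) x ∈ B := by
  have hB' : ∀ a, B.submoduleOf A ≤ (B.submoduleOf A).comap ((ρ a).restrict (hA a)) :=
    fun a x hx => hB a _ hx
  let ρQ : k⟦X⟧ →ₐ[k] Module.End K (A ⧸ B.submoduleOf A) := AlgHom.ofLinearMap
    { toFun := fun a => (B.submoduleOf A).mapQ (B.submoduleOf A) ((ρ a).restrict (hA a)) (hB' a)
      map_add' := fun a b => by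
        ext x
        simp only [LinearMap.comp_apply, LinearMap.add_apply, Submodule.mkQ_apply,
          Submodule.mapQ_apply, ← Submodule.Quotient.mk_add]
        congr 1
        exact Subtype.ext (by simp)
      map_smul' := fun c a => by
        ext x
        simp only [LinearMap.comp_apply, LinearMap.smul_apply, Submodule.mkQ_apply,
          Submodule.mapQ_apply, ← Submodule.Quotient.mk_smul]
        congr 1
        exact Subtype.ext (by simp) }
    (by
      ext x
      simp only [LinearMap.coe_mk, AddHom.coe_mk, LinearMap.comp_apply, Submodule.mkQ_apply,
        Submodule.mapQ_apply, Module.End.one_apply]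
      congr 1
      exact Subtype.ext (by simp))
    (fun a b => by
      ext x
      simp only [LinearMap.coe_mk, AddHom.coe_mk, LinearMap.comp_apply, Submodule.mkQ_apply,
        Submodule.mapQ_apply, Module.End.mul_apply]
      congr 1
      exact Subtype.ext (by simp))
  intro x hx
  have h := map_X_pow_eq_zero ρQ hn
  rw [← map_pow] at h
  have h1 := LinearMap.congr_fun h ((B.submoduleOf A).mkQ ⟨x, hx⟩)
  have h2 : ρQ (PowerSeries.X ^ n) ((B.submoduleOf A).mkQ ⟨x, hx⟩) =
      (B.submoduleOf A).mkQ ⟨ρ (PowerSeries.X ^ n) x, hA _ x hx⟩ := rfl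
  rw [h2, LinearMap.zero_apply, Submodule.mkQ_apply, Submodule.Quotient.mk_eq_zero] at h1
  exact h1

end PowerSeriesActions

/-! ### Codimension in terms of ranks, and extension of scalars -/

section Codimension

variable {K : Type*} {V W W' : Type*} [Field K] [AddCommGroup V] [Module K V] [AddCommGroup W]
  [Module K W] [AddCommGroup W'] [Module K W']

/-- The rank of `f(A ∩ B)` is eliminated: it is `rk f(B) - rk g(B)`, because `g` kills `A` and is
injective on `B / (A ∩ B)`. What remains are ranks of images of `A` and of `B` separately, which
behave well under extension of scalars. -/
theorem commCodim_add_finrank (A B : Submodule K V) (f : V →ₗ[K] W) (g : V →ₗ[K] W')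
    [FiniteDimensional K W] [FiniteDimensional K W'] (hA : A ⊓ LinearMap.ker f ≤ B)
    (hB : B ⊓ LinearMap.ker f ≤ A) (hg : B ⊓ LinearMap.ker g ≤ A) (hg' : A ≤ LinearMap.ker g) :
    commCodim K A B + Module.finrank K (B.map f) =
      Module.finrank K (A.map f) + 2 * Module.finrank K (B.map g) := by
  have h1 := (relDim_add_finrank A B f hA).1
  have h2 := (relDim_add_finrank B A f hB).1
  have h3 := (relDim_add_finrank B A g hg).1
  have h4 : (B ⊓ A).map g = ⊥ := by
    rw [eq_bot_iff]
    rintro _ ⟨x, hx, rfl⟩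
    exact (Submodule.mem_bot _).2 (hg' hx.2)
  rw [h4, finrank_bot, add_zero] at h3
  rw [inf_comm] at h2
  rw [commCodim]
  omega

/-- A basis over `K` stays linearly independent over `F`. -/
theorem finrank_span_comp_eq {F : Type*} [Field F] (e : K →+* F) {P : Type*} [Finite P]
    (R : Submodule K (P → K)) :
    Module.finrank F (Submodule.span F ((fun f p => e (f p)) '' (R : Set (P → K)))) =
      Module.finrank K R := by
  let _ := e.toAlgebra
  let b := Module.finBasis K R
  have hb : LinearIndependent K fun i => (b i : P → K) :=
    b.linearIndependent.map' R.subtype R.ker_subtype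
  have hb' : LinearIndependent F fun i => ((fun p => e ((b i : P → K) p)) : P → F) :=
    (linearIndependent_algebraMap_comp_iff (S := F)).2 hb
  have hspan : Submodule.span F ((fun f p => e (f p)) '' (R : Set (P → K))) =
      Submodule.span F (Set.range fun i => ((fun p => e ((b i : P → K) p)) : P → F)) := by
    apply le_antisymm
    · rw [Submodule.span_le]
      rintro _ ⟨f, hf, rfl⟩
      have h1 : f = ∑ i, b.repr ⟨f, hf⟩ i • (b i : P → K) := by
        have := congrArg Subtype.val (b.sum_repr ⟨f, hf⟩)
        rw [Submodule.coe_sum] at this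
        exact this.symm
      have h2 : (fun p => e (f p)) = ∑ i, e (b.repr ⟨f, hf⟩ i) •
          ((fun p => e ((b i : P → K) p)) : P → F) := by
        funext p
        conv_lhs => rw [h1]
        simp
      change (fun p => e (f p)) ∈ _
      rw [h2]
      exact Submodule.sum_mem _ fun i _ => Submodule.smul_mem _ _ (Submodule.subset_span ⟨i, rfl⟩)
    · rw [Submodule.span_le]
      rintro _ ⟨i, rfl⟩
      exact Submodule.subset_span ⟨_, (b i).2, rfl⟩
  rw [hspan, finrank_span_eq_card hb', Fintype.card_fin]

end Codimension

/-! ### Spans over `F[[t]]` seen in a window -/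

section TruncatedSpans

variable {F : Type u} [Field F] {d : ℕ}

/-- A power series is a polynomial plus a multiple of a high power of `t`, and that multiple carries
`P` into `t^N F[[t]]ᵈ ⊆ P`. -/
theorem smul_mem_of_mulX_mem {M N : ℤ} {P : Submodule F (LaurentSpace F d)}
    (hN : (stdLattice F d N).restrictScalars F ≤ P)
    (hM : P ≤ (stdLattice F d M).restrictScalars F) (hX : ∀ v ∈ P, mulX F d v ∈ P) (f : F⟦X⟧)
    {v : LaurentSpace F d} (hv : v ∈ P) : f • v ∈ P := by
  have hpow : ∀ m : ℕ, (PowerSeries.X ^ m : F⟦X⟧) • v ∈ P := by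
    intro m
    induction m with
    | zero => rwa [pow_zero, one_smul]
    | succ m ih =>
      rw [pow_succ', mul_smul]
      exact hX _ ih
  have key : ∀ m : ℕ, ∃ p ∈ P, ∃ g : F⟦X⟧, f • v = p + (PowerSeries.X ^ m : F⟦X⟧) • g • v := by
    intro m
    induction m with
    | zero => exact ⟨0, zero_mem _, f, by rw [zero_add, pow_zero, one_smul]⟩
    | succ m ih =>
      obtain ⟨p, hp, g, hg⟩ := ih
      obtain ⟨a, g', rfl⟩ : ∃ a g', g = PowerSeries.C a + PowerSeries.X * g' :=
        ⟨_, smul_decomp g⟩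
      refine ⟨p + a • (PowerSeries.X ^ m : F⟦X⟧) • v, P.add_mem hp (P.smul_mem _ (hpow m)), g', ?_⟩
      rw [hg, ← C_smul_eq_pi]
      simp only [add_smul, smul_add, smul_smul, add_assoc]
      rw [mul_comm (PowerSeries.C a), pow_succ, mul_assoc]
  obtain ⟨p, hp, g, hg⟩ := key (N - M).toNat
  rw [hg]
  refine P.add_mem hp (hN (stdLattice_anti ?_
    (X_pow_smul_mem_stdLattice (n := M) (N - M).toNat (Submodule.smul_mem _ g (hM hv)))))
  omega

/-- Stability of `S` under `t` makes its span over `F` an `F[[t]]`-module up to vectors invisible in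
the window. -/
theorem map_window_span {n w : ℕ} {S : Set (LaurentSpace F d)}
    (hS : S ⊆ stdLattice F d (-n)) (hX : ∀ v ∈ S, mulX F d v ∈ S) :
    ((Submodule.span F⟦X⟧ S).restrictScalars F).map (window n w) =
      Submodule.span F (window n w '' S) := by
  let P : Submodule F (LaurentSpace F d) :=
    Submodule.span F S ⊔ (stdLattice F d (w - n)).restrictScalars F
  have hPX : ∀ v ∈ P, mulX F d v ∈ P := by
    have : P ≤ P.comap (mulX F d) := by
      refine sup_le (Submodule.span_le.2 fun v hv => ?_) fun v hv => ?_
      · exact Submodule.mem_sup_left (Submodule.subset_span (hX v hv))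
      · exact Submodule.mem_sup_right (stdLattice_anti (by omega) (mulX_mem hv))
    exact this
  have hPM : P ≤ (stdLattice F d (-n)).restrictScalars F :=
    sup_le (Submodule.span_le.2 hS) (stdLattice_anti (by omega))
  let P' : TLattice F d :=
    { P.toAddSubmonoid with
      smul_mem' := fun f v hv => smul_mem_of_mulX_mem le_sup_right hPM hPX f hv }
  have hle : Submodule.span F⟦X⟧ S ≤ P' := by
    rw [Submodule.span_le]
    exact fun v hv => Submodule.mem_sup_left (Submodule.subset_span hv)
  rw [← Submodule.map_span]
  apply le_antisymm
  · rintro _ ⟨v, hv, rfl⟩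
    obtain ⟨s, hs, r, hr, rfl⟩ := Submodule.mem_sup.1 (hle hv)
    refine ⟨s, hs, ?_⟩
    rw [map_add, (window_eq_zero_iff (stdLattice_anti (by omega) hr)).2 hr, add_zero]
  · refine Submodule.map_mono (Submodule.span_le.2 fun v hv => ?_)
    exact Submodule.subset_span hv

end TruncatedSpans

/-! ### From subalgebras over a finite extension to lattices over `F` -/

section GeometricLattices

variable {k : Type u} [Field k] {d : ℕ}
variable {𝔏 : Type w} [LieRing 𝔏] [LieAlgebra k 𝔏] [LieAlgebra k⟦X⟧ 𝔏] [IsScalarTower k k⟦X⟧ 𝔏]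
variable {F : Type u} [Field F] [Algebra k F]
variable (coords : 𝔏 →ₗ[k⟦X⟧] LaurentSpace k d)
variable {K : Type u} [Field K] [Algebra k K] (e : K →ₐ[k] F)

variable (k 𝔏 K) in
/-- The action of `k[[t]]` on `K ⊗ 𝔏`. -/
def seriesAct : k⟦X⟧ →ₐ[k] Module.End K (K ⊗[k] 𝔏) :=
  (Module.End.baseChangeHom k K 𝔏).comp (Algebra.lsmul k k 𝔏)

theorem seriesAct_tmul (f : k⟦X⟧) (c : K) (x : 𝔏) :
    seriesAct k 𝔏 K f (c ⊗ₜ x) = c ⊗ₜ (f • x) := rfl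

variable (K) in
/-- The coefficients of the coordinates of an element of `K ⊗ 𝔏`. -/
def tensorCoeff (a : Fin d × ℤ) : K ⊗[k] 𝔏 →ₗ[K] K :=
  (TensorProduct.AlgebraTensorModule.rid k K K).toLinearMap ∘ₗ
    LinearMap.baseChange K (coeffAt a ∘ₗ coords.restrictScalars k)

theorem tensorCoeff_tmul (a : Fin d × ℤ) (c : K) (x : 𝔏) :
    tensorCoeff coords K a (c ⊗ₜ x) = coeffAt a (coords x) • c := by
  simp [tensorCoeff]

theorem coeffAt_geomMap (a : Fin d × ℤ) (v : K ⊗[k] 𝔏) :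
    coeffAt a (geomMap coords e v) = e (tensorCoeff coords K a v) := by
  induction v using TensorProduct.induction_on with
  | zero => simp
  | add v w hv hw => rw [map_add, map_add, map_add, map_add, hv, hw]
  | tmul c x =>
    rw [tensorCoeff_tmul, map_smul, Algebra.smul_def, mul_comm]
    simp [geomMap, coeffAt_apply]

theorem tensorCoeff_seriesAct_X_pow (n : ℕ) (a : Fin d × ℤ) (v : K ⊗[k] 𝔏) :
    tensorCoeff coords K a (seriesAct k 𝔏 K (PowerSeries.X ^ n) v) =
      tensorCoeff coords K (a.1, a.2 - n) v := by
  induction v using TensorProduct.induction_on with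
  | zero => simp
  | add v w hv hw => rw [map_add, map_add, map_add, hv, hw]
  | tmul c x =>
    rw [seriesAct_tmul, tensorCoeff_tmul, tensorCoeff_tmul, map_smul, coeffAt_X_pow_smul]

theorem geomMap_seriesAct_X_pow (n : ℕ) (v : K ⊗[k] 𝔏) :
    geomMap coords e (seriesAct k 𝔏 K (PowerSeries.X ^ n) v) =
      (PowerSeries.X ^ n : F⟦X⟧) • geomMap coords e v :=
  ext_coeffAt fun a => by
    rw [coeffAt_geomMap, tensorCoeff_seriesAct_X_pow, coeffAt_X_pow_smul, coeffAt_geomMap]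

/-- The elements of `𝔏` with coordinates in `t ^ m k[[t]]`. -/
def coordLattice (m : ℤ) : Submodule k 𝔏 := ((stdLattice k d m).comap coords).restrictScalars k

theorem mem_coordLattice {m : ℤ} {x : 𝔏} :
    x ∈ coordLattice coords m ↔ coords x ∈ stdLattice k d m := Iff.rfl

theorem seriesAct_mem_baseChange {m : ℤ} (f : k⟦X⟧) :
    ∀ v ∈ (coordLattice coords m).baseChange K,
      seriesAct k 𝔏 K f v ∈ (coordLattice coords m).baseChange K := by
  suffices (coordLattice coords m).baseChange K ≤
      ((coordLattice coords m).baseChange K).comap (seriesAct k 𝔏 K f) from this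
  conv_lhs => rw [Submodule.baseChange_eq_span]
  rw [Submodule.span_le]
  rintro _ ⟨x, hx, rfl⟩
  refine Submodule.tmul_mem_baseChange_of_mem _ ?_
  change coords (f • x) ∈ stdLattice k d m
  rw [map_smul]
  exact Submodule.smul_mem _ _ hx

/-- For the converse, expand `v` along a basis of `K` over `k`: the vanishing of a coefficient of
`v` means its vanishing for each component. -/
theorem mem_baseChange_coordLattice [FiniteDimensional k K] {m : ℤ} {v : K ⊗[k] 𝔏} :
    v ∈ (coordLattice coords m).baseChange K ↔
      ∀ a : Fin d × ℤ, a.2 < m → tensorCoeff coords K a v = 0 := by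
  constructor
  · intro hv a ha
    have h : (coordLattice coords m).baseChange K ≤ LinearMap.ker (tensorCoeff coords K a) := by
      rw [Submodule.baseChange_eq_span, Submodule.span_le]
      rintro _ ⟨x, hx, rfl⟩
      change tensorCoeff coords K a (1 ⊗ₜ x) = 0
      rw [tensorCoeff_tmul, mem_stdLattice_iff.1 hx a ha, zero_smul]
    exact h hv
  · intro h
    let b := Module.finBasis k K
    obtain ⟨c, rfl⟩ := TensorProduct.eq_repr_basis_left b v
    rw [Finsupp.sum_fintype _ _ fun _ => TensorProduct.tmul_zero _ _] at h ⊢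
    refine Submodule.sum_mem _ fun i _ => Submodule.tmul_mem_baseChange_of_mem _ ?_
    refine mem_stdLattice_iff.2 fun a ha => ?_
    have h1 := h a ha
    simp only [map_sum, tensorCoeff_tmul] at h1
    exact Fintype.linearIndependent_iff.1 b.linearIndependent _ h1 i

/-- Dividing the coordinates by `tⁿ` leaves them integral, and integral vectors are coordinates of
elements of `𝔏`. -/
theorem exists_seriesAct_X_pow_eq (hinj : Function.Injective coords)
    (hrange : stdLattice k d 0 ≤ LinearMap.range coords) {n : ℕ} {v : K ⊗[k] 𝔏}
    (hv : v ∈ (coordLattice coords n).baseChange K) :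
    ∃ u ∈ (coordLattice coords 0).baseChange K, seriesAct k 𝔏 K (PowerSeries.X ^ n) u = v := by
  suffices h : (coordLattice coords n).baseChange K ≤
      ((coordLattice coords 0).baseChange K).map (seriesAct k 𝔏 K (PowerSeries.X ^ n)) from h hv
  conv_lhs => rw [Submodule.baseChange_eq_span]
  rw [Submodule.span_le]
  rintro _ ⟨x, hx, rfl⟩
  obtain ⟨y, hy, hxy⟩ := exists_X_pow_smul_of_mem (n := 0) (m := n) (v := coords x)
    (by rw [zero_add]; exact hx)
  obtain ⟨z, rfl⟩ := hrange hy
  refine ⟨1 ⊗ₜ z, Submodule.tmul_mem_baseChange_of_mem _ hy, ?_⟩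
  have hxz : x = (PowerSeries.X ^ n : k⟦X⟧) • z := hinj (by rw [hxy, map_smul])
  rw [seriesAct_tmul, ← hxz]
  rfl

theorem geomLattice_le [FiniteDimensional k K] {m : ℤ} {S : Submodule K (K ⊗[k] 𝔏)}
    (hS : S ≤ (coordLattice coords m).baseChange K) :
    geomLattice coords e S ≤ stdLattice F d m := by
  refine Submodule.span_le.2 ?_
  rintro _ ⟨v, hv, rfl⟩
  refine mem_stdLattice_iff.2 fun a ha => ?_
  rw [coeffAt_geomMap, (mem_baseChange_coordLattice coords).1 (hS hv) a ha, map_zero]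

theorem le_geomLattice (hrange : stdLattice k d 0 ≤ LinearMap.range coords) {n : ℕ}
    {S : Submodule K (K ⊗[k] 𝔏)} (hS : ∀ v ∈ (coordLattice coords 0).baseChange K,
      seriesAct k 𝔏 K (PowerSeries.X ^ n) v ∈ S) :
    stdLattice F d n ≤ geomLattice coords e S := by
  classical
  refine Submodule.span_le.2 ?_
  rintro _ ⟨i, rfl⟩
  have hmem : (monoVec (i, 0) : LaurentSpace k d) ∈ stdLattice k d 0 :=
    monoVec_mem_stdLattice le_rfl
  obtain ⟨z, hz⟩ := hrange hmem
  have h1 : (1 : K) ⊗ₜ[k] z ∈ (coordLattice coords 0).baseChange K :=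
    Submodule.tmul_mem_baseChange_of_mem _ (by rw [mem_coordLattice, hz]; exact hmem)
  refine Submodule.subset_span ⟨_, hS _ h1, ?_⟩
  change _ = monoVec (i, (n : ℤ))
  refine ext_coeffAt fun a => ?_
  rw [coeffAt_geomMap, tensorCoeff_seriesAct_X_pow, tensorCoeff_tmul, hz, coeffAt_monoVec,
    coeffAt_monoVec]
  have : (a.1, a.2 - (n : ℤ)) = (i, 0) ↔ a = (i, (n : ℤ)) := by
    rw [Prod.ext_iff, Prod.ext_iff]
    simp only [sub_eq_zero]
  simp only [this]
  split_ifs <;> simp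

variable (K) in
/-- The coefficients of the coordinates between `t ^ (-n)` and `t ^ (w - n)`. -/
def tensorWindow (n w : ℕ) : K ⊗[k] 𝔏 →ₗ[K] (Fin d × Fin w → K) :=
  LinearMap.pi fun p => tensorCoeff coords K (pos n p)

theorem window_geomMap (n w : ℕ) (v : K ⊗[k] 𝔏) :
    window n w (geomMap coords e v) = fun p => e (tensorWindow coords K n w v p) :=
  funext fun p => coeffAt_geomMap coords e (pos n p) v

theorem tensorWindow_eq_zero_iff [FiniteDimensional k K] {n w : ℕ} {v : K ⊗[k] 𝔏}
    (hv : v ∈ (coordLattice coords (-n)).baseChange K) :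
    tensorWindow coords K n w v = 0 ↔ v ∈ (coordLattice coords (w - n)).baseChange K := by
  rw [mem_baseChange_coordLattice] at hv ⊢
  constructor
  · intro h a ha
    rcases lt_or_ge a.2 (-n) with h1 | h1
    · exact hv a h1
    · obtain ⟨p, rfl⟩ := exists_pos_eq h1 ha
      exact congrFun h p
  · intro h
    funext p
    refine h _ ?_
    have := p.2.2
    simp only [pos]
    omega

/-- In the window, the lattice is the `F`-span of the image under `e` of a `K`-subspace, whose
dimension is preserved. -/
theorem finrank_map_window_geomLattice [FiniteDimensional k K] {n : ℕ} (w : ℕ)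
    {S : Submodule K (K ⊗[k] 𝔏)} (hS : S ≤ (coordLattice coords (-n)).baseChange K)
    (hX : ∀ f, ∀ v ∈ S, seriesAct k 𝔏 K f v ∈ S) :
    Module.finrank F (((geomLattice coords e S).restrictScalars F).map (window n w)) =
      Module.finrank K (S.map (tensorWindow coords K n w)) := by
  have h1 : geomMap coords e '' S ⊆ stdLattice F d (-n) :=
    fun v hv => geomLattice_le coords e hS (Submodule.subset_span hv)
  have hset : window n w '' (geomMap coords e '' S) =
      (fun (f : Fin d × Fin w → K) p => (e : K →+* F) (f p)) ''
        ((S.map (tensorWindow coords K n w) : Submodule K (Fin d × Fin w → K)) :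
          Set (Fin d × Fin w → K)) := by
    ext f
    constructor
    · rintro ⟨_, ⟨v, hv, rfl⟩, rfl⟩
      exact ⟨_, ⟨v, hv, rfl⟩, (window_geomMap coords e n w v).symm⟩
    · rintro ⟨_, ⟨v, hv, rfl⟩, rfl⟩
      exact ⟨_, ⟨v, hv, rfl⟩, window_geomMap coords e n w v⟩
  rw [geomLattice, map_window_span h1, hset, finrank_span_comp_eq]
  · rintro _ ⟨v, hv, rfl⟩
    refine ⟨_, hX PowerSeries.X v hv, ?_⟩
    have := geomMap_seriesAct_X_pow coords e 1 v
    rwa [pow_one, pow_one] at this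

variable {coords}

theorem le_baseChange_coordLattice [FiniteDimensional k K] {S : Submodule K (K ⊗[k] 𝔏)} {n : ℕ}
    (h : ∀ v ∈ S, seriesAct k 𝔏 K (PowerSeries.X ^ n) v ∈ (coordLattice coords 0).baseChange K) :
    S ≤ (coordLattice coords (-n)).baseChange K := by
  intro v hv
  refine (mem_baseChange_coordLattice coords).2 fun a ha => ?_
  have := (mem_baseChange_coordLattice coords).1 (h v hv) (a.1, a.2 + n) (by simp only; omega)
  rwa [tensorCoeff_seriesAct_X_pow, add_sub_cancel_right] at this

theorem baseChange_coordLattice_anti [FiniteDimensional k K] {m n : ℤ} (h : m ≤ n) :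
    (coordLattice coords n).baseChange K ≤ (coordLattice coords m).baseChange K := fun _ hv =>
  (mem_baseChange_coordLattice coords).2 fun a ha =>
    (mem_baseChange_coordLattice coords).1 hv a (by omega)

variable [FiniteDimensional k K] {S : Submodule K (K ⊗[k] 𝔏)}

theorem geomLattice_coordLattice (hrange : stdLattice k d 0 ≤ LinearMap.range coords) :
    geomLattice coords e ((coordLattice coords 0).baseChange K) = stdLattice F d 0 := by
  refine le_antisymm (geomLattice_le coords e le_rfl) ?_
  have := le_geomLattice (F := F) (n := 0) coords e hrange (S := (coordLattice coords 0).baseChange K)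
    fun v hv => seriesAct_mem_baseChange coords _ v hv
  simpa using this

theorem seriesAct_X_pow_mem_of_commCodim_le (hX : ∀ f, ∀ v ∈ S, seriesAct k 𝔏 K f v ∈ S)
    (hcomm : Commensurable K ((integralPart coords).baseChange K) S) {n : ℕ}
    (hn : commCodim K ((integralPart coords).baseChange K) S ≤ n) :
    (∀ v ∈ (coordLattice coords 0).baseChange K, seriesAct k 𝔏 K (PowerSeries.X ^ n) v ∈ S) ∧
      ∀ v ∈ S, seriesAct k 𝔏 K (PowerSeries.X ^ n) v ∈ (coordLattice coords 0).baseChange K :=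
  ⟨map_X_pow_apply_mem _ (seriesAct_mem_baseChange coords) hX hcomm.1 (le_of_add_le_left hn),
    map_X_pow_apply_mem _ hX (seriesAct_mem_baseChange coords) hcomm.2 (le_of_add_le_right hn)⟩

/-- Codimension at most `n` means that `tⁿ` carries the integral part into `S` and `S` into the
integral part. This is the source of stability. -/
theorem geomLattice_mem_Gr (hrange : stdLattice k d 0 ≤ LinearMap.range coords)
    (hX : ∀ f, ∀ v ∈ S, seriesAct k 𝔏 K f v ∈ S)
    (hcomm : Commensurable K ((integralPart coords).baseChange K) S) {n : ℕ}
    (hn : commCodim K ((integralPart coords).baseChange K) S ≤ n) :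
    geomLattice coords e S ∈ Gr F d n := by
  obtain ⟨h1, h2⟩ := seriesAct_X_pow_mem_of_commCodim_le hX hcomm hn
  exact ⟨le_geomLattice coords e hrange h1,
    geomLattice_le coords e (le_baseChange_coordLattice h2)⟩

/-- Over `K` and over `F` the codimension is given by the same formula in ranks of windows, and
these ranks agree. -/
theorem latticeCodim_geomLattice (hinj : Function.Injective coords)
    (hrange : stdLattice k d 0 ≤ LinearMap.range coords)
    (hX : ∀ f, ∀ v ∈ S, seriesAct k 𝔏 K f v ∈ S)
    (hcomm : Commensurable K ((integralPart coords).baseChange K) S) :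
    latticeCodim (geomLattice coords e S) =
      commCodim K ((integralPart coords).baseChange K) S := by
  obtain ⟨n, hn⟩ : ∃ n, commCodim K ((integralPart coords).baseChange K) S ≤ n := ⟨_, le_rfl⟩
  obtain ⟨h1, h2⟩ := seriesAct_X_pow_mem_of_commCodim_le hX hcomm hn
  have hS := le_baseChange_coordLattice h2
  have h0 : (coordLattice coords 0).baseChange K ≤ (coordLattice coords (-n)).baseChange K :=
    baseChange_coordLattice_anti (by omega)
  obtain ⟨hG, hG'⟩ := geomLattice_mem_Gr e hrange hX hcomm hn
  have hO : stdLattice F d 0 ≤ stdLattice F d (-n) := stdLattice_anti (by omega)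
  have e1 : (((2 * n : ℕ) : ℤ) - n) = n := by push_cast; ring
  have e2 : ((n : ℤ) - n) = 0 := sub_self _
  -- The window of width `2n` sees the exponents from `-n` to `n - 1`. The window of width `n` sees
  -- only the negative exponents, so it kills exactly the integral vectors.
  have hK := commCodim_add_finrank ((coordLattice coords 0).baseChange K) S
    (tensorWindow coords K n (2 * n)) (tensorWindow coords K n n)
    (fun v hv => by
      have := (tensorWindow_eq_zero_iff coords (h0 hv.1)).1 hv.2
      rw [e1] at this
      obtain ⟨u, hu, rfl⟩ := exists_seriesAct_X_pow_eq coords hinj hrange this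
      exact h1 u hu)
    (fun v hv => by
      have := (tensorWindow_eq_zero_iff coords (hS hv.1)).1 hv.2
      exact baseChange_coordLattice_anti (by omega) this)
    (fun v hv => by
      have := (tensorWindow_eq_zero_iff coords (hS hv.1)).1 hv.2
      rwa [e2] at this)
    (fun v hv => (tensorWindow_eq_zero_iff coords (h0 hv)).2 (by rwa [e2]))
  have hF := commCodim_add_finrank ((stdLattice F d 0).restrictScalars F)
    ((geomLattice coords e S).restrictScalars F) (window n (2 * n)) (window n n)
    (fun v hv => by
      have := (window_eq_zero_iff (hO hv.1)).1 hv.2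
      rw [e1] at this
      exact hG this)
    (fun v hv => by
      have := (window_eq_zero_iff (hG' hv.1)).1 hv.2
      exact stdLattice_anti (by omega) this)
    (fun v hv => by
      have := (window_eq_zero_iff (hG' hv.1)).1 hv.2
      rwa [e2] at this)
    (fun v hv => (window_eq_zero_iff (hO hv)).2 (by rw [e2]; exact hv))
  rw [← geomLattice_coordLattice (F := F) e hrange,
    finrank_map_window_geomLattice coords e _ hS hX,
    finrank_map_window_geomLattice coords e _ hS hX,
    finrank_map_window_geomLattice coords e _ h0 (seriesAct_mem_baseChange coords),
    geomLattice_coordLattice e hrange] at hF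
  have hF' : latticeCodim (geomLattice coords e S) + _ = _ := hF
  have hK' : commCodim K ((integralPart coords).baseChange K) S + _ = _ := hK
  omega

end GeometricLattices

/-! ### Stability and the zeta function as an integral -/

section MotivicZeta

variable {k : Type u} [Field k] {F : Type u} [Field F] [Algebra k F] {d : ℕ}

theorem index_bounds {n : ℕ} {H : TLattice F d} (hH : H ∈ Gr F d n) :
    index H ∈ Set.Icc (-((n : ℤ) * d)) (n * d) := by
  have h := coDim_add_finrank (n := n) (N := n) (w := 2 * n) (H := H)
    (by convert hH.1 using 2; push_cast; ring) hH.2 le_rfl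
  have h1 : coDim n H ≤ d * (2 * n) := by omega
  have h2 : ((coDim n H : ℕ) : ℤ) ≤ ((d * (2 * n) : ℕ) : ℤ) := by exact_mod_cast h1
  push_cast at h2
  rw [index_eq hH, Set.mem_Icc]
  constructor <;> linarith

theorem GrStable.sep_index {n : ℕ} {A : Set (TLattice F d)} (hA : GrStable k n A) (j : ℤ) :
    GrStable k n {H ∈ A | index H * d = j} :=
  hA.sep (fun H => index H * d = j)
    (fun I => ((n : ℤ) * d - Fintype.card (Iᶜ : Finset _)) * d = j) fun H hH I c hc => by
      rw [← index_eq_of_grChart hH hc]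

/-- On a chart with index `m` only `j = md` contributes, and there `𝐋ʲ` cancels the weight
`𝐋^(-md)`, leaving the plain class. -/
theorem GrStable.finsum_lefPow_mul_grMeasure [IsAlgClosed F] {n : ℕ} {A : Set (TLattice F d)}
    (hA : GrStable k n A) :
    ∑ᶠ j : ℤ, lefPow k j * grMeasure k {H ∈ A | index H * d = j} =
      algebraMap (GrothendieckRing k) (GrothendieckRingLoc k) (grClass k n A) := by
  classical
  obtain ⟨X, hX⟩ := hA.exists_presentation
  let m : Finset (Fin d × Fin (2 * n)) → ℤ := fun I =>
    ((n : ℤ) * d - Fintype.card (Iᶜ : Finset _)) * d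
  have hterm : ∀ j : ℤ, lefPow k j * grMeasure k {H ∈ A | index H * d = j} =
      ∑ I, if m I = j then
        algebraMap (GrothendieckRing k) (GrothendieckRingLoc k) (affineClass k (X I)) else 0 := by
    intro j
    have hpres := hX.sep hA.1 (fun H => index H * d = j) (fun I => m I = j) fun H hH I c hc => by
      rw [index_eq_of_grChart hH hc]
    rw [grMeasure_eq_sum (hA.sep_index j) hpres, Finset.mul_sum]
    refine Finset.sum_congr rfl fun I _ => ?_
    split_ifs with hm
    · rw [mul_left_comm, ← lefPow_add, ← hm, add_neg_cancel, lefPow_zero, mul_one]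
    · rw [affineClass_empty, map_zero, zero_mul, mul_zero]
  simp only [hterm]
  rw [finsum_eq_sum_of_support_subset (s := Finset.univ.image m), Finset.sum_comm,
    grClass_eq_sum hX, map_sum]
  · refine Finset.sum_congr rfl fun I _ => ?_
    rw [Finset.sum_ite_eq, if_pos (Finset.mem_image_of_mem _ (Finset.mem_univ I))]
  · intro j hj
    obtain ⟨I, -, hI⟩ := Finset.exists_ne_zero_of_sum_ne_zero (Function.mem_support.1 hj)
    have hm : m I = j := by
      by_contra hne
      exact hI (if_neg hne)
    exact Finset.mem_coe.2 (Finset.mem_image.2 ⟨I, Finset.mem_univ I, hm⟩)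

namespace SubalgebraClass

variable {𝔏 : Type w} [LieRing 𝔏] [LieAlgebra k 𝔏] [LieAlgebra k⟦X⟧ 𝔏] [IsScalarTower k k⟦X⟧ 𝔏]
variable {coords : 𝔏 →ₗ[k⟦X⟧] LaurentSpace k d} (𝒳 : SubalgebraClass coords)

theorem levelSet_eq_of_le (hrange : stdLattice k d 0 ≤ LinearMap.range coords) {l n : ℕ}
    (h : n ≤ l) : 𝒳.levelSet F l n = 𝒳.levelSet F n n := by
  ext Λ
  constructor
  · rintro ⟨-, K, hK, hkK, hfin, e, H, hH, hn, rfl⟩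
    exact ⟨geomLattice_mem_Gr e hrange (𝒳.smul_mem K H hH) (𝒳.commensurable K H hH) hn.le,
      K, hK, hkK, hfin, e, H, hH, hn, rfl⟩
  · rintro ⟨hΛ, h'⟩
    exact ⟨Gr_mono h hΛ, h'⟩

theorem stableFrom (hrange : stdLattice k d 0 ≤ LinearMap.range coords) (n : ℕ) :
    𝒳.StableFrom F n n := fun _ hj => (𝒳.levelSet_eq_of_le hrange hj).symm

/-- A point of codimension `n` lies automatically in `Gr_(n)`, and its codimension is the same on
the Lie algebra side and on the lattice side. -/
theorem setOf_latticeCodim_eq (hinj : Function.Injective coords)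
    (hrange : stdLattice k d 0 ≤ LinearMap.range coords) (n : ℕ) (j : ℤ) :
    {H ∈ 𝒳.points F | index H * d = j ∧ latticeCodim H = n} =
      {H ∈ 𝒳.levelSet F n n | index H * d = j} := by
  ext Λ
  constructor
  · rintro ⟨⟨K, hK, hkK, hfin, e, H, hH, rfl⟩, hj, hn⟩
    rw [latticeCodim_geomLattice e hinj hrange (𝒳.smul_mem K H hH) (𝒳.commensurable K H hH)] at hn
    exact ⟨⟨geomLattice_mem_Gr e hrange (𝒳.smul_mem K H hH) (𝒳.commensurable K H hH) hn.le,
      K, hK, hkK, hfin, e, H, hH, hn, rfl⟩, hj⟩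
  · rintro ⟨⟨-, K, hK, hkK, hfin, e, H, hH, hn, rfl⟩, hj⟩
    refine ⟨⟨K, hK, hkK, hfin, e, H, hH, rfl⟩, hj, ?_⟩
    rw [latticeCodim_geomLattice e hinj hrange (𝒳.smul_mem K H hH) (𝒳.commensurable K H hH), hn]

theorem finite_setOf_nonempty (hinj : Function.Injective coords)
    (hrange : stdLattice k d 0 ≤ LinearMap.range coords) (n : ℕ) :
    {j : ℤ | {H ∈ 𝒳.points F | index H * d = j ∧ latticeCodim H = n}.Nonempty}.Finite := by
  refine ((Set.finite_Icc (-((n : ℤ) * d)) (n * d)).image fun m : ℤ => m * (d : ℤ)).subset ?_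
  rintro j ⟨H, hH⟩
  rw [𝒳.setOf_latticeCodim_eq hinj hrange] at hH
  exact ⟨index H, index_bounds hH.1.1, hH.2⟩

theorem map_zeta_eq_grIntegral [IsAlgClosed F] (hinj : Function.Injective coords)
    (hrange : stdLattice k d 0 ≤ LinearMap.range coords) (h : 𝒳.IsConstructible F) :
    PowerSeries.map (algebraMap (GrothendieckRing k) (GrothendieckRingLoc k)) (𝒳.zeta F) =
      grIntegral k (𝒳.points F) (fun H => index H * d) latticeCodim := by
  classical
  ext n
  have hex : ∃ l, 𝒳.StableFrom F n l := ⟨n, 𝒳.stableFrom hrange n⟩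
  have hset : 𝒳.levelSet F (Nat.find hex) n = 𝒳.levelSet F n n :=
    Nat.find_spec hex n (Nat.find_min' hex (𝒳.stableFrom hrange n))
  rw [PowerSeries.coeff_map, zeta, grIntegral, PowerSeries.coeff_mk, PowerSeries.coeff_mk,
    dif_pos hex]
  simp only [𝒳.setOf_latticeCodim_eq hinj hrange]
  rw [(h n n).finsum_lefPow_mul_grMeasure, hset]
  congr 1
  -- The least stable level chosen by `zeta` may be smaller than `n`; the set is the same and its
  -- class does not depend on the level.
  refine GrStable.grClass_eq ?_ (h n n)
  rw [← hset]
  exact h _ n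

end SubalgebraClass

end MotivicZeta

end MotivicGr
end

theorem mainTheorem12 {k F : Type u} [Field k] [CharZero k] [Field F] [Algebra k F]
    [IsAlgClosure k F] (d : ℕ) (hd : 0 < d) :
    -- the comparison of the two motivic measures
    (∀ (n : ℕ) (A : Set (TLattice F d)), GrStable k n A →
      IsCylindrical k n (2 * n) (Theta ⁻¹' A) ∧
      arcMeasure k (Theta ⁻¹' A) =
        (∏ i ∈ Finset.Icc 1 d, (1 - lefPow k (-(i : ℤ)))) * grMeasure k A ∧
      ∀ (R : Type v) [CommRing R] (f : GrothendieckRingLoc k →+* R),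
        (∀ i ∈ Finset.Icc 1 d, IsUnit (f (1 - lefPow k (-(i : ℤ))))) →
        f (grMeasure k A) =
          (∏ i ∈ Finset.Icc 1 d, Ring.inverse (f (1 - lefPow k (-(i : ℤ))))) *
            f (arcMeasure k (Theta ⁻¹' A))) ∧
    -- the motivic zeta function as an integral over the infinite Grassmannian
    (∀ (𝔏 : Type w) [LieRing 𝔏] [LieAlgebra k 𝔏] [LieAlgebra (PowerSeries k) 𝔏]
      [IsScalarTower k (PowerSeries k) 𝔏]
      (coords : 𝔏 →ₗ[PowerSeries k] LaurentSpace k d),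
      Function.Injective coords → stdLattice k d 0 ≤ LinearMap.range coords →
      ∀ 𝒳 : SubalgebraClass coords, 𝒳.IsConstructible F →
        𝒳.IsStable F ∧
        (∀ (n : ℕ) (j : ℤ), ∃ l,
          GrStable k l {H ∈ 𝒳.points F | index H * d = j ∧ latticeCodim H = n}) ∧
        (∀ n : ℕ, {j : ℤ | {H ∈ 𝒳.points F | index H * d = j ∧ latticeCodim H = n}.Nonempty}.Finite) ∧
        PowerSeries.map (algebraMap (GrothendieckRing k) (GrothendieckRingLoc k)) (𝒳.zeta F) =
          grIntegral k (𝒳.points F) (fun H => index H * d) latticeCodim) := by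
  have := IsAlgClosure.isAlgClosed (R := k) (K := F)
  refine ⟨fun n A hA => ?_, fun 𝔏 _ _ _ _ coords hinj hrange 𝒳 h𝒳 => ⟨?_, ?_, ?_, ?_⟩⟩
  · have h := hasArcMeasure_preimage_Theta hA
    refine ⟨h.isCylindrical, h.arcMeasure_eq, fun R _ f hf => ?_⟩
    exact map_eq_prod_inverse_mul f _ _ hf h.arcMeasure_eq
  · exact fun n => ⟨n, 𝒳.stableFrom hrange n⟩
  · intro n j
    rw [𝒳.setOf_latticeCodim_eq hinj hrange]
    exact ⟨n, (h𝒳 n n).sep_index j⟩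
  · exact 𝒳.finite_setOf_nonempty hinj hrange
  · exact 𝒳.map_zeta_eq_grIntegral hinj hrange h𝒳
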